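/- **Setting.** Let $G$ be a toroidal grid diagram of grid number $n$: an $n\times n$ grid on the torus in which every row and every column contains exactly one $O$ and exactly one $X$, in different squares. Let $O_1,\dots,O_n$ be the $O$'s, and let $1,\dots,\ell$ number the components of the link it presents. Let $c$ be a vertical circle $\beta$ of $G$, and suppose that the $O$ and the $X$ of the column to the right of $\beta$ lie on one of the two (closed) arcs into which the $O$ and the $X$ of the column to the left of $\beta$ cut the vertical circle. Let $H$ be the diagram obtained by switching the decorations of these two columns (a commutation move); each $O_i$ and each $X_i$ stays in its row and on its link component. Draw both diagrams on one torus, replacing $\beta$ by a curve $\gamma$ which stays within the two columns next to $\beta$, meets each horizontal circle once, and meets $\beta$ transversally in two points $a,b$, neither on a horizontal circle, such that one of the two bigons between $\beta$ and $\gamma$ lies to the left of $\beta$ and contains the two decorations of the left column, and the other one lies to the right of $\beta$ and contains the two decorations of the right column. Here $a$ is the point at which $\gamma$, going upwards, passes from the left to the right of $\beta$. **Complexes.** For $k=\mathbb F_2$ or $k=\mathbb Z$ let $C(G)$ be the free $k[U_1,\dots,U_n]$-module on the set $\mathbf S(G)$ of one-to-one correspondences between horizontal and vertical circles, viewed as $n$-tuples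 of intersection points. Let $\mathrm{Rect}^\circ(\mathbf x,\mathbf y)$ be the set of embedded rectangles from $\mathbf x$ to $\mathbf y$ (lower left and upper right corner in $\mathbf x$, the other two in $\mathbf y$, and $\mathbf x=\mathbf y$ elsewhere) with no point of $\mathbf x$ in the interior. Over $\mathbb F_2$, $$\partial \mathbf x=\sum_{\mathbf y}\sum_{r\in \mathrm{Rect}^\circ(\mathbf x,\mathbf y)}U_1^{O_1(r)}\cdots U_n^{O_n(r)}\,\mathbf y ,$$ where $O_i(r)$ is $1$ if $O_i\in r$ and $0$ otherwise. Over $\mathbb Z$ each term gets the sign $\mathcal S(r)$, where $\mathcal S:\mathrm{Rect}^\circ\to\{\pm1\}$ is a sign assignment: $\mathcal S(r_1)\mathcal S(r_2)=-\mathcal S(r_1')\mathcal S(r_2')$ if $r_1*r_2=r_1'*r_2'$ are two different decompositions of a domain, and $\mathcal S(r_1)\mathcal S(r_2)$ is $-1$ if $r_1*r_2$ is a vertical annulus and $+1$ if it is a horizontal annulus. The same $\mathcal S$ is used for $H$, where $\mathbf S(H)$ is identified with $\mathbf S(G)$ by sliding points horizontally between $\gamma$ and $\beta$. For finite sets of points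 of the plane let $\mathcal I(A,B)$ be the number of $(p,q)\in A\times B$ with $p_1<q_1$ and $p_2<q_2$, and extend $\mathcal J(A,B)=\frac12(\mathcal I(A,B)+\mathcal I(B,A))$ bilinearly to formal sums. In the fundamental domain $[0,n)^2$, in which generators have integer coordinates and decorations half-integer ones, the Maslov grading is $M(\mathbf x)=\mathcal J(\mathbf x-\mathbb O,\mathbf x-\mathbb O)+1$, and the Alexander gradings are $A_j(\mathbf x)=\mathcal J(\mathbf x-\frac12(\mathbb X+\mathbb O),\mathbb X_j-\mathbb O_j)-\frac{n_j-1}2$, $1\le j\le\ell$. Here $\mathbb X,\mathbb O$ are the sets of all $X$'s and all $O$'s, $\mathbb X_j,\mathbb O_j$ are the subsets on component $j$, and $n_j=|\mathbb O_j|$. The element $U_1^{m_1}\cdots U_n^{m_n}\mathbf x$ has degree $M(\mathbf x)-2\sum_i m_i$ and filtration level $\big(A_j(\mathbf x)-\sum_{O_i\in\mathbb O_j}m_i\big)_j\in\mathbb Q^\ell$. **Maps.** A pentagon in $\mathrm{Pent}_{\beta\gamma}(\mathbf x,\mathbf y)$, for $\mathbf x\in\mathbf S(G)$ and $\mathbf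 y\in\mathbf S(H)$ that coincide at $n-2$ points, is an embedded disk with five edges on horizontal and vertical circles and all angles less than straight, whose oriented boundary goes from the $\beta$-component of $\mathbf x$ along a horizontal circle to $\mathbf y$, along a vertical circle to $\mathbf x$, along a horizontal circle to the $\gamma$-component of $\mathbf y$, along $\gamma$ to a point of $\beta\cap\gamma$ (necessarily $a$), and along $\beta$ back. A hexagon in $\mathrm{Hex}_{\beta\gamma\beta}(\mathbf x,\mathbf y)$, for $\mathbf x,\mathbf y\in\mathbf S(G)$, is defined in the same way, except that the last part of the boundary goes from the $\beta$-component of $\mathbf y$ along $\beta$ to $b$, along $\gamma$ to $a$, and along $\beta$ back to $\mathbf x$. Polygons are empty if their interior contains no point of $\mathbf x$. Let $$\Phi_{\beta\gamma}(\mathbf x)=\sum_{\mathbf y\in\mathbf S(H)}\sum_{p}\epsilon(p)\,U_1^{O_1(p)}\cdots U_n^{O_n(p)}\,\mathbf y,\qquad H_{\beta\gamma\beta}(\mathbf x)=\sum_{\mathbf y\in\mathbf S(G)}\sum_{h}\epsilon'(h)\,U_1^{O_1(h)}\cdots U_n^{O_n(h)}\,\mathbf y,$$ the sums being over empty pentagons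 $p\in\mathrm{Pent}_{\beta\gamma}(\mathbf x,\mathbf y)$ and empty hexagons $h\in\mathrm{Hex}_{\beta\gamma\beta}(\mathbf x,\mathbf y)$. Over $\mathbb F_2$ there are no signs. Over $\mathbb Z$, $\epsilon'(h)$ is the value of $\mathcal S$ on the rectangle obtained by straightening $h$, and $\epsilon(p)$ is the value of $\mathcal S$ on the straightening of $p$ if this rectangle lies to the left of its edge on $\beta$, and minus this value if it lies to the right. Exchanging the roles of $\beta$ and $\gamma$ gives $\Phi_{\gamma\beta}$ and $H_{\gamma\beta\gamma}$. **Proposition.** For every commutation move such a curve $\gamma$ exists, and for each such $\gamma$ the following holds. 1. Over $\mathbb F_2$, $C(G)$ and $C(H)$ are filtered chain complexes ($\partial^2=0$, and $\partial$ is filtered and lowers the degree by one), $\Phi_{\beta\gamma}$ and $\Phi_{\gamma\beta}$ are filtered chain maps of degree $0$, $H_{\beta\gamma\beta}$ and $H_{\gamma\beta\gamma}$ are filtered module maps of degree $1$, and $$\mathbb I+\Phi_{\gamma\beta}\circ\Phi_{\beta\gamma}+\partial\circ H_{\beta\gamma\beta}+H_{\beta\gamma\beta}\circ\partial=0,\qquad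 \mathbb I+\Phi_{\beta\gamma}\circ\Phi_{\gamma\beta}+\partial\circ H_{\gamma\beta\gamma}+H_{\gamma\beta\gamma}\circ\partial=0 .$$ In particular $\Phi_{\beta\gamma}$ is a filtered chain homotopy equivalence with homotopy inverse $\Phi_{\gamma\beta}$. 2. Over $\mathbb Z$, for every sign assignment $\mathcal S$, $C(G)$ and $C(H)$ are again filtered chain complexes, $\Phi_{\beta\gamma}$ and $\Phi_{\gamma\beta}$ are filtered of degree $0$ and anti-commute with the differentials ($\partial\circ\Phi+\Phi\circ\partial=0$), $H_{\beta\gamma\beta}$ and $H_{\gamma\beta\gamma}$ are filtered of degree $1$, the same two identities hold, and $\Phi_{\beta\gamma}$ induces an isomorphism of $\mathbb Z[U_1,\dots,U_n]$-modules on homology. -/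

import Mathlib

namespace GridHomology

/-! ### Grid diagrams on the torus

Vertical circles, horizontal circles, columns and rows are all indexed by `Fin n`, viewed cyclically.
In the fundamental domain `[0,n) × [0,n)` the `v`-th vertical circle is `{v} × [0,n)`, the `h`-th
horizontal circle is `[0,n) × {h}`, the `v`-th column lies between the vertical circles `v` and
`v + 1`, and the `h`-th row lies between the horizontal circles `h` and `h + 1`. -/

/-- The number of unit steps in the positive direction from `p` to `q` on the circle of length `n`. -/
def gap {n : ℕ} (p q : Fin n) : ℕ := (q - p).val

/-- `i` lies on the closed arc that runs in the positive direction from `p` to `q`. -/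
def InArc {n : ℕ} (p q i : Fin n) : Prop := gap p i ≤ gap p q

/-- A grid diagram of grid number `n`: `O i` and `X i` are the columns of the unique `O` and the
unique `X` in row `i`. The `O`'s (hence the variables `U_i`) and the `X`'s are numbered by rows. -/
structure GridDiagram (n : ℕ) where
  O : Equiv.Perm (Fin n)
  X : Equiv.Perm (Fin n)
  O_ne_X : ∀ i, O i ≠ X i

/-- Following the link: from `O i` along its row to `X i`, then along the column of `X i` to the
`O` in that column. -/
def GridDiagram.follow {n : ℕ} (G : GridDiagram n) : Equiv.Perm (Fin n) := G.X.trans G.O.symm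

/-- `comp` numbers the components of the `ℓ`-component link presented by `G`: `comp i` is the
component that `O i` and `X i` belong to. -/
def GridDiagram.IsComponentNumbering {n ℓ : ℕ} (G : GridDiagram n) (comp : Fin n → Fin ℓ) : Prop :=
  Function.Surjective comp ∧ ∀ i j, comp i = comp j ↔ G.follow.SameCycle i j

/-- Generators: one-to-one correspondences between the horizontal and the vertical circles.
The generator `x` has the components `(x h, h)`. -/
abbrev Gen (n : ℕ) := Equiv.Perm (Fin n)

/-! ### Rectangles -/

/-- An embedded rectangle in the torus, with edges on the circles. It extends to the right from the
vertical circle `left` to `right`, and upwards from the horizontal circle `bottom` to `top`. -/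
@[ext] structure Rect (n : ℕ) where
  left : Fin n
  right : Fin n
  bottom : Fin n
  top : Fin n
  left_ne_right : left ≠ right
  bottom_ne_top : bottom ≠ top

noncomputable instance (n : ℕ) : Fintype (Rect n) :=
  Fintype.ofInjective (fun r => (r.left, r.right, r.bottom, r.top)) (by
    intro r s h
    simp only [Prod.mk.injEq] at h
    exact Rect.ext h.1 h.2.1 h.2.2.1 h.2.2.2)

/-- The rectangle crosses the given row. -/
def Rect.HasRow {n : ℕ} (r : Rect n) (row : Fin n) : Prop :=
  gap r.bottom row < gap r.bottom r.top

/-- The rectangle crosses the given column. -/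
def Rect.HasCol {n : ℕ} (r : Rect n) (col : Fin n) : Prop :=
  gap r.left col < gap r.left r.right

open Classical in
/-- Multiplicity of a little square in the two-chain of a rectangle. -/
noncomputable def Rect.mult {n : ℕ} (r : Rect n) (col row : Fin n) : ℕ :=
  if r.HasCol col ∧ r.HasRow row then 1 else 0

/-- The intersection point of the vertical circle `v` and the horizontal circle `h` lies in the
interior of the rectangle. -/
def Rect.HasInteriorPoint {n : ℕ} (r : Rect n) (v h : Fin n) : Prop :=
  (0 < gap r.left v ∧ gap r.left v < gap r.left r.right) ∧
    (0 < gap r.bottom h ∧ gap r.bottom h < gap r.bottom r.top)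

/-- The rectangle connects `x` to `y`: along its boundary the horizontal edges run from `x` to `y`
(so the lower left and the upper right corners are in `x`, the two others are in `y`), and
`x` and `y` agree on all other horizontal circles. -/
structure Rect.Connects {n : ℕ} (r : Rect n) (x y : Gen n) : Prop where
  lower_left : x r.bottom = r.left
  upper_right : x r.top = r.right
  lower_right : y r.bottom = r.right
  upper_left : y r.top = r.left
  agree : ∀ h, h ≠ r.bottom → h ≠ r.top → y h = x h

/-- `Rect°(x, y)`: rectangles from `x` to `y` without a point of `x` in the interior. -/
def EmptyRect {n : ℕ} (x y : Gen n) : Type :=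
  {r : Rect n // r.Connects x y ∧ ∀ h, ¬ r.HasInteriorPoint (x h) h}

open Classical in
noncomputable instance {n : ℕ} (x y : Gen n) : Fintype (EmptyRect x y) :=
  inferInstanceAs (Fintype {r : Rect n // r.Connects x y ∧ ∀ h, ¬ r.HasInteriorPoint (x h) h})

/-! ### Signs -/

/-- A function `Rect° → {±1}`. -/
abbrev RectSign (n : ℕ) := ∀ x y : Gen n, EmptyRect x y → ℤˣ

/-- All signs `+1`: the choice used with coefficients in `𝔽₂`. -/
def noSign (n : ℕ) : RectSign n := fun _ _ _ => 1

/-- True sign assignments. In `sq` the two decompositions of the same domain from `x` to `z` are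
different; then the four elements of `Rect°` (which carry their end points) are distinct. -/
structure IsSignAssignment {n : ℕ} (S : RectSign n) : Prop where
  sq : ∀ (x y y' z : Gen n) (r₁ : EmptyRect x y) (r₂ : EmptyRect y z)
      (s₁ : EmptyRect x y') (s₂ : EmptyRect y' z), r₁.1 ≠ s₁.1 →
      (∀ col row, r₁.1.mult col row + r₂.1.mult col row
        = s₁.1.mult col row + s₂.1.mult col row) →
      S x y r₁ * S y z r₂ = -(S x y' s₁ * S y' z s₂)
  vertical : ∀ (x y : Gen n) (r₁ : EmptyRect x y) (r₂ : EmptyRect y x),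
      r₁.1.left = r₂.1.left → r₁.1.right = r₂.1.right →
      r₁.1.top = r₂.1.bottom → r₂.1.top = r₁.1.bottom →
      S x y r₁ * S y x r₂ = -1
  horizontal : ∀ (x y : Gen n) (r₁ : EmptyRect x y) (r₂ : EmptyRect y x),
      r₁.1.bottom = r₂.1.bottom → r₁.1.top = r₂.1.top →
      r₁.1.right = r₂.1.left → r₂.1.right = r₁.1.left →
      S x y r₁ * S y x r₂ = 1

/-! ### The complex `C(G)` over `k[U_1, …, U_n]` -/

/-- The free `k[U_1, …, U_n]`-module on the generators. -/
abbrev Cx (k : Type) [CommRing k] {n : ℕ} (_G : GridDiagram n) : Type :=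
  Gen n →₀ MvPolynomial (Fin n) k

open Classical in
/-- `ε · U_1 ^ m_1 ⋯ U_n ^ m_n`, where `m_i` is `1` if `P i` holds and `0` otherwise. -/
noncomputable def weight (k : Type) [CommRing k] {n : ℕ} (ε : ℤˣ) (P : Fin n → Prop) :
    MvPolynomial (Fin n) k :=
  ((ε : ℤ) : MvPolynomial (Fin n) k) * ∏ i, MvPolynomial.X i ^ (if P i then 1 else 0)

/-- The differential, with the signs `σ`: it counts empty rectangles. -/
noncomputable def differential (k : Type) [CommRing k] {n : ℕ} (σ : RectSign n)
    (G : GridDiagram n) : Cx k G →ₗ[MvPolynomial (Fin n) k] Cx k G :=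
  Finsupp.linearCombination (MvPolynomial (Fin n) k) fun x : Gen n =>
    ∑ y : Gen n, ∑ r : EmptyRect x y,
      Finsupp.single y (weight k (σ x y r) fun i => r.1.HasCol (G.O i) ∧ r.1.HasRow i)

/-! ### Maslov grading and Alexander filtration -/

/-- Formal linear combinations of points of the plane. -/
abbrev PointSum := (ℚ × ℚ) →₀ ℚ

open Classical in
/-- The bilinear extension of `𝒥(A, B) = (ℐ(A, B) + ℐ(B, A)) / 2`, where `ℐ(A, B)` counts the pairs
`(p, q) ∈ A × B` with `p.1 < q.1` and `p.2 < q.2`. -/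
noncomputable def J (A B : PointSum) : ℚ :=
  A.sum fun p w => B.sum fun q v => w * v *
    (((if p.1 < q.1 ∧ p.2 < q.2 then 1 else 0) + (if q.1 < p.1 ∧ q.2 < p.2 then 1 else 0)) / 2)

/-- The points of a generator in the fundamental domain `[0,n) × [0,n)`. -/
noncomputable def genSum {n : ℕ} (x : Gen n) : PointSum :=
  ∑ h : Fin n, Finsupp.single (((x h).val : ℚ), (h.val : ℚ)) 1

/-- The centres of the squares in the rows `i ∈ K` and the columns `D i`. -/
noncomputable def markSum {n : ℕ} (D : Equiv.Perm (Fin n)) (K : Finset (Fin n)) : PointSum :=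
  ∑ i ∈ K, Finsupp.single (((D i).val : ℚ) + 1 / 2, (i.val : ℚ) + 1 / 2) 1

/-- The Maslov grading `M(x) = 𝒥(x - 𝕆, x - 𝕆) + 1`. -/
noncomputable def maslov {n : ℕ} (G : GridDiagram n) (x : Gen n) : ℚ :=
  J (genSum x - markSum G.O Finset.univ) (genSum x - markSum G.O Finset.univ) + 1

/-- The Alexander grading
`A_j(x) = 𝒥(x - (𝕏 + 𝕆) / 2, 𝕏_j - 𝕆_j) - (n_j - 1) / 2`, where `n_j` is the number of `O`'s on the
`j`-th component. -/
noncomputable def alexander {n ℓ : ℕ} (G : GridDiagram n) (comp : Fin n → Fin ℓ) (x : Gen n)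
    (j : Fin ℓ) : ℚ :=
  J (genSum x - (1 / 2 : ℚ) • (markSum G.X Finset.univ + markSum G.O Finset.univ))
      (markSum G.X (Finset.univ.filter fun i => comp i = j)
        - markSum G.O (Finset.univ.filter fun i => comp i = j))
    - (((Finset.univ.filter fun i => comp i = j).card : ℚ) - 1) / 2

/-- The part of Maslov degree `d`: spanned over `k` by the `U_1 ^ m_1 ⋯ U_n ^ m_n · x` with
`M(x) - 2 (m_1 + ⋯ + m_n) = d`. -/
noncomputable def degPart (k : Type) [CommRing k] {n : ℕ} (G : GridDiagram n) (d : ℤ) :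
    Submodule k (Cx k G) :=
  Submodule.span k {v | ∃ (x : Gen n) (m : Fin n →₀ ℕ),
    maslov G x - 2 * ∑ i, (m i : ℚ) = d ∧ v = Finsupp.single x (MvPolynomial.monomial m 1)}

/-- The level `s ∈ ℚ^ℓ` of the Alexander filtration: generated by the `U_1 ^ m_1 ⋯ U_n ^ m_n · x` with
`A_j(x) - ∑_{O_i on component j} m_i ≤ s_j` for all `j`. -/
noncomputable def filtPart (k : Type) [CommRing k] {n ℓ : ℕ} (G : GridDiagram n)
    (comp : Fin n → Fin ℓ) (s : Fin ℓ → ℚ) : Submodule (MvPolynomial (Fin n) k) (Cx k G) :=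
  Submodule.span (MvPolynomial (Fin n) k) {v | ∃ (x : Gen n) (m : Fin n →₀ ℕ),
    (∀ j, alexander G comp x j - ∑ i ∈ Finset.univ.filter (fun i => comp i = j), (m i : ℚ) ≤ s j) ∧
      v = Finsupp.single x (MvPolynomial.monomial m 1)}

/-- `f` is a filtered `k[U_1, …, U_n]`-module map that changes the Maslov degree by `e`. -/
structure IsFilteredOfDegree {k : Type} [CommRing k] {n ℓ : ℕ} (comp : Fin n → Fin ℓ)
    {G H : GridDiagram n} (e : ℤ) (f : Cx k G →ₗ[MvPolynomial (Fin n) k] Cx k H) : Prop where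
  degree : ∀ (d : ℤ), ∀ v ∈ degPart k G d, f v ∈ degPart k H (d + e)
  filtered : ∀ (s : Fin ℓ → ℚ), ∀ v ∈ filtPart k G comp s, f v ∈ filtPart k H comp s

/-- `C(G)` with the differential `d` is a filtered chain complex. -/
structure IsFilteredComplex {k : Type} [CommRing k] {n ℓ : ℕ} (comp : Fin n → Fin ℓ)
    {G : GridDiagram n} (d : Cx k G →ₗ[MvPolynomial (Fin n) k] Cx k G) : Prop where
  sq_zero : d ∘ₗ d = 0
  filtered_degree : IsFilteredOfDegree comp (-1) d

/-! ### Commutation -/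

/-- `H` is obtained from `G` by switching the decorations of the consecutive columns `c - 1` and `c`
(which lie to the left and to the right of the `c`-th vertical circle), where the `O` and the `X` of
column `c` lie on one of the two arcs into which the `O` and the `X` of column `c - 1` cut
the vertical circle. -/
structure IsCommutation {n : ℕ} [NeZero n] (G H : GridDiagram n) (c : Fin n) : Prop where
  arcs : ∀ p q : Fin n, G.O p = c - 1 → G.X q = c - 1 →
    (∀ i, G.O i = c ∨ G.X i = c → InArc p q i) ∨ (∀ i, G.O i = c ∨ G.X i = c → InArc q p i)
  O_switch : ∀ i, H.O i = Equiv.swap (c - 1) c (G.O i)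
  X_switch : ∀ i, H.X i = Equiv.swap (c - 1) c (G.X i)

/-- A curve `γ` which can replace the `c`-th vertical circle `β` of `G` to give `H`, up to isotopy
preserving the horizontal circles and the decorations. It stays within the columns `c - 1` and `c`,
meets each horizontal circle once and meets `β` transversally in two points `a` and `b`, which lie
inside the rows also called `a` and `b`. Going upwards, `γ` passes at `a` from the left to the
right of `β`, and at `b` from the right to the left. So `β` and `γ` bound two bigons: one on the left
of `β`, over the arc of heights from `b` to `a`, and one on the right of `β`, over the arc from
`a` to `b`. The left one contains both decorations of column `c - 1` of `G`, the right one both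
decorations of column `c` of `G`; so with respect to `γ` these two pairs lie on the other side,
as they do in `H`. In the row `a` a decoration in column `c - 1` is below, and one in column `c` is
above the point `a`; in the row `b` it is the other way round. -/
structure Curve {n : ℕ} [NeZero n] (G H : GridDiagram n) (c : Fin n) where
  a : Fin n
  b : Fin n
  O_switch : ∀ i, H.O i = Equiv.swap (c - 1) c (G.O i)
  X_switch : ∀ i, H.X i = Equiv.swap (c - 1) c (G.X i)
  left_bigon : ∀ i, G.O i = c - 1 ∨ G.X i = c - 1 → InArc b a i
  right_bigon : ∀ i, G.O i = c ∨ G.X i = c → InArc a b i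

theorem swap_eq_left {n : ℕ} {p q u v : Fin n} (h : v = Equiv.swap p q u) : v = p ↔ u = q := by
  subst h
  rw [Equiv.swap_apply_eq_iff, Equiv.swap_apply_left]

theorem swap_eq_right {n : ℕ} {p q u v : Fin n} (h : v = Equiv.swap p q u) : v = q ↔ u = p := by
  subst h
  rw [Equiv.swap_apply_eq_iff, Equiv.swap_apply_right]

/-- The roles of `β` and `γ` exchanged: `β` as a curve that replaces the vertical circle `γ` of
`H`. Relative to `γ`, going upwards, `β` passes at `b` from the left to the right. -/
def Curve.symm {n : ℕ} [NeZero n] {G H : GridDiagram n} {c : Fin n} (γ : Curve G H c) :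
    Curve H G c where
  a := γ.b
  b := γ.a
  O_switch i := by rw [γ.O_switch i, Equiv.swap_apply_self]
  X_switch i := by rw [γ.X_switch i, Equiv.swap_apply_self]
  left_bigon i h := γ.right_bigon i
    (by rwa [swap_eq_left (γ.O_switch i), swap_eq_left (γ.X_switch i)] at h)
  right_bigon i h := γ.left_bigon i
    (by rwa [swap_eq_right (γ.O_switch i), swap_eq_right (γ.X_switch i)] at h)

/-! ### Pentagons

The vertical circles for `H` are those for `G` with `γ` in place of `β` as the `c`-th one, and
generators of `H` are described by permutations accordingly. So straightening (sliding the
components on `γ` horizontally to `β`) does not change the permutation, and a polygon is described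
by the rectangle to which it straightens.

For a decoration in row `i`, the column `G.O i` (resp. `H.O i`) tells where it lies with respect
to the vertical circles including `β` (resp. `γ`). Thus a decoration lies in a polygon if it
lies in a row of the polygon and in the column range of the rectangle, where the columns are those
of `G` at heights at which the distinguished edge of the polygon runs along `β`, and those
of `H` where it runs along `γ`. In the row that contains a corner `a` or `b` of the polygon both
conditions are needed, because the angle at that corner is less than straight. -/

/-- The rectangle is the straightening of a pentagon in `Pent_{βγ}`: one of its vertical edges is
on the circle `β`, and passes the point `a`.

In a right pentagon (left edge distinguished) the lower left corner is the `β`-component of `x`, the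
edge follows `β` up to `a`, then `γ` up to the upper left corner, which is in `y`. In a left pentagon
(right edge distinguished) the lower right corner is the `γ`-component of `y`, the edge follows `γ`
up to `a`, then `β` up to the upper right corner, which is in `x`. -/
def Curve.IsPentagon {n : ℕ} [NeZero n] {G H : GridDiagram n} {c : Fin n} (γ : Curve G H c)
    (r : Rect n) : Prop :=
  (r.left = c ∨ r.right = c) ∧ r.HasRow γ.a

/-- `Pent°_{βγ}(x, y)`. The interior of the pentagon contains a point of `x` if and only
if that of the rectangle does. The straightening map is `Subtype.val`. -/
def Curve.EmptyPent {n : ℕ} [NeZero n] {G H : GridDiagram n} {c : Fin n} (γ : Curve G H c)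
    (x y : Gen n) : Type :=
  {r : EmptyRect x y // γ.IsPentagon r.1}

open Classical in
noncomputable instance {n : ℕ} [NeZero n] {G H : GridDiagram n} {c : Fin n} (γ : Curve G H c)
    (x y : Gen n) : Fintype (γ.EmptyPent x y) :=
  inferInstanceAs (Fintype {r : EmptyRect x y // γ.IsPentagon r.1})

open Classical in
/-- `O_i` lies in the pentagon with the straightening `r`. -/
def Curve.PentHasO {n : ℕ} [NeZero n] {G H : GridDiagram n} {c : Fin n} (γ : Curve G H c)
    (r : Rect n) (i : Fin n) : Prop :=
  r.HasRow i ∧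
    (gap r.bottom i ≤ gap r.bottom γ.a → r.HasCol (if r.left = c then G.O i else H.O i)) ∧
    (gap r.bottom γ.a ≤ gap r.bottom i → r.HasCol (if r.left = c then H.O i else G.O i))

open Classical in
/-- `Φ_{βγ} : C(G) → C(H)`, with the signs `ε(p) = σ(e(p))` for left pentagons and
`ε(p) = -σ(e(p))` for right pentagons, where `e` is the straightening map. -/
noncomputable def Curve.pentMap (k : Type) [CommRing k] {n : ℕ} [NeZero n] (σ : RectSign n)
    {G H : GridDiagram n} {c : Fin n} (γ : Curve G H c) :
    Cx k G →ₗ[MvPolynomial (Fin n) k] Cx k H :=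
  Finsupp.linearCombination (MvPolynomial (Fin n) k) fun x : Gen n =>
    ∑ y : Gen n, ∑ p : γ.EmptyPent x y,
      Finsupp.single y
        (weight k (if p.1.1.left = c then -σ x y p.1 else σ x y p.1) (γ.PentHasO p.1.1))

/-! ### Hexagons -/

open Classical in
/-- The row of the lower one of the two corners `a`, `b` on the distinguished edge. -/
noncomputable def Curve.lowerCorner {n : ℕ} [NeZero n] {G H : GridDiagram n} {c : Fin n}
    (γ : Curve G H c) (r : Rect n) : Fin n :=
  if r.left = c then γ.a else γ.b

open Classical in
/-- The row of the upper one of the two corners `a`, `b` on the distinguished edge. -/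
noncomputable def Curve.upperCorner {n : ℕ} [NeZero n] {G H : GridDiagram n} {c : Fin n}
    (γ : Curve G H c) (r : Rect n) : Fin n :=
  if r.left = c then γ.b else γ.a

/-- The rectangle is the straightening of a hexagon in `Hex_{βγβ}`: one of its vertical edges is on
the circle `β`. Going upwards, if this is the left edge, the corresponding edge of the hexagon
follows `β` to `a`, then `γ` to `b`, then `β`; if it is the right edge, it follows `β` to `b`,
then `γ` to `a`, then `β`. -/
def Curve.IsHexagon {n : ℕ} [NeZero n] {G H : GridDiagram n} {c : Fin n} (γ : Curve G H c)
    (r : Rect n) : Prop :=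
  (r.left = c ∨ r.right = c) ∧ r.HasRow (γ.upperCorner r) ∧
    gap r.bottom (γ.lowerCorner r) < gap r.bottom (γ.upperCorner r)

/-- `Hex°_{βγβ}(x, y)`. -/
def Curve.EmptyHex {n : ℕ} [NeZero n] {G H : GridDiagram n} {c : Fin n} (γ : Curve G H c)
    (x y : Gen n) : Type :=
  {r : EmptyRect x y // γ.IsHexagon r.1}

open Classical in
noncomputable instance {n : ℕ} [NeZero n] {G H : GridDiagram n} {c : Fin n} (γ : Curve G H c)
    (x y : Gen n) : Fintype (γ.EmptyHex x y) :=
  inferInstanceAs (Fintype {r : EmptyRect x y // γ.IsHexagon r.1})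

/-- `O_i` lies in the hexagon with the straightening `r`. -/
def Curve.HexHasO {n : ℕ} [NeZero n] {G H : GridDiagram n} {c : Fin n} (γ : Curve G H c)
    (r : Rect n) (i : Fin n) : Prop :=
  r.HasRow i ∧
    (gap r.bottom i ≤ gap r.bottom (γ.lowerCorner r) ∨
      gap r.bottom (γ.upperCorner r) ≤ gap r.bottom i → r.HasCol (G.O i)) ∧
    (gap r.bottom (γ.lowerCorner r) ≤ gap r.bottom i ∧
      gap r.bottom i ≤ gap r.bottom (γ.upperCorner r) → r.HasCol (H.O i))

/-- `H_{βγβ} : C(G) → C(G)`. -/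
noncomputable def Curve.hexMap (k : Type) [CommRing k] {n : ℕ} [NeZero n] (σ : RectSign n)
    {G H : GridDiagram n} {c : Fin n} (γ : Curve G H c) :
    Cx k G →ₗ[MvPolynomial (Fin n) k] Cx k G :=
  Finsupp.linearCombination (MvPolynomial (Fin n) k) fun x : Gen n =>
    ∑ y : Gen n, ∑ p : γ.EmptyHex x y,
      Finsupp.single y (weight k (σ x y p.1) (γ.HexHasO p.1.1))

/-! ### Homology -/

/-- The homology `ker d / im d` (used for `d ∘ d = 0`). -/
abbrev Homology {R M : Type} [CommRing R] [AddCommGroup M] [Module R M] (d : M →ₗ[R] M) : Type :=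
  LinearMap.ker d ⧸ (LinearMap.range d).submoduleOf (LinearMap.ker d)

/-- `f` maps cycles to cycles, and `[z] ↦ [f z]` is a well-defined isomorphism on homology. -/
def InducesIsoOnHomology {R M N : Type} [CommRing R] [AddCommGroup M] [Module R M]
    [AddCommGroup N] [Module R N] (d : M →ₗ[R] M) (d' : N →ₗ[R] N) (f : M →ₗ[R] N) : Prop :=
  ∃ (hf : ∀ z ∈ LinearMap.ker d, f z ∈ LinearMap.ker d') (e : Homology d ≃ₗ[R] Homology d'),
    ∀ z : LinearMap.ker d,
      e (Submodule.Quotient.mk z) = Submodule.Quotient.mk ⟨f z.1, hf z.1 z.2⟩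

end GridHomology

open GridHomology

/-!
# Commutation of grid diagrams

The pentagons and hexagons straighten to empty rectangles, so a single matrix counts rectangles,
pentagons and hexagons at once. Its rows and columns are indexed by generators, and its entries are
`2 × 2` matrices over `k[U_1, …, U_n][T]`: the states `0` and `1` stand for `β` and `γ`, and `T` counts
the corners of a polygon at `a` and `b`. The weight of a rectangle (`polyWeight`) is a product of
row-wise transfer matrices if its left edge is distinguished, the adjugate of such a product if its
right edge is, and a scalar otherwise. The entries of the total matrix `D` are
`∂ + T ^ 2 • H_{βγβ}`, `T • Φ_{βγ}` and the same for the exchanged roles of `β` and `γ`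
(`Curve.totalMatrix_zero_zero`, `Curve.totalMatrix_one_zero`, `Curve.totalMatrix_symm`).

The weight is multiplicative when a rectangle is cut (`isTransferWeight_polyWeight`). This is all that
the usual argument for `∂ ^ 2 = 0` needs: a domain that is not an annulus has exactly two decompositions
into empty rectangles, of opposite signs, and by multiplicativity they have the same weight, although
weights do not commute (`rectMatrix_mul_self_off_diagonal`). On the diagonal only thin annuli are left.
The horizontal ones give `∑ U_i`. Of the vertical ones, the two next to the distinguished circle give
`-(A + adj A) = -tr A`, where `A` is the transfer matrix once around the circle, and
`tr A = U_p + U_q + T ^ 2` because the two pairs of marks lie in different bigons (`trace_colMat`);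
the others give the remaining `-U_i`. Hence `D ^ 2 = -T ^ 2` (`rectMatrix_polyWeight_sq`), and the
coefficients of `1`, `T` and `T ^ 2` are `∂ ^ 2 = 0`, the anti-commutation of `Φ` with `∂`, and the homotopy
identity (`Curve.matrix_relations`). All signs enter through the axioms of a sign assignment,
which also hold for trivial signs if `1 = -1`.

For the gradings, `𝒥` is treated as a bilinear form. Pairing it with the four corners of a rectangle
gives the change of the gradings along a rectangle (`maslov_emptyRect`, `alexander_emptyRect`), and pairing
it with the displacement of the marks gives the difference between the gradings for `G` and for `H`, which
depends only on the position of the component on `β` relative to `a` and the marks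
(`Curve.maslov_sub_maslov`, `Curve.alexander_sub_alexander`). This difference is made up for by the marks
that lie in only one of a polygon and its straightening (`Curve.count_sub_pentagon`,
`Curve.count_sub_hexagon`).
-/

namespace GridHomology

variable {n : ℕ}

/-! ### Cyclic order -/

theorem gap_eq (p q : Fin n) :
    gap p q = if p.val ≤ q.val then q.val - p.val else q.val + n - p.val := by
  have hp := p.isLt
  have hq := q.isLt
  simp only [gap, Fin.sub_def]
  split_ifs with h
  · rw [show n - p.val + q.val = (q.val - p.val) + n by omega, Nat.add_mod_right,
      Nat.mod_eq_of_lt (by omega)]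
  · rw [Nat.mod_eq_of_lt (by omega)]
    omega

/-- Going in the positive direction from `p`, one meets `q` strictly before `r`, and `q ≠ p`. -/
def Cyc (p q r : Fin n) : Prop := 0 < gap p q ∧ gap p q < gap p r

theorem cyc_iff (p q r : Fin n) : Cyc p q r ↔
    (p.val < q.val ∧ q.val < r.val) ∨ (q.val < r.val ∧ r.val < p.val) ∨
      (r.val < p.val ∧ p.val < q.val) := by
  have hp := p.isLt
  have hq := q.isLt
  have hr := r.isLt
  simp only [Cyc, gap_eq]
  split_ifs <;> omega

theorem gap_lt_iff (p q r : Fin n) : gap p q < gap p r ↔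
    (p.val ≤ q.val ∧ q.val < r.val) ∨ (q.val < r.val ∧ r.val < p.val) ∨
      (r.val < p.val ∧ p.val ≤ q.val) := by
  have hp := p.isLt
  have hq := q.isLt
  have hr := r.isLt
  simp only [gap_eq]
  split_ifs <;> omega

end GridHomology

namespace GridHomology

variable {n : ℕ}

open Equiv (swap)

/-! ### Two consecutive empty rectangles -/

/-- There is an empty rectangle that starts at `x` and has its bottom at height `b` and its top at
height `t`: the rectangle with the lower left corner `(x b, b)` and the upper right corner `(x t, t)`
is not degenerate and contains no point of `x` in its interior. -/
def IsEmptyAt (x : Gen n) (b t : Fin n) : Prop :=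
  b ≠ t ∧ ∀ h, ¬ (Cyc (x b) (x h) (x t) ∧ Cyc b h t)

theorem mul_swap_apply (x : Gen n) (b t h : Fin n) :
    (x * swap b t) h = if h = b then x t else if h = t then x b else x h := by
  rw [Equiv.Perm.mul_apply, Equiv.swap_apply_def]
  split_ifs <;> rfl

theorem mul_swap_left (x : Gen n) (b t : Fin n) : (x * swap b t) b = x t := by simp

theorem mul_swap_right (x : Gen n) (b t : Fin n) : (x * swap b t) t = x b := by simp

theorem mul_swap_of_ne (x : Gen n) {b t h : Fin n} (h1 : h ≠ b) (h2 : h ≠ t) :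
    (x * swap b t) h = x h := by
  rw [mul_swap_apply, if_neg h1, if_neg h2]

theorem cyc_or_cyc {i j k : Fin n} (h1 : i ≠ j) (h2 : j ≠ k) (h3 : i ≠ k) :
    Cyc i j k ∨ Cyc i k j := by
  rw [ne_eq, Fin.ext_iff] at *
  rw [cyc_iff, cyc_iff]
  omega

theorem Cyc.ne {b m t : Fin n} (h : Cyc b m t) : b ≠ m ∧ m ≠ t ∧ b ≠ t := by
  rw [cyc_iff] at h
  refine ⟨?_, ?_, ?_⟩ <;> rintro rfl <;> omega

theorem Cyc.asymm {i j k : Fin n} (h : Cyc i j k) : ¬ Cyc i k j := by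
  rw [cyc_iff] at *
  omega

theorem Cyc.rotate {i j k : Fin n} (h : Cyc i j k) : Cyc j k i := by
  rw [cyc_iff] at *
  omega

/-- The open arc `(b, t)` consists of `(b, m)`, `m` and `(m, t)`. -/
theorem Cyc.cut {b m t : Fin n} (h : Cyc b m t) {i : Fin n} (hi : i ≠ m) :
    Cyc b i t ↔ Cyc b i m ∨ Cyc m i t := by
  rw [ne_eq, Fin.ext_iff] at hi
  simp only [cyc_iff] at *
  omega

theorem cyc_ne_of_apply {x : Gen n} {b m t : Fin n} (h : Cyc (x b) (x m) (x t)) :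
    b ≠ m ∧ m ≠ t ∧ b ≠ t :=
  ⟨fun e => h.ne.1 (e ▸ rfl), fun e => h.ne.2.1 (e ▸ rfl), fun e => h.ne.2.2 (e ▸ rfl)⟩

/-- For the emptiness of a rectangle, one of the points of the generator is treated separately. -/
theorem isEmptyAt_iff {x : Gen n} {b t : Fin n} (m : Fin n) : IsEmptyAt x b t ↔
    b ≠ t ∧ (Cyc (x b) (x m) (x t) → ¬ Cyc b m t) ∧
      ∀ h, h ≠ b → h ≠ m → h ≠ t → Cyc (x b) (x h) (x t) → ¬ Cyc b h t := by
  refine and_congr_right fun _ => ⟨fun h => ⟨fun h1 h2 => h m ⟨h1, h2⟩,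
    fun i _ _ _ h1 h2 => h i ⟨h1, h2⟩⟩, fun h i hi => ?_⟩
  by_cases him : i = m
  · subst him
    exact h.1 hi.1 hi.2
  · exact h.2 i hi.2.ne.1.symm him hi.2.ne.2.1 hi.1 hi.2

/-! The L-shaped domains with a corner of the bounding box missing have two decompositions into
rectangles, obtained by cutting at the reflex corner horizontally or vertically. In each of the
following four statements, one is described by the cyclic order of the heights and the other by the
cyclic order of the abscissas, and if the rectangles of one of them are empty, so are those of the other. -/

theorem empty_without_upper_left_iff {x : Gen n} {b m t : Fin n} :
    (Cyc b m t ∧ IsEmptyAt x b m ∧ IsEmptyAt (x * swap b m) b t) ↔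
      (Cyc (x b) (x m) (x t) ∧ IsEmptyAt x m t ∧ IsEmptyAt (x * swap m t) b m) := by
  rw [isEmptyAt_iff (b := b) (t := m) t, isEmptyAt_iff (x := x * swap b m) (b := b) (t := t) m,
    isEmptyAt_iff (b := m) (t := t) b, isEmptyAt_iff (x := x * swap m t) (b := b) (t := m) t]
  by_cases hd : b ≠ m ∧ m ≠ t ∧ b ≠ t
  · obtain ⟨h1, h2, h3⟩ := hd
    have r := cyc_or_cyc h1 h2 h3
    have s := cyc_or_cyc (x.injective.ne h1) (x.injective.ne h2) (x.injective.ne h3)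
    have inj := x.injective
    simp only [mul_swap_apply, h1, h2, h3, h1.symm, h2.symm, h3.symm, if_true, if_false]
    have cr := fun (h : Cyc b m t) i (hi : i ≠ m) => h.cut hi
    have cs := fun (h : Cyc (x b) (x m) (x t)) i (hi : i ≠ m) => h.cut (inj.ne hi)
    grind [Cyc.asymm, Cyc.rotate]
  · grind [Cyc.ne, cyc_ne_of_apply]

theorem empty_without_lower_right_iff {x : Gen n} {b m t : Fin n} :
    (Cyc b m t ∧ IsEmptyAt x m t ∧ IsEmptyAt (x * swap m t) b t) ↔
      (Cyc (x b) (x m) (x t) ∧ IsEmptyAt x b m ∧ IsEmptyAt (x * swap b m) m t) := by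
  rw [isEmptyAt_iff (b := m) (t := t) b, isEmptyAt_iff (x := x * swap m t) (b := b) (t := t) m,
    isEmptyAt_iff (b := b) (t := m) t, isEmptyAt_iff (x := x * swap b m) (b := m) (t := t) b]
  by_cases hd : b ≠ m ∧ m ≠ t ∧ b ≠ t
  · obtain ⟨h1, h2, h3⟩ := hd
    have r := cyc_or_cyc h1 h2 h3
    have s := cyc_or_cyc (x.injective.ne h1) (x.injective.ne h2) (x.injective.ne h3)
    have inj := x.injective
    simp only [mul_swap_apply, h1, h2, h3, h1.symm, h2.symm, h3.symm, if_true, if_false]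
    have cr := fun (h : Cyc b m t) i (hi : i ≠ m) => h.cut hi
    have cs := fun (h : Cyc (x b) (x m) (x t)) i (hi : i ≠ m) => h.cut (inj.ne hi)
    grind [Cyc.asymm, Cyc.rotate]
  · grind [Cyc.ne, cyc_ne_of_apply]

theorem empty_without_upper_right_iff {x : Gen n} {b m t : Fin n} :
    (Cyc b m t ∧ IsEmptyAt x b t ∧ IsEmptyAt (x * swap b t) b m) ↔
      (Cyc (x b) (x t) (x m) ∧ IsEmptyAt x b m ∧ IsEmptyAt (x * swap b m) m t) := by
  rw [isEmptyAt_iff (b := b) (t := t) m, isEmptyAt_iff (x := x * swap b t) (b := b) (t := m) t,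
    isEmptyAt_iff (b := b) (t := m) t, isEmptyAt_iff (x := x * swap b m) (b := m) (t := t) b]
  by_cases hd : b ≠ m ∧ m ≠ t ∧ b ≠ t
  · obtain ⟨h1, h2, h3⟩ := hd
    have r := cyc_or_cyc h1 h2 h3
    have s := cyc_or_cyc (x.injective.ne h1) (x.injective.ne h2) (x.injective.ne h3)
    have inj := x.injective
    simp only [mul_swap_apply, h1, h2, h3, h1.symm, h2.symm, h3.symm, if_true, if_false]
    have cr := fun (h : Cyc b m t) i (hi : i ≠ m) => h.cut hi
    have cs := fun (h : Cyc (x b) (x t) (x m)) i (hi : i ≠ t) => h.cut (inj.ne hi)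
    grind [Cyc.asymm, Cyc.rotate]
  · grind [Cyc.ne, cyc_ne_of_apply]

theorem empty_without_lower_left_iff {x : Gen n} {b m t : Fin n} :
    (Cyc b m t ∧ IsEmptyAt x b t ∧ IsEmptyAt (x * swap b t) m t) ↔
      (Cyc (x m) (x b) (x t) ∧ IsEmptyAt x m t ∧ IsEmptyAt (x * swap m t) b m) := by
  rw [isEmptyAt_iff (b := b) (t := t) m, isEmptyAt_iff (x := x * swap b t) (b := m) (t := t) b,
    isEmptyAt_iff (b := m) (t := t) b, isEmptyAt_iff (x := x * swap m t) (b := b) (t := m) t]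
  by_cases hd : b ≠ m ∧ m ≠ t ∧ b ≠ t
  · obtain ⟨h1, h2, h3⟩ := hd
    have r := cyc_or_cyc h1 h2 h3
    have s := cyc_or_cyc (x.injective.ne h1) (x.injective.ne h2) (x.injective.ne h3)
    have inj := x.injective
    simp only [mul_swap_apply, h1, h2, h3, h1.symm, h2.symm, h3.symm, if_true, if_false]
    have cr := fun (h : Cyc b m t) i (hi : i ≠ m) => h.cut hi
    have cs := fun (h : Cyc (x m) (x b) (x t)) i (hi : i ≠ b) => h.cut (inj.ne hi)
    grind [Cyc.asymm, Cyc.rotate]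
  · grind [Cyc.ne, cyc_ne_of_apply]

theorem Cyc.exit {l r p q : Fin n} (hp : Cyc l p r) (hq : ¬ Cyc l q r) (h1 : q ≠ l) (h2 : q ≠ r) :
    Cyc p r q := by
  rw [ne_eq, Fin.ext_iff] at h1 h2
  rw [cyc_iff] at *
  omega

theorem Cyc.enter {l r p q : Fin n} (hq : Cyc l q r) (hp : ¬ Cyc l p r) (h1 : p ≠ l) (h2 : p ≠ r) :
    Cyc p l q := by
  rw [ne_eq, Fin.ext_iff] at h1 h2
  rw [cyc_iff] at *
  omega

/-- Two rectangles without a common corner may be used in the other order. -/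
theorem disjoint_isEmptyAt {x : Gen n} {i j k l : Fin n} (hik : i ≠ k) (hil : i ≠ l) (hjk : j ≠ k)
    (hjl : j ≠ l) (h1 : IsEmptyAt x i j) (h2 : IsEmptyAt (x * swap i j) k l) :
    IsEmptyAt x k l ∧ IsEmptyAt (x * swap k l) i j := by
  obtain ⟨hij, e1⟩ := h1
  obtain ⟨hkl, e2⟩ := h2
  have vik := x.injective.ne hik
  have vil := x.injective.ne hil
  have vjk := x.injective.ne hjk
  have vjl := x.injective.ne hjl
  have a1 := e1 k
  have a2 := e1 l
  have a3 := e2 i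
  have a4 := e2 j
  rw [mul_swap_left, mul_swap_of_ne x hik.symm hjk.symm, mul_swap_of_ne x hil.symm hjl.symm] at a3
  rw [mul_swap_right, mul_swap_of_ne x hik.symm hjk.symm, mul_swap_of_ne x hil.symm hjl.symm] at a4
  refine ⟨⟨hkl, fun h hh => ?_⟩, hij, fun h hh => ?_⟩
  · by_cases k1 : h = i
    · subst k1
      exact a2 ⟨hh.1.exit (fun e => a3 ⟨e, hh.2⟩) vjk vjl, hh.2.exit (fun e => a4 ⟨hh.1, e⟩) hjk hjl⟩
    by_cases k2 : h = j
    · subst k2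
      exact a1 ⟨hh.1.enter (fun e => a4 ⟨e, hh.2⟩) vik vil, hh.2.enter (fun e => a3 ⟨hh.1, e⟩) hik hil⟩
    refine e2 h ?_
    rwa [mul_swap_of_ne x k1 k2, mul_swap_of_ne x hik.symm hjk.symm, mul_swap_of_ne x hil.symm hjl.symm]
  · rw [mul_swap_of_ne x hik hil, mul_swap_of_ne x hjk hjl] at hh
    by_cases k1 : h = k
    · subst k1
      rw [mul_swap_left] at hh
      exact a4 ⟨hh.1.enter (fun e => a1 ⟨e, hh.2⟩) vik.symm vjk.symm,
        hh.2.exit (fun e => a2 ⟨hh.1, e⟩) hil.symm hjl.symm⟩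
    by_cases k2 : h = l
    · subst k2
      rw [mul_swap_right] at hh
      exact a3 ⟨hh.1.exit (fun e => a2 ⟨e, hh.2⟩) vil.symm vjl.symm,
        hh.2.enter (fun e => a1 ⟨hh.1, e⟩) hik.symm hjk.symm⟩
    rw [mul_swap_of_ne x k1 k2] at hh
    exact e1 h hh

end GridHomology

namespace GridHomology

open Equiv (swap)

variable {n : ℕ} {A : Type} [Ring A]

/-! ### Rectangles as pairs of heights -/

/-- The rectangle with the lower left corner `(x b, b)` and the upper right corner `(x t, t)`. -/
def rectAt (x : Gen n) {b t : Fin n} (h : b ≠ t) : Rect n :=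
  ⟨x b, x t, b, t, x.injective.ne h, h⟩

/-- The empty rectangle that leaves `x` at the heights `b` and `t`. -/
def emptyRectAt (x : Gen n) {b t : Fin n} (h : IsEmptyAt x b t) : EmptyRect x (x * swap b t) :=
  ⟨rectAt x h.1, ⟨rfl, rfl, mul_swap_left x b t, mul_swap_right x b t,
    fun _ h1 h2 => mul_swap_of_ne x h1 h2⟩, h.2⟩

theorem EmptyRect.isEmptyAt {x y : Gen n} (r : EmptyRect x y) :
    IsEmptyAt x r.1.bottom r.1.top := by
  refine ⟨r.1.bottom_ne_top, fun h => ?_⟩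
  have := r.2.2 h
  rwa [Rect.HasInteriorPoint, ← r.2.1.lower_left, ← r.2.1.upper_right] at this

theorem EmptyRect.mul_swap {x y : Gen n} (r : EmptyRect x y) :
    x * swap r.1.bottom r.1.top = y := by
  ext h : 1
  rw [mul_swap_apply]
  split_ifs with h1 h2
  · rw [h1, r.2.1.lower_right, r.2.1.upper_right]
  · rw [h2, r.2.1.upper_left, r.2.1.lower_left]
  · exact (r.2.1.agree h h1 h2).symm

theorem EmptyRect.ext' {x y : Gen n} {r s : EmptyRect x y} (h1 : r.1.bottom = s.1.bottom)
    (h2 : r.1.top = s.1.top) : r = s := by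
  refine Subtype.ext (Rect.ext ?_ ?_ h1 h2)
  · rw [← r.2.1.lower_left, ← s.2.1.lower_left, h1]
  · rw [← r.2.1.upper_right, ← s.2.1.upper_right, h2]

open Classical in
/-- The sign of the empty rectangle that leaves `x` at the heights `b` and `t`
(and `1` if there is none). -/
noncomputable def signAt (σ : RectSign n) (x : Gen n) (b t : Fin n) : ℤˣ :=
  if h : IsEmptyAt x b t then σ x (x * swap b t) (emptyRectAt x h) else 1

theorem signAt_eq (σ : RectSign n) {x y : Gen n} (r : EmptyRect x y) :
    signAt σ x r.1.bottom r.1.top = σ x y r := by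
  have key : ∀ (z : Gen n) (s : EmptyRect x z), z = y → s.1.bottom = r.1.bottom →
      s.1.top = r.1.top → σ x z s = σ x y r := by
    rintro z s rfl h1 h2
    rw [EmptyRect.ext' h1 h2]
  rw [signAt, dif_pos r.isEmptyAt]
  exact key _ _ r.mul_swap rfl rfl

theorem exists_emptyRect {x y : Gen n} {b t : Fin n} (h : IsEmptyAt x b t)
    (hy : x * swap b t = y) : ∃ r : EmptyRect x y, r.1 = rectAt x h.1 := by
  subst hy
  exact ⟨emptyRectAt x h, rfl⟩

open Classical in
theorem sum_emptyRect {M : Type} [AddCommMonoid M] {x z : Gen n} (f : EmptyRect x z → M)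
    (g : Fin n × Fin n → M) (hfg : ∀ r, f r = g (r.1.bottom, r.1.top)) :
    ∑ r, f r = ∑ p : Fin n × Fin n,
      if IsEmptyAt x p.1 p.2 ∧ x * swap p.1 p.2 = z then g p else 0 := by
  rw [← Finset.sum_filter]
  refine Finset.sum_bij (fun r _ => (r.1.bottom, r.1.top)) ?_ ?_ ?_ ?_
  · exact fun r _ => Finset.mem_filter.2 ⟨Finset.mem_univ _, r.isEmptyAt, r.mul_swap⟩
  · intro r _ s _ h
    rw [Prod.mk.injEq] at h
    exact EmptyRect.ext' h.1 h.2
  · intro p hp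
    obtain ⟨r, hr⟩ := exists_emptyRect (Finset.mem_filter.1 hp).2.1 (Finset.mem_filter.1 hp).2.2
    exact ⟨r, Finset.mem_univ _, by rw [hr]; rfl⟩
  · exact fun r _ => hfg r

/-! ### Signs and multiplicative weights -/

/-- The axioms of a sign assignment, for the images of the signs in a ring. -/
structure SignRel (A : Type) [Ring A] (σ : RectSign n) : Prop where
  sq : ∀ (x y y' z : Gen n) (r₁ : EmptyRect x y) (r₂ : EmptyRect y z)
      (s₁ : EmptyRect x y') (s₂ : EmptyRect y' z), r₁.1 ≠ s₁.1 →
      (∀ col row, r₁.1.mult col row + r₂.1.mult col row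
        = s₁.1.mult col row + s₂.1.mult col row) →
      (((σ x y r₁ * σ y z r₂ : ℤˣ) : ℤ) : A) = -(((σ x y' s₁ * σ y' z s₂ : ℤˣ) : ℤ) : A)
  vertical : ∀ (x y : Gen n) (r₁ : EmptyRect x y) (r₂ : EmptyRect y x),
      r₁.1.left = r₂.1.left → r₁.1.right = r₂.1.right →
      r₁.1.top = r₂.1.bottom → r₂.1.top = r₁.1.bottom →
      (((σ x y r₁ * σ y x r₂ : ℤˣ) : ℤ) : A) = -1
  horizontal : ∀ (x y : Gen n) (r₁ : EmptyRect x y) (r₂ : EmptyRect y x),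
      r₁.1.bottom = r₂.1.bottom → r₁.1.top = r₂.1.top →
      r₁.1.right = r₂.1.left → r₂.1.right = r₁.1.left →
      (((σ x y r₁ * σ y x r₂ : ℤˣ) : ℤ) : A) = 1

theorem IsSignAssignment.signRel {S : RectSign n} (hS : IsSignAssignment S) (A : Type) [Ring A] :
    SignRel A S where
  sq x y y' z r₁ r₂ s₁ s₂ h h' := by rw [hS.sq x y y' z r₁ r₂ s₁ s₂ h h']; push_cast; rfl
  vertical x y r₁ r₂ h1 h2 h3 h4 := by rw [hS.vertical x y r₁ r₂ h1 h2 h3 h4]; simp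
  horizontal x y r₁ r₂ h1 h2 h3 h4 := by rw [hS.horizontal x y r₁ r₂ h1 h2 h3 h4]; simp

theorem noSign_signRel (n : ℕ) (h : (1 : A) = -1) : SignRel A (noSign n) where
  sq _ _ _ _ _ _ _ _ _ _ := by simpa [noSign] using h
  vertical _ _ _ _ _ _ _ _ := by simpa [noSign] using h
  horizontal := by simp [noSign]

/-- A weight of rectangles `(left, right, bottom, top)` with values in a ring, which is
multiplicative when a rectangle is cut. Only weights of rectangles with an edge on the
`c`-th vertical circle may fail to be central. The weight of the upper part acts after that of the lower
part along a left edge, and before it along a right edge. -/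
structure IsTransferWeight (c : Fin n) (w : Fin n → Fin n → Fin n → Fin n → A) : Prop where
  central : ∀ l r b t, l ≠ c → r ≠ c → ∀ a, w l r b t * a = a * w l r b t
  cut_left : ∀ l r b m t, l ≠ r → r ≠ c → Cyc b m t → w l r b t = w l r m t * w l r b m
  cut_right : ∀ l r b m t, l ≠ r → l ≠ c → Cyc b m t → w l r b t = w l r b m * w l r m t
  join : ∀ l m r b t, b ≠ t → Cyc l m r → w m r b t * w l m b t = w l r b t
  join' : ∀ l m r b t, b ≠ t → Cyc l m r → w l m b t * w m r b t = w l r b t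

/-! The two decompositions of an L-shaped domain have the same weight. -/

namespace IsTransferWeight

variable {c : Fin n} {w : Fin n → Fin n → Fin n → Fin n → A} {b m t l M r : Fin n}

theorem without_upper_left (hw : IsTransferWeight c w) (h : Cyc b m t) (hc : Cyc l M r) :
    w M r b t * w l M b m = w l r b m * w M r m t := by
  obtain ⟨n1, n2, n3⟩ := hc.ne
  have hbm := h.ne.1
  by_cases hr : r = c
  · rw [hw.cut_right M r b m t n2 (hr ▸ n2) h, mul_assoc,
      ← hw.central l M b m (hr ▸ n3) (hr ▸ n2), ← mul_assoc, hw.join l M r b m hbm hc]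
  · rw [hw.cut_left M r b m t n2 hr h, mul_assoc, hw.join l M r b m hbm hc]
    by_cases hM : M = c
    · rw [hw.central l r b m (hM ▸ n1) hr]
    · rw [hw.central M r m t hM hr]

theorem without_lower_right (hw : IsTransferWeight c w) (h : Cyc b m t) (hc : Cyc l M r) :
    w l M b t * w M r m t = w l r m t * w l M b m := by
  obtain ⟨n1, n2, n3⟩ := hc.ne
  have hmt := h.ne.2.1
  by_cases hM : M = c
  · rw [hw.cut_right l M b m t n1 (hM ▸ n1) h, mul_assoc, hw.join' l M r m t hmt hc,
      hw.central l r m t (hM ▸ n1) (hM ▸ n2.symm)]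
  · rw [hw.cut_left l M b m t n1 hM h, mul_assoc]
    by_cases hr : r = c
    · rw [hw.central l M b m (hr ▸ n3) hM, ← mul_assoc, hw.join' l M r m t hmt hc]
    · rw [← hw.central M r m t hM hr, ← mul_assoc, hw.join' l M r m t hmt hc]

theorem without_upper_right (hw : IsTransferWeight c w) (h : Cyc b m t) (hc : Cyc l M r) :
    w M r b m * w l M b t = w l M m t * w l r b m := by
  obtain ⟨n1, n2, n3⟩ := hc.ne
  have hbm := h.ne.1
  by_cases hM : M = c
  · rw [hw.cut_right l M b m t n1 (hM ▸ n1) h, ← mul_assoc, hw.join l M r b m hbm hc,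
      hw.central l r b m (hM ▸ n1) (hM ▸ n2.symm)]
  · rw [hw.cut_left l M b m t n1 hM h, ← mul_assoc]
    by_cases hr : r = c
    · rw [← hw.central l M m t (hr ▸ n3) hM, mul_assoc, hw.join l M r b m hbm hc]
    · rw [hw.central M r b m hM hr, mul_assoc, hw.join l M r b m hbm hc]

theorem without_lower_left (hw : IsTransferWeight c w) (h : Cyc b m t) (hc : Cyc l M r) :
    w l M m t * w M r b t = w M r b m * w l r m t := by
  obtain ⟨n1, n2, n3⟩ := hc.ne
  have hmt := h.ne.2.1
  by_cases hr : r = c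
  · rw [hw.cut_right M r b m t n2 (hr ▸ n2) h, ← mul_assoc,
      hw.central l M m t (hr ▸ n3) (hr ▸ n2), mul_assoc, hw.join' l M r m t hmt hc]
  · rw [hw.cut_left M r b m t n2 hr h, ← mul_assoc, hw.join' l M r m t hmt hc]
    by_cases hM : M = c
    · rw [hw.central l r m t (hM ▸ n1) hr]
    · rw [hw.central M r b m hM hr]

end IsTransferWeight

/-! ### Multiplicities -/

/-- The multiplicity of the square `(col, row)` in the rectangle that extends from `l` to `r` and from
`b` to `t`. -/
def multAt (l r b t col row : Fin n) : ℕ :=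
  if gap l col < gap l r ∧ gap b row < gap b t then 1 else 0

theorem mult_rectAt (x : Gen n) {b t : Fin n} (h : b ≠ t) (i j : Fin n) :
    (rectAt x h).mult i j = multAt (x b) (x t) b t i j := by
  classical
  rw [Rect.mult, multAt]
  exact if_congr Iff.rfl rfl rfl

theorem Cyc.gap_lt_iff {b m t : Fin n} (h : Cyc b m t) (i : Fin n) :
    gap b i < gap b t ↔ gap b i < gap b m ∨ gap m i < gap m t := by
  rw [cyc_iff] at h
  simp only [GridHomology.gap_lt_iff]
  omega

theorem Cyc.not_gap_lt {b m t : Fin n} (h : Cyc b m t) (i : Fin n) :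
    ¬ (gap b i < gap b m ∧ gap m i < gap m t) := by
  rw [cyc_iff] at h
  simp only [GridHomology.gap_lt_iff]
  omega

theorem multAt_cut_row {b m t : Fin n} (l r i j : Fin n) (h : Cyc b m t) :
    multAt l r b t i j = multAt l r b m i j + multAt l r m t i j := by
  have h1 := h.gap_lt_iff j
  have h2 := h.not_gap_lt j
  unfold multAt
  split_ifs <;> tauto

theorem multAt_cut_col {l M r : Fin n} (b t i j : Fin n) (hc : Cyc l M r) :
    multAt l r b t i j = multAt l M b t i j + multAt M r b t i j := by
  have h1 := hc.gap_lt_iff i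
  have h2 := hc.not_gap_lt i
  unfold multAt
  split_ifs <;> tauto

/-! ### The square of a matrix of weighted rectangles -/

theorem intCast_mul_mul_intCast_mul (s₁ s₂ : ℤ) (a₁ a₂ : A) :
    (s₂ : A) * a₂ * ((s₁ : A) * a₁) = (s₁ : A) * s₂ * (a₂ * a₁) := by
  rw [mul_assoc, ← mul_assoc a₂, ← (Int.cast_commute s₁ a₂).eq, mul_assoc, ← mul_assoc (s₂ : A),
    (Int.cast_commute s₂ (s₁ : A)).eq]

/-- The matrix over `A` which counts empty rectangles with the signs `σ` and the weights `w`. -/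
noncomputable def rectMatrix (σ : RectSign n) (w : Fin n → Fin n → Fin n → Fin n → A) :
    Matrix (Gen n) (Gen n) A := fun z x =>
  ∑ r : EmptyRect x z, ((σ x z r : ℤ) : A) * w r.1.left r.1.right r.1.bottom r.1.top

/-- Heights `((b, t), (b', t'))` of two consecutive empty rectangles which start at `x`. -/
def IsEmptyPair (x : Gen n) (q : (Fin n × Fin n) × (Fin n × Fin n)) : Prop :=
  IsEmptyAt x q.1.1 q.1.2 ∧ IsEmptyAt (x * swap q.1.1 q.1.2) q.2.1 q.2.2

/-- The end point of two consecutive rectangles. -/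
def pairEnd (x : Gen n) (q : (Fin n × Fin n) × (Fin n × Fin n)) : Gen n :=
  x * swap q.1.1 q.1.2 * swap q.2.1 q.2.2

/-- The contribution of one rectangle. -/
noncomputable def valAt (σ : RectSign n) (w : Fin n → Fin n → Fin n → Fin n → A) (x : Gen n)
    (p : Fin n × Fin n) : A :=
  ((signAt σ x p.1 p.2 : ℤ) : A) * w (x p.1) (x p.2) p.1 p.2

/-- The contribution of two consecutive rectangles. -/
noncomputable def pairVal (σ : RectSign n) (w : Fin n → Fin n → Fin n → Fin n → A) (x : Gen n)
    (q : (Fin n × Fin n) × (Fin n × Fin n)) : A :=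
  valAt σ w (x * swap q.1.1 q.1.2) q.2 * valAt σ w x q.1

open Classical in
theorem rectMatrix_apply (σ : RectSign n) (w : Fin n → Fin n → Fin n → Fin n → A) (z x : Gen n) :
    rectMatrix σ w z x = ∑ p : Fin n × Fin n,
      if IsEmptyAt x p.1 p.2 ∧ x * swap p.1 p.2 = z then valAt σ w x p else 0 :=
  sum_emptyRect _ _ fun r => by
    simp only [valAt, signAt_eq, r.2.1.lower_left, r.2.1.upper_right]

open Classical in
theorem rectMatrix_mul_self_apply (σ : RectSign n) (w : Fin n → Fin n → Fin n → Fin n → A)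
    (z x : Gen n) :
    (rectMatrix σ w * rectMatrix σ w) z x =
      ∑ q : (Fin n × Fin n) × (Fin n × Fin n),
        if IsEmptyPair x q ∧ pairEnd x q = z then pairVal σ w x q else 0 := by
  rw [Matrix.mul_apply, Fintype.sum_prod_type]
  simp only [rectMatrix_apply σ w _ x, Finset.mul_sum]
  rw [Finset.sum_comm]
  refine Finset.sum_congr rfl fun p _ => ?_
  by_cases hp : IsEmptyAt x p.1 p.2
  · rw [Finset.sum_eq_single (x * swap p.1 p.2)]
    · rw [if_pos ⟨hp, rfl⟩, rectMatrix_apply, Finset.sum_mul]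
      refine Finset.sum_congr rfl fun p' _ => ?_
      simp only [IsEmptyPair, pairEnd, pairVal, hp, true_and, ite_mul, zero_mul]
    · intro y _ hy
      rw [if_neg (fun h => hy h.2.symm), mul_zero]
    · exact fun h => absurd (Finset.mem_univ _) h
  · simp [IsEmptyPair, hp]

/-- Two different decompositions of one domain, of the same weight, cancel. -/
theorem pairVal_add_pairVal {σ : RectSign n} (hσ : SignRel A σ)
    {w : Fin n → Fin n → Fin n → Fin n → A} {x : Gen n} {b t b' t' d u d' u' : Fin n}
    (h : IsEmptyPair x ((b, t), (b', t'))) (h' : IsEmptyPair x ((d, u), (d', u')))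
    (hz : pairEnd x ((b, t), (b', t')) = pairEnd x ((d, u), (d', u')))
    (hne : (b, t) ≠ (d, u))
    (hm : ∀ i j, multAt (x b) (x t) b t i j
        + multAt ((x * swap b t) b') ((x * swap b t) t') b' t' i j
      = multAt (x d) (x u) d u i j + multAt ((x * swap d u) d') ((x * swap d u) u') d' u' i j)
    (hw : w ((x * swap b t) b') ((x * swap b t) t') b' t' * w (x b) (x t) b t
      = w ((x * swap d u) d') ((x * swap d u) u') d' u' * w (x d) (x u) d u) :
    pairVal σ w x ((b, t), (b', t')) + pairVal σ w x ((d, u), (d', u')) = 0 := by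
  obtain ⟨r₁, hr₁⟩ := exists_emptyRect h.1 rfl
  obtain ⟨r₂, hr₂⟩ := exists_emptyRect h.2 hz
  obtain ⟨s₁, hs₁⟩ := exists_emptyRect h'.1 rfl
  obtain ⟨s₂, hs₂⟩ := exists_emptyRect h'.2 (rfl : _ = pairEnd x ((d, u), (d', u')))
  have key := hσ.sq _ _ _ _ r₁ r₂ s₁ s₂ (by
    rw [hr₁, hs₁]
    exact fun e => hne (Prod.ext (congrArg Rect.bottom e) (congrArg Rect.top e))) (by
    intro i j
    rw [hr₁, hr₂, hs₁, hs₂]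
    simp only [mult_rectAt]
    exact hm i j)
  have e1 := signAt_eq σ r₁
  have e2 := signAt_eq σ r₂
  have e3 := signAt_eq σ s₁
  have e4 := signAt_eq σ s₂
  rw [hr₁] at e1
  rw [hr₂] at e2
  rw [hs₁] at e3
  rw [hs₂] at e4
  rw [← e1, ← e2, ← e3, ← e4] at key
  simp only [rectAt, Units.val_mul, Int.cast_mul] at key
  simp only [pairVal, valAt]
  rw [intCast_mul_mul_intCast_mul, intCast_mul_mul_intCast_mul, key, hw, neg_mul, neg_add_cancel]

theorem pairEnd_apply (x : Gen n) (q : (Fin n × Fin n) × (Fin n × Fin n)) (h : Fin n) :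
    pairEnd x q h = x (swap q.1.1 q.1.2 (swap q.2.1 q.2.2 h)) := rfl

open Classical in
/-- The heights of the other decomposition of the domain of two consecutive rectangles. -/
noncomputable def otherPair (x : Gen n) (q : (Fin n × Fin n) × (Fin n × Fin n)) :
    (Fin n × Fin n) × (Fin n × Fin n) :=
  if q.2.1 = q.1.1 then
    if Cyc q.1.1 q.1.2 q.2.2 then ((q.1.2, q.2.2), (q.1.1, q.1.2))
    else ((q.1.1, q.2.2), (q.2.2, q.1.2))
  else if q.2.2 = q.1.2 then
    if Cyc q.1.1 q.2.1 q.1.2 then ((q.2.1, q.1.2), (q.1.1, q.2.1))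
    else ((q.2.1, q.1.1), (q.1.1, q.1.2))
  else if q.2.1 = q.1.2 then
    if Cyc (x q.1.1) (x q.1.2) (x q.2.2) then ((q.1.2, q.2.2), (q.1.1, q.2.2))
    else ((q.1.1, q.2.2), (q.1.1, q.1.2))
  else if q.2.2 = q.1.1 then
    if Cyc (x q.2.1) (x q.1.1) (x q.1.2) then ((q.2.1, q.1.1), (q.2.1, q.1.2))
    else ((q.2.1, q.1.2), (q.1.1, q.1.2))
  else ((q.2.1, q.2.2), (q.1.1, q.1.2))

section

variable {σ : RectSign n} {c : Fin n} {w : Fin n → Fin n → Fin n → Fin n → A} {x : Gen n}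
  {b m t : Fin n}

/-- `q` and `q'` are the two decompositions of one domain, and their contributions cancel. -/
structure Cancels (σ : RectSign n) (w : Fin n → Fin n → Fin n → Fin n → A) (x : Gen n)
    (q q' : (Fin n × Fin n) × (Fin n × Fin n)) : Prop where
  pairEnd_eq : pairEnd x q = pairEnd x q'
  other : otherPair x q = q'
  other' : otherPair x q' = q
  ne : q ≠ q'
  add_eq_zero : pairVal σ w x q + pairVal σ w x q' = 0

theorem Cancels.symm {q q' : (Fin n × Fin n) × (Fin n × Fin n)} (h : Cancels σ w x q q') :
    Cancels σ w x q' q :=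
  ⟨h.pairEnd_eq.symm, h.other', h.other, h.ne.symm, by rw [add_comm]; exact h.add_eq_zero⟩

theorem cancels_without_upper_left (hσ : SignRel A σ) (hw : IsTransferWeight c w) (h : Cyc b m t)
    (hc : Cyc (x b) (x m) (x t)) (e : IsEmptyPair x ((b, m), (b, t)))
    (e' : IsEmptyPair x ((m, t), (b, m))) :
    Cancels σ w x ((b, m), (b, t)) ((m, t), (b, m)) := by
  obtain ⟨n1, n2, n3⟩ := h.ne
  have hz : pairEnd x ((b, m), (b, t)) = pairEnd x ((m, t), (b, m)) := by
    ext i : 1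
    simp only [pairEnd_apply, Equiv.swap_apply_def]
    grind
  have hne : ((b, m) : Fin n × Fin n) ≠ (m, t) := by grind
  refine ⟨hz, ?_, ?_, fun h => hne (congrArg Prod.fst h),
    pairVal_add_pairVal hσ e e' hz hne (fun i j => ?_) ?_⟩
  · grind [otherPair, Cyc.asymm, Cyc.rotate]
  · grind [otherPair, Cyc.asymm, Cyc.rotate]
  · simp only [mul_swap_apply, n1, n2, n3, n2.symm, n3.symm, if_true, if_false]
    rw [multAt_cut_row (x m) (x t) i j h, multAt_cut_col b m i j hc]
    ring
  · simp only [mul_swap_apply, n1, n2, n3, n2.symm, n3.symm, if_true, if_false]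
    exact hw.without_upper_left h hc

theorem cancels_without_lower_right (hσ : SignRel A σ) (hw : IsTransferWeight c w) (h : Cyc b m t)
    (hc : Cyc (x b) (x m) (x t)) (e : IsEmptyPair x ((m, t), (b, t)))
    (e' : IsEmptyPair x ((b, m), (m, t))) :
    Cancels σ w x ((m, t), (b, t)) ((b, m), (m, t)) := by
  obtain ⟨n1, n2, n3⟩ := h.ne
  have hz : pairEnd x ((m, t), (b, t)) = pairEnd x ((b, m), (m, t)) := by
    ext i : 1
    simp only [pairEnd_apply, Equiv.swap_apply_def]
    grind
  have hne : ((m, t) : Fin n × Fin n) ≠ (b, m) := by grind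
  refine ⟨hz, ?_, ?_, fun h => hne (congrArg Prod.fst h),
    pairVal_add_pairVal hσ e e' hz hne (fun i j => ?_) ?_⟩
  · grind [otherPair, Cyc.asymm, Cyc.rotate]
  · grind [otherPair, Cyc.asymm, Cyc.rotate]
  · simp only [mul_swap_apply, n1, n3, n1.symm, n2.symm, n3.symm, if_true, if_false]
    rw [multAt_cut_row (x b) (x m) i j h, multAt_cut_col m t i j hc]
    ring
  · simp only [mul_swap_apply, n1, n3, n1.symm, n2.symm, n3.symm, if_true, if_false]
    exact hw.without_lower_right h hc

theorem cancels_without_upper_right (hσ : SignRel A σ) (hw : IsTransferWeight c w) (h : Cyc b m t)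
    (hc : Cyc (x b) (x t) (x m)) (e : IsEmptyPair x ((b, t), (b, m)))
    (e' : IsEmptyPair x ((b, m), (m, t))) :
    Cancels σ w x ((b, t), (b, m)) ((b, m), (m, t)) := by
  obtain ⟨n1, n2, n3⟩ := h.ne
  have hz : pairEnd x ((b, t), (b, m)) = pairEnd x ((b, m), (m, t)) := by
    ext i : 1
    simp only [pairEnd_apply, Equiv.swap_apply_def]
    grind
  have hne : ((b, t) : Fin n × Fin n) ≠ (b, m) := by grind
  refine ⟨hz, ?_, ?_, fun h => hne (congrArg Prod.fst h),
    pairVal_add_pairVal hσ e e' hz hne (fun i j => ?_) ?_⟩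
  · grind [otherPair, Cyc.asymm, Cyc.rotate]
  · grind [otherPair, Cyc.asymm, Cyc.rotate]
  · simp only [mul_swap_apply, n2, n3, n1.symm, n2.symm, n3.symm, if_true, if_false]
    rw [multAt_cut_row (x b) (x t) i j h, multAt_cut_col b m i j hc]
    ring
  · simp only [mul_swap_apply, n2, n3, n1.symm, n2.symm, n3.symm, if_true, if_false]
    exact hw.without_upper_right h hc

theorem cancels_without_lower_left (hσ : SignRel A σ) (hw : IsTransferWeight c w) (h : Cyc b m t)
    (hc : Cyc (x m) (x b) (x t)) (e : IsEmptyPair x ((b, t), (m, t)))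
    (e' : IsEmptyPair x ((m, t), (b, m))) :
    Cancels σ w x ((b, t), (m, t)) ((m, t), (b, m)) := by
  obtain ⟨n1, n2, n3⟩ := h.ne
  have hz : pairEnd x ((b, t), (m, t)) = pairEnd x ((m, t), (b, m)) := by
    ext i : 1
    simp only [pairEnd_apply, Equiv.swap_apply_def]
    grind
  have hne : ((b, t) : Fin n × Fin n) ≠ (m, t) := by grind
  refine ⟨hz, ?_, ?_, fun h => hne (congrArg Prod.fst h),
    pairVal_add_pairVal hσ e e' hz hne (fun i j => ?_) ?_⟩
  · grind [otherPair, Cyc.asymm, Cyc.rotate]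
  · grind [otherPair, Cyc.asymm, Cyc.rotate]
  · simp only [mul_swap_apply, n1, n2, n3, n1.symm, n3.symm, if_true, if_false]
    rw [multAt_cut_row (x b) (x t) i j h, multAt_cut_col m t i j hc]
    ring
  · simp only [mul_swap_apply, n1, n2, n3, n1.symm, n3.symm, if_true, if_false]
    exact hw.without_lower_left h hc

theorem cancels_disjoint (hσ : SignRel A σ) (hw : IsTransferWeight c w) {i j k l : Fin n}
    (hik : i ≠ k) (hil : i ≠ l) (hjk : j ≠ k) (hjl : j ≠ l)
    (e : IsEmptyPair x ((i, j), (k, l))) (e' : IsEmptyPair x ((k, l), (i, j))) :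
    Cancels σ w x ((i, j), (k, l)) ((k, l), (i, j)) := by
  have hz : pairEnd x ((i, j), (k, l)) = pairEnd x ((k, l), (i, j)) := by
    ext h : 1
    simp only [pairEnd_apply]
    congr 1
    simp only [Equiv.swap_apply_def]
    grind
  have hne : ((i, j) : Fin n × Fin n) ≠ (k, l) := by simp [hik]
  refine ⟨hz, ?_, ?_, fun h => hne (congrArg Prod.fst h), ?_⟩
  · simp [otherPair, hik.symm, hil.symm, hjk.symm, hjl.symm]
  · simp [otherPair, hik, hil, hjk, hjl]
  · apply pairVal_add_pairVal hσ e e' hz hne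
    · intro a b
      simp only [mul_swap_apply, hik, hil, hjk, hjl, hik.symm, hil.symm, hjk.symm, hjl.symm, if_false]
      rw [add_comm]
    · simp only [mul_swap_apply, hik, hil, hjk, hjl, hik.symm, hil.symm, hjk.symm, hjl.symm, if_false]
      by_cases h : x i ≠ c ∧ x j ≠ c
      · rw [hw.central _ _ _ _ h.1 h.2]
      · rw [hw.central (x k) (x l)]
        · intro hk
          exact h ⟨hk ▸ x.injective.ne hik, hk ▸ x.injective.ne hjk⟩
        · intro hl
          exact h ⟨hl ▸ x.injective.ne hil, hl ▸ x.injective.ne hjl⟩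

/-- Two consecutive empty rectangles which do not form an annulus have a second decomposition. -/
theorem cancels_otherPair (hσ : SignRel A σ) (hw : IsTransferWeight c w)
    {q : (Fin n × Fin n) × (Fin n × Fin n)} (e : IsEmptyPair x q) (hq : pairEnd x q ≠ x) :
    IsEmptyPair x (otherPair x q) ∧ Cancels σ w x q (otherPair x q) := by
  suffices ∃ q', IsEmptyPair x q' ∧ Cancels σ w x q q' by
    obtain ⟨q', h1, h2⟩ := this
    exact h2.other ▸ ⟨h1, h2⟩
  obtain ⟨⟨b, t⟩, ⟨b', t'⟩⟩ := q
  have hbt : b ≠ t := e.1.1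
  have hbt' : b' ≠ t' := e.2.1
  by_cases h1 : b' = b
  · subst h1
    have htt : t ≠ t' := by
      rintro rfl
      exact hq (by simp [pairEnd])
    rcases cyc_or_cyc hbt htt hbt' with h | h
    · obtain ⟨hc, e1, e2⟩ := empty_without_upper_left_iff.1 ⟨h, e.1, e.2⟩
      exact ⟨_, ⟨e1, e2⟩, cancels_without_upper_left hσ hw h hc e ⟨e1, e2⟩⟩
    · obtain ⟨hc, e1, e2⟩ := empty_without_upper_right_iff.1 ⟨h, e.1, e.2⟩
      exact ⟨_, ⟨e1, e2⟩, cancels_without_upper_right hσ hw h hc e ⟨e1, e2⟩⟩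
  by_cases h2 : t' = t
  · subst h2
    rcases cyc_or_cyc (Ne.symm h1) hbt' hbt with h | h
    · obtain ⟨hc, e1, e2⟩ := empty_without_lower_left_iff.1 ⟨h, e.1, e.2⟩
      exact ⟨_, ⟨e1, e2⟩, cancels_without_lower_left hσ hw h hc e ⟨e1, e2⟩⟩
    · obtain ⟨hc, e1, e2⟩ := empty_without_lower_right_iff.1 ⟨h.rotate.rotate, e.1, e.2⟩
      exact ⟨_, ⟨e1, e2⟩, cancels_without_lower_right hσ hw h.rotate.rotate hc e ⟨e1, e2⟩⟩
  by_cases h3 : b' = t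
  · subst h3
    have hbt'' : b ≠ t' := by
      rintro rfl
      exact hq (by simp [pairEnd, Equiv.swap_comm])
    rcases cyc_or_cyc (x.injective.ne hbt) (x.injective.ne hbt') (x.injective.ne hbt'') with h | h
    · obtain ⟨hr, e1, e2⟩ := empty_without_lower_right_iff.2 ⟨h, e.1, e.2⟩
      exact ⟨_, ⟨e1, e2⟩, (cancels_without_lower_right hσ hw hr h ⟨e1, e2⟩ e).symm⟩
    · obtain ⟨hr, e1, e2⟩ := empty_without_upper_right_iff.2 ⟨h, e.1, e.2⟩
      exact ⟨_, ⟨e1, e2⟩, (cancels_without_upper_right hσ hw hr h ⟨e1, e2⟩ e).symm⟩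
  by_cases h4 : t' = b
  · subst h4
    rcases cyc_or_cyc (x.injective.ne hbt') (x.injective.ne hbt) (x.injective.ne h3) with h | h
    · obtain ⟨hr, e1, e2⟩ := empty_without_upper_left_iff.2 ⟨h, e.1, e.2⟩
      exact ⟨_, ⟨e1, e2⟩, (cancels_without_upper_left hσ hw hr h ⟨e1, e2⟩ e).symm⟩
    · obtain ⟨hr, e1, e2⟩ := empty_without_lower_left_iff.2 ⟨h.rotate.rotate, e.1, e.2⟩
      exact ⟨_, ⟨e1, e2⟩, (cancels_without_lower_left hσ hw hr h.rotate.rotate ⟨e1, e2⟩ e).symm⟩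
  obtain ⟨e1, e2⟩ := disjoint_isEmptyAt (Ne.symm h1) (Ne.symm h4) (Ne.symm h3) (Ne.symm h2) e.1 e.2
  exact ⟨_, ⟨e1, e2⟩, cancels_disjoint hσ hw (Ne.symm h1) (Ne.symm h4) (Ne.symm h3) (Ne.symm h2) e
    ⟨e1, e2⟩⟩

end

theorem rectMatrix_mul_self_off_diagonal {σ : RectSign n} (hσ : SignRel A σ) {c : Fin n}
    {w : Fin n → Fin n → Fin n → Fin n → A} (hw : IsTransferWeight c w) {z x : Gen n}
    (hzx : z ≠ x) : (rectMatrix σ w * rectMatrix σ w) z x = 0 := by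
  classical
  rw [rectMatrix_mul_self_apply, ← Finset.sum_filter]
  refine Finset.sum_involution (fun q _ => otherPair x q) ?_ ?_ ?_ ?_
  all_goals
    intro q hq
    obtain ⟨e, rfl⟩ := (Finset.mem_filter.1 hq).2
    obtain ⟨e', h⟩ := cancels_otherPair hσ hw e hzx
  · exact h.add_eq_zero
  · exact fun _ => h.ne.symm
  · exact Finset.mem_filter.2 ⟨Finset.mem_univ _, e', h.pairEnd_eq.symm⟩
  · exact h.other'

end GridHomology

namespace GridHomology

open Equiv (swap)

variable {n : ℕ}

/-! ### Thin annuli -/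

theorem gap_add_one [NeZero n] (hn : 2 ≤ n) (b : Fin n) : gap b (b + 1) = 1 := by
  rw [gap, add_sub_cancel_left, Fin.val_one', Nat.mod_eq_of_lt (by omega)]

theorem gap_inj {b i j : Fin n} (h : gap b i = gap b j) : i = j := by
  have hi := i.isLt
  have hj := j.isLt
  have hb := b.isLt
  rw [gap_eq, gap_eq] at h
  ext
  split_ifs at h <;> omega

theorem gap_self (b : Fin n) : gap b b = 0 := by simp [gap_eq]

theorem gap_pos {b i : Fin n} (h : b ≠ i) : 0 < gap b i :=
  Nat.pos_of_ne_zero fun e => h (gap_inj ((gap_self b).trans e.symm))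

theorem not_cyc_iff_eq_add_one [NeZero n] (hn : 2 ≤ n) {b t : Fin n} :
    (b ≠ t ∧ ∀ h, ¬ Cyc b h t) ↔ t = b + 1 := by
  constructor
  · rintro ⟨h, h'⟩
    have h1 := h' (b + 1)
    have h2 := gap_pos h
    rw [Cyc, gap_add_one hn] at h1
    refine gap_inj (b := b) ?_
    rw [gap_add_one hn]
    omega
  · rintro rfl
    have h1 := gap_add_one hn b
    refine ⟨fun h => ?_, fun h hh => ?_⟩
    · rw [← h, gap_self] at h1
      omega
    · rw [Cyc] at hh
      omega

theorem pairEnd_eq_self_iff {x : Gen n} {b t b' t' : Fin n} (h : b ≠ t) :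
    pairEnd x ((b, t), (b', t')) = x ↔ (b' = b ∧ t' = t) ∨ (b' = t ∧ t' = b) := by
  constructor
  · intro e
    have e1 : ∀ i, swap b t (swap b' t' i) = i := fun i => x.injective (DFunLike.congr_fun e i)
    have e2 := e1 b
    have e3 := e1 t
    simp only [Equiv.swap_apply_def] at e2 e3
    grind
  · rintro (⟨rfl, rfl⟩ | ⟨rfl, rfl⟩)
    · simp [pairEnd]
    · simp [pairEnd, Equiv.swap_comm]

/-- A horizontal annulus without points of `x` in the interior of its two parts is thin, since every point
at a height in between lies in one of the parts. -/
theorem isEmptyPair_horizontal [NeZero n] (hn : 2 ≤ n) {x : Gen n} {b t : Fin n} :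
    IsEmptyPair x ((b, t), (b, t)) ↔ t = b + 1 := by
  rw [← not_cyc_iff_eq_add_one hn]
  constructor
  · rintro ⟨⟨h, h1⟩, -, h2⟩
    refine ⟨h, fun i hi => ?_⟩
    have k1 := h1 i
    have k2 := h2 i
    have hb : i ≠ b := hi.ne.1.symm
    have ht : i ≠ t := hi.ne.2.1
    rw [mul_swap_left, mul_swap_right, mul_swap_of_ne x hb ht] at k2
    have := cyc_or_cyc (x.injective.ne h) (x.injective.ne ht.symm) (x.injective.ne hb.symm)
    rcases this with h | h
    · exact k2 ⟨h.rotate, hi⟩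
    · exact k1 ⟨h, hi⟩
  · exact fun h => ⟨⟨h.1, fun i hi => h.2 i hi.2⟩, h.1, fun i hi => h.2 i hi.2⟩

theorem isEmptyPair_vertical [NeZero n] (hn : 2 ≤ n) {x : Gen n} {b t : Fin n} :
    IsEmptyPair x ((b, t), (t, b)) ↔ x t = x b + 1 := by
  rw [← not_cyc_iff_eq_add_one hn]
  constructor
  · rintro ⟨⟨h, h1⟩, -, h2⟩
    refine ⟨x.injective.ne h, fun v hi => ?_⟩
    obtain ⟨i, rfl⟩ := x.surjective v
    have k1 := h1 i
    have k2 := h2 i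
    have hb : i ≠ b := fun e => hi.ne.1 (e ▸ rfl)
    have ht : i ≠ t := fun e => hi.ne.2.1 (e ▸ rfl)
    simp only [mul_swap_left, mul_swap_right, mul_swap_of_ne x hb ht] at k2
    rcases cyc_or_cyc h ht.symm hb.symm with h | h
    · exact k2 ⟨hi, h.rotate⟩
    · exact k1 ⟨hi, h⟩
  · intro h
    have hbt : b ≠ t := fun e => h.1 (e ▸ rfl)
    refine ⟨⟨hbt, fun i hi => h.2 _ hi.1⟩, hbt.symm, fun i hi => ?_⟩
    simp only [mul_swap_left, mul_swap_right] at hi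
    exact h.2 _ hi.1

variable {A : Type} [Ring A]

theorem pairVal_horizontal {σ : RectSign n} (hσ : SignRel A σ)
    (w : Fin n → Fin n → Fin n → Fin n → A) {x : Gen n} {b t : Fin n}
    (h : IsEmptyPair x ((b, t), (b, t))) :
    pairVal σ w x ((b, t), (b, t)) = w (x t) (x b) b t * w (x b) (x t) b t := by
  obtain ⟨r₁, hr₁⟩ := exists_emptyRect h.1 (rfl : _ = x * swap b t)
  obtain ⟨r₂, hr₂⟩ := exists_emptyRect h.2 ((pairEnd_eq_self_iff h.1.1).2 (Or.inl ⟨rfl, rfl⟩))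
  have e1 := signAt_eq σ r₁
  have e2 := signAt_eq σ r₂
  have key := hσ.horizontal _ _ r₁ r₂ (by rw [hr₁, hr₂]; rfl) (by rw [hr₁, hr₂]; rfl)
    (by rw [hr₁, hr₂]; exact (mul_swap_left x b t).symm)
    (by rw [hr₁, hr₂]; exact mul_swap_right x b t)
  rw [← e1, ← e2, hr₁, hr₂] at key
  simp only [rectAt, Units.val_mul, Int.cast_mul] at key
  simp only [pairVal, valAt]
  rw [intCast_mul_mul_intCast_mul, key, one_mul, mul_swap_left, mul_swap_right]

theorem pairVal_vertical {σ : RectSign n} (hσ : SignRel A σ)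
    (w : Fin n → Fin n → Fin n → Fin n → A) {x : Gen n} {b t : Fin n}
    (h : IsEmptyPair x ((b, t), (t, b))) :
    pairVal σ w x ((b, t), (t, b)) = -(w (x b) (x t) t b * w (x b) (x t) b t) := by
  obtain ⟨r₁, hr₁⟩ := exists_emptyRect h.1 (rfl : _ = x * swap b t)
  obtain ⟨r₂, hr₂⟩ := exists_emptyRect h.2 ((pairEnd_eq_self_iff h.1.1).2 (Or.inr ⟨rfl, rfl⟩))
  have e1 := signAt_eq σ r₁
  have e2 := signAt_eq σ r₂
  have key := hσ.vertical _ _ r₁ r₂ (by rw [hr₁, hr₂]; exact (mul_swap_right x b t).symm)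
    (by rw [hr₁, hr₂]; exact (mul_swap_left x b t).symm)
    (by rw [hr₁, hr₂]; rfl) (by rw [hr₁, hr₂]; rfl)
  rw [← e1, ← e2, hr₁, hr₂] at key
  simp only [rectAt, Units.val_mul, Int.cast_mul] at key
  simp only [pairVal, valAt]
  rw [intCast_mul_mul_intCast_mul, key, neg_one_mul, mul_swap_left, mul_swap_right]

/-- Only thin annuli contribute to the diagonal. -/
theorem rectMatrix_mul_self_diagonal [NeZero n] (hn : 2 ≤ n) {σ : RectSign n} (hσ : SignRel A σ)
    (w : Fin n → Fin n → Fin n → Fin n → A) (x : Gen n) :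
    (rectMatrix σ w * rectMatrix σ w) x x =
      ∑ b, w (x (b + 1)) (x b) b (b + 1) * w (x b) (x (b + 1)) b (b + 1)
        - ∑ v, w v (v + 1) (x.symm (v + 1)) (x.symm v) * w v (v + 1) (x.symm v) (x.symm (v + 1)) := by
  classical
  rw [rectMatrix_mul_self_apply, Fintype.sum_prod_type]
  have h1 : ∀ p : Fin n × Fin n, (∑ p' : Fin n × Fin n,
      if IsEmptyPair x (p, p') ∧ pairEnd x (p, p') = x then pairVal σ w x (p, p') else 0) =
      (if p.2 = p.1 + 1 then w (x p.2) (x p.1) p.1 p.2 * w (x p.1) (x p.2) p.1 p.2 else 0) -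
      (if p.2 = x.symm (x p.1 + 1) then
        w (x p.1) (x p.2) p.2 p.1 * w (x p.1) (x p.2) p.1 p.2 else 0) := by
    rintro ⟨b, t⟩
    dsimp only
    by_cases hbt : b = t
    · rw [if_neg, if_neg, Finset.sum_eq_zero, sub_zero]
      · exact fun p' _ => if_neg fun h => h.1.1.1 hbt
      · rw [Equiv.eq_symm_apply, ← isEmptyPair_vertical hn]
        exact fun h => h.1.1 hbt
      · rw [← isEmptyPair_horizontal hn (x := x)]
        exact fun h => h.1.1 hbt
    have hne : ((b, t) : Fin n × Fin n) ≠ (t, b) := fun h => hbt (congrArg Prod.fst h)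
    rw [← Finset.sum_subset (Finset.subset_univ {(b, t), (t, b)}), Finset.sum_pair hne, sub_eq_add_neg]
    · congr 1
      · rw [(pairEnd_eq_self_iff hbt).2 (Or.inl ⟨rfl, rfl⟩), isEmptyPair_horizontal hn]
        by_cases h : t = b + 1
        · rw [if_pos ⟨h, rfl⟩, if_pos h, pairVal_horizontal hσ w ((isEmptyPair_horizontal hn).2 h)]
        · rw [if_neg fun h' => h h'.1, if_neg h]
      · rw [(pairEnd_eq_self_iff hbt).2 (Or.inr ⟨rfl, rfl⟩), isEmptyPair_vertical hn]
        by_cases h : x t = x b + 1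
        · rw [if_pos ⟨h, rfl⟩, if_pos ((Equiv.eq_symm_apply x).2 h),
            pairVal_vertical hσ w ((isEmptyPair_vertical hn).2 h)]
        · rw [if_neg fun h' => h h'.1, if_neg fun h' => h ((Equiv.eq_symm_apply x).1 h'), neg_zero]
    · rintro ⟨b', t'⟩ _ h
      refine if_neg fun h' => h ?_
      rcases (pairEnd_eq_self_iff hbt).1 h'.2 with ⟨rfl, rfl⟩ | ⟨rfl, rfl⟩ <;> simp
  simp only [h1, Finset.sum_sub_distrib, Fintype.sum_prod_type, Finset.sum_ite_eq',
    Finset.mem_univ, if_true, Equiv.apply_symm_apply]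
  congr 1
  conv_rhs => rw [← Equiv.sum_comp x]
  simp only [Equiv.symm_apply_apply]

end GridHomology

namespace GridHomology

open Matrix

variable {n : ℕ} {P : Type} [CommRing P]

/-! ### Transfer matrices along the distinguished circle -/

/-- The `k`-th position after `p` on the circle of length `n`. -/
def shift (p : Fin n) (k : ℕ) : Fin n := ⟨(p.val + k) % n, Nat.mod_lt _ p.pos⟩

theorem gap_shift (p : Fin n) {k : ℕ} (hk : k < n) : gap p (shift p k) = k := by
  have hp := p.isLt
  simp only [gap_eq, shift]
  rcases lt_or_ge (p.val + k) n with h | h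
  · rw [Nat.mod_eq_of_lt h, if_pos (by omega)]
    omega
  · rw [Nat.mod_eq_sub_mod h, Nat.mod_eq_of_lt (by omega), if_neg (by omega)]
    omega

theorem gap_lt (p q : Fin n) : gap p q < n := (q - p).isLt

theorem shift_gap (p q : Fin n) : shift p (gap p q) = q :=
  gap_inj (gap_shift p (gap_lt p q))

theorem shift_shift (p : Fin n) (j k : ℕ) : shift (shift p j) k = shift p (j + k) := by
  simp only [shift, Nat.mod_add_mod, add_assoc]

theorem gap_eq_iff (p i : Fin n) {k : ℕ} (hk : k < n) : gap p i = k ↔ i = shift p k := by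
  constructor
  · exact fun h => gap_inj (h.trans (gap_shift p hk).symm)
  · rintro rfl
    exact gap_shift p hk

theorem Cyc.gap_add {p q r : Fin n} (h : Cyc p q r) : gap p q + gap q r = gap p r := by
  have hp := p.isLt
  have hq := q.isLt
  have hr := r.isLt
  rw [cyc_iff] at h
  simp only [gap_eq]
  split_ifs <;> omega

theorem gap_add_gap {p q : Fin n} (h : p ≠ q) : gap p q + gap q p = n := by
  have hp := p.isLt
  have hq := q.isLt
  rw [ne_eq, Fin.ext_iff] at h
  simp only [gap_eq]
  split_ifs <;> omega

/-- The transfer matrix of the `i`-th row, along the left edge of a rectangle. The states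
`0` and `1` stand for `β` and `γ`, with weights `μ` and `ν`; one can pass from `β` to `γ` in the row
`a` and back in the row `b`, at the price of the factor `-T`. -/
def rowMat (μ ν : Fin n → P) (T : P) (a b i : Fin n) : Matrix (Fin 2) (Fin 2) P :=
  !![μ i, if i = b then -T else 0; if i = a then -T else 0, ν i]

/-- The transfer matrix of the `k` rows from `p` upwards. -/
def colMat (μ ν : Fin n → P) (T : P) (a b p : Fin n) : ℕ → Matrix (Fin 2) (Fin 2) P
  | 0 => 1
  | k + 1 => rowMat μ ν T a b (shift p k) * colMat μ ν T a b p k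

variable {μ ν : Fin n → P} {T : P} {a b : Fin n}

theorem colMat_add (p : Fin n) (j k : ℕ) : colMat μ ν T a b p (j + k)
    = colMat μ ν T a b (shift p j) k * colMat μ ν T a b p j := by
  induction k with
  | zero => simp [colMat]
  | succ k ih => rw [← add_assoc, colMat, colMat, ih, shift_shift, Matrix.mul_assoc]

/-- Exchanging the two states. -/
theorem colMat_swap (p : Fin n) (k : ℕ) :
    colMat ν μ T b a p k 0 0 = colMat μ ν T a b p k 1 1 ∧
    colMat ν μ T b a p k 1 0 = colMat μ ν T a b p k 0 1 := by
  induction k with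
  | zero => simp [colMat]
  | succ k ih =>
    simp only [colMat, Matrix.mul_apply, Fin.sum_univ_two, ih.1, ih.2]
    simp [rowMat, add_comm]

theorem det_rowMat (hab : a ≠ b) (i : Fin n) : (rowMat μ ν T a b i).det = μ i * ν i := by
  rw [rowMat, Matrix.det_fin_two_of]
  split_ifs with h1 h2
  · exact absurd (h2.symm.trans h1) hab
  all_goals ring

theorem prod_update {ι : Type} [Fintype ι] [DecidableEq ι] {F F' : ι → P} (j : ι)
    (h : ∀ i, i ≠ j → F' i = F i) (hj : F j = 1) : ∏ i, F' i = F' j * ∏ i, F i := by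
  rw [← Finset.mul_prod_erase _ F' (Finset.mem_univ j), ← Finset.mul_prod_erase _ F (Finset.mem_univ j),
    hj, one_mul]
  congr 1
  exact Finset.prod_congr rfl fun i hi => h i (Finset.ne_of_mem_erase hi)

/-- The entries of the first column of the transfer matrix: starting in state `0`, one stays there, or
passes to state `1` at `a`, and possibly back at `b`. A second passage is excluded as `k ≤ n`. -/
theorem colMat_first_column (hab : a ≠ b) (p : Fin n) (k : ℕ) (hk : k ≤ n) :
    (colMat μ ν T a b p k 0 0 = (∏ i, if gap p i < k then μ i else 1) +
      if gap p a < gap p b ∧ gap p b < k then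
        T ^ 2 * ∏ i, (if gap p i < gap p a ∨ (gap p b < gap p i ∧ gap p i < k) then μ i else
          if gap p a < gap p i ∧ gap p i < gap p b then ν i else 1) else 0) ∧
    (colMat μ ν T a b p k 1 0 = if gap p a < k then
        -T * ∏ i, (if gap p i < gap p a then μ i else
          if gap p a < gap p i ∧ gap p i < k then ν i else 1) else 0) := by
  have hg : gap p a ≠ gap p b := fun h => hab (gap_inj h)
  induction k with
  | zero => simp [colMat]
  | succ k ih =>
    obtain ⟨ih0, ih1⟩ := ih (by omega)
    have hj : ∀ i, gap p i = k ↔ i = shift p k := fun i => gap_eq_iff p i (by omega)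
    have hgj : gap p (shift p k) = k := gap_shift p (by omega)
    have hne : ∀ i, i ≠ shift p k → gap p i ≠ k := fun i hi h => hi ((hj i).1 h)
    have ea : (shift p k = a) = (gap p a = k) := propext (by rw [hj, eq_comm])
    have eb : (shift p k = b) = (gap p b = k) := propext (by rw [hj, eq_comm])
    have p1 : (∏ i, if gap p i < k + 1 then μ i else 1)
        = μ (shift p k) * ∏ i, if gap p i < k then μ i else 1 := by
      rw [prod_update (shift p k) (F := fun i => if gap p i < k then μ i else 1)]
      · rw [hgj, if_pos (by omega)]
      · intro i hi
        have := hne i hi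
        split_ifs <;> first | rfl | omega
      · simp [hgj]
    constructor
    · simp only [colMat, Matrix.mul_apply, Fin.sum_univ_two, ih0, ih1, p1]
      simp only [rowMat, Matrix.of_apply, Matrix.cons_val_zero, Matrix.cons_val_one, ea, eb,
        Matrix.cons_val', Matrix.cons_val_fin_one]
      by_cases hb : gap p b = k
      · simp only [hb, lt_irrefl, and_false, if_false, if_true, lt_add_one, and_true, add_zero]
        by_cases ha : gap p a < k
        · rw [if_pos ha, if_pos ha]
          have : (∏ i, (if gap p i < gap p a then μ i else
              if gap p a < gap p i ∧ gap p i < k then ν i else 1)) =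
            ∏ i, (if gap p i < gap p a ∨ (k < gap p i ∧ gap p i < k + 1) then μ i else
              if gap p a < gap p i ∧ gap p i < k then ν i else 1) := by
            refine Finset.prod_congr rfl fun i _ => ?_
            split_ifs <;> first | rfl | omega
          rw [this]
          ring
        · rw [if_neg ha, if_neg ha]
          ring
      · simp only [hb, if_false, zero_mul, add_zero]
        rw [mul_add]
        congr 1
        by_cases h : gap p a < gap p b ∧ gap p b < k
        · rw [if_pos h, if_pos ⟨h.1, by omega⟩]
          have e : (∏ i, if gap p i < gap p a ∨ (gap p b < gap p i ∧ gap p i < k + 1) then μ i else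
                if gap p a < gap p i ∧ gap p i < gap p b then ν i else 1) = μ (shift p k) *
              ∏ i, if gap p i < gap p a ∨ (gap p b < gap p i ∧ gap p i < k) then μ i else
                if gap p a < gap p i ∧ gap p i < gap p b then ν i else 1 := by
            rw [prod_update (shift p k) (F := fun i =>
              if gap p i < gap p a ∨ (gap p b < gap p i ∧ gap p i < k) then μ i else
                if gap p a < gap p i ∧ gap p i < gap p b then ν i else 1)]
            · rw [hgj, if_pos (by omega)]
            · intro i hi
              have := hne i hi
              split_ifs <;> first | rfl | omega
            · simp only [hgj]
              rw [if_neg (by omega), if_neg (by omega)]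
          rw [e]
          ring
        · rw [if_neg h, if_neg fun h' => h ⟨h'.1, by omega⟩, mul_zero]
    · simp only [colMat, Matrix.mul_apply, Fin.sum_univ_two, ih0, ih1]
      simp only [rowMat, Matrix.of_apply, Matrix.cons_val_zero, Matrix.cons_val_one, ea, eb,
        Matrix.cons_val', Matrix.cons_val_fin_one]
      by_cases ha : gap p a = k
      · simp only [ha, lt_irrefl, if_false, if_true, lt_add_one, mul_zero, add_zero]
        rw [if_neg (by omega), add_zero]
        congr 1
        refine Finset.prod_congr rfl fun i _ => ?_
        split_ifs <;> first | rfl | omega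
      · simp only [ha, if_false, zero_mul, zero_add]
        by_cases h : gap p a < k
        · rw [if_pos h, if_pos (by omega)]
          have e : (∏ i, if gap p i < gap p a then μ i else
                if gap p a < gap p i ∧ gap p i < k + 1 then ν i else 1) = ν (shift p k) *
              ∏ i, if gap p i < gap p a then μ i else
                if gap p a < gap p i ∧ gap p i < k then ν i else 1 := by
            rw [prod_update (shift p k) (F := fun i =>
              if gap p i < gap p a then μ i else
                if gap p a < gap p i ∧ gap p i < k then ν i else 1)]
            · rw [hgj, if_neg (by omega), if_pos (by omega)]
            · intro i hi
              have := hne i hi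
              split_ifs <;> first | rfl | omega
            · simp only [hgj]
              rw [if_neg (by omega), if_neg (by omega)]
          rw [e]
          ring
        · rw [if_neg h, if_neg (by omega), mul_zero]

/-- The transfer matrix of the arc from `p` to `q`. -/
def edgeMat (μ ν : Fin n → P) (T : P) (a b p q : Fin n) : Matrix (Fin 2) (Fin 2) P :=
  colMat μ ν T a b p (gap p q)

theorem edgeMat_cut {p q r : Fin n} (h : Cyc p q r) :
    edgeMat μ ν T a b p r = edgeMat μ ν T a b q r * edgeMat μ ν T a b p q := by
  rw [edgeMat, ← h.gap_add, colMat_add, shift_gap, edgeMat, edgeMat]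

theorem edgeMat_mul_edgeMat {p q : Fin n} (h : p ≠ q) :
    edgeMat μ ν T a b q p * edgeMat μ ν T a b p q = colMat μ ν T a b p n := by
  have := colMat_add (μ := μ) (ν := ν) (T := T) (a := a) (b := b) p (gap p q) (gap q p)
  rw [gap_add_gap h, shift_gap] at this
  exact this.symm

end GridHomology

namespace GridHomology

open Matrix

variable {n : ℕ} {P : Type} [CommRing P]

instance (p q r : Fin n) : Decidable (Cyc p q r) := inferInstanceAs (Decidable (_ ∧ _))

/-! ### The matrix valued weight of a rectangle -/

/-- The contribution to the weight of a rectangle of the `O`'s outside of the columns `c` and `d`. -/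
def outerWeight (u : Fin n → P) (O : Equiv.Perm (Fin n)) (c d l r b t : Fin n) : P :=
  ∏ i, if gap b i < gap b t ∧ gap l (O i) < gap l r ∧ O i ≠ c ∧ O i ≠ d then u i else 1

/-- The weight of row `i` with respect to the column `c`: `u i` if the `O` of this row lies in the
column, and `1` otherwise. -/
def columnWeight (u : Fin n → P) (O : Equiv.Perm (Fin n)) (c i : Fin n) : P :=
  if O i = c then u i else 1

/-- The contribution to the weight of a rectangle of the two columns `c` and `d` next to the
distinguished circle `c`. -/
def innerWeight (μ ν : Fin n → P) (T : P) (p q c l r b t : Fin n) : Matrix (Fin 2) (Fin 2) P :=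
  if l = c then edgeMat μ ν T p q b t
  else if r = c then (edgeMat μ ν T p q b t).adjugate
  else if Cyc l c r then (edgeMat μ ν T p q b t).det • 1
  else 1

/-- The matrix which counts rectangles, pentagons and hexagons with the same straightening. -/
def polyWeight (u : Fin n → P) (O : Equiv.Perm (Fin n)) (T : P) (p q c d l r b t : Fin n) :
    Matrix (Fin 2) (Fin 2) P :=
  outerWeight u O c d l r b t •
    innerWeight (columnWeight u O c) (columnWeight u O d) T p q c l r b t

theorem outerWeight_cut_row {u : Fin n → P} {O : Equiv.Perm (Fin n)} {c d l r b m t : Fin n}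
    (h : Cyc b m t) :
    outerWeight u O c d l r b t = outerWeight u O c d l r b m * outerWeight u O c d l r m t := by
  rw [outerWeight, outerWeight, outerWeight, ← Finset.prod_mul_distrib]
  refine Finset.prod_congr rfl fun i _ => ?_
  have h1 := h.gap_lt_iff i
  have h2 := h.not_gap_lt i
  split_ifs <;> first | (simp; done) | tauto

theorem outerWeight_cut_col {u : Fin n → P} {O : Equiv.Perm (Fin n)} {c d l m r b t : Fin n}
    (h : Cyc l m r) :
    outerWeight u O c d l r b t = outerWeight u O c d l m b t * outerWeight u O c d m r b t := by
  rw [outerWeight, outerWeight, outerWeight, ← Finset.prod_mul_distrib]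
  refine Finset.prod_congr rfl fun i _ => ?_
  have h1 := h.gap_lt_iff (O i)
  have h2 := h.not_gap_lt (O i)
  split_ifs <;> first | (simp; done) | tauto

section

variable {μ ν : Fin n → P} {T : P} {p q c : Fin n}

theorem innerWeight_cut_left {l r b m t : Fin n} (hr : r ≠ c) (h : Cyc b m t) :
    innerWeight μ ν T p q c l r b t
      = innerWeight μ ν T p q c l r m t * innerWeight μ ν T p q c l r b m := by
  simp only [innerWeight, hr, if_false, edgeMat_cut h]
  split_ifs
  · rfl
  · simp [Matrix.det_mul, smul_smul, mul_comm]
  · simp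

theorem innerWeight_cut_right {l r b m t : Fin n} (hl : l ≠ c) (h : Cyc b m t) :
    innerWeight μ ν T p q c l r b t
      = innerWeight μ ν T p q c l r b m * innerWeight μ ν T p q c l r m t := by
  simp only [innerWeight, hl, if_false, edgeMat_cut h]
  split_ifs
  · rw [Matrix.adjugate_mul_distrib]
  · simp [Matrix.det_mul, smul_smul, mul_comm]
  · simp

theorem innerWeight_join {l m r b t : Fin n} (h : Cyc l m r) :
    innerWeight μ ν T p q c m r b t * innerWeight μ ν T p q c l m b t
      = innerWeight μ ν T p q c l r b t ∧
    innerWeight μ ν T p q c l m b t * innerWeight μ ν T p q c m r b t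
      = innerWeight μ ν T p q c l r b t := by
  obtain ⟨n1, n2, n3⟩ := h.ne
  by_cases hl : l = c
  · subst hl
    have : ¬ Cyc m l r := fun h' => h'.asymm h.rotate
    simp [innerWeight, n1.symm, n3.symm, this]
  by_cases hm : m = c
  · subst hm
    simp [innerWeight, n1, n2.symm, h, Matrix.mul_adjugate, Matrix.adjugate_mul]
  by_cases hr : r = c
  · subst hr
    have : ¬ Cyc l r m := h.asymm
    simp [innerWeight, n2, n3, this]
  have h1 : Cyc l c r ↔ Cyc l c m ∨ Cyc m c r := by
    rw [Fin.ext_iff] at hl hm hr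
    simp only [cyc_iff] at *
    omega
  have h2 : ¬ (Cyc l c m ∧ Cyc m c r) := by
    simp only [cyc_iff] at *
    omega
  simp only [innerWeight, hl, hm, hr, if_false]
  split_ifs <;> first | (simp; done) | tauto

theorem isTransferWeight_polyWeight (u : Fin n → P) (O : Equiv.Perm (Fin n)) (T : P)
    (p q c d : Fin n) : IsTransferWeight c (polyWeight u O T p q c d) where
  central l r b t hl hr M := by
    simp only [polyWeight, innerWeight, hl, hr, if_false]
    split_ifs <;> simp
  cut_left l r b m t _ hr h := by
    simp only [polyWeight]
    rw [innerWeight_cut_left hr h, outerWeight_cut_row h, Matrix.smul_mul, Matrix.mul_smul, smul_smul,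
      mul_comm]
  cut_right l r b m t _ hl h := by
    simp only [polyWeight]
    rw [innerWeight_cut_right hl h, outerWeight_cut_row h, Matrix.smul_mul, Matrix.mul_smul, smul_smul]
  join l m r b t _ h := by
    simp only [polyWeight]
    rw [← (innerWeight_join h).1, outerWeight_cut_col h, Matrix.smul_mul, Matrix.mul_smul, smul_smul,
      mul_comm]
  join' l m r b t _ h := by
    simp only [polyWeight]
    rw [← (innerWeight_join h).2, outerWeight_cut_col h, Matrix.smul_mul, Matrix.mul_smul, smul_smul]

end

/-! ### Contributions of thin annuli -/

section

variable {u : Fin n → P} {O : Equiv.Perm (Fin n)} {T : P} {p q c d : Fin n}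

theorem gap_lt_or_gap_lt {l r : Fin n} (h : l ≠ r) (i : Fin n) :
    (gap l i < gap l r ∨ gap r i < gap r l) ∧ ¬ (gap l i < gap l r ∧ gap r i < gap r l) := by
  rw [ne_eq, Fin.ext_iff] at h
  simp only [gap_lt_iff]
  omega

theorem polyWeight_horizontal [NeZero n] (hn : 2 ≤ n) (hpq : p ≠ q) (hcd : c ≠ d) {l r : Fin n}
    (hlr : l ≠ r) (b : Fin n) :
    polyWeight u O T p q c d r l b (b + 1) * polyWeight u O T p q c d l r b (b + 1) = u b • 1 := by
  have hg : ∀ i, gap b i < 1 ↔ i = b := fun i => by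
    rw [Nat.lt_one_iff]
    exact ⟨fun h => (gap_inj (h.trans (gap_self b).symm)), fun h => h ▸ gap_self b⟩
  have h0 : outerWeight u O c d r l b (b + 1) * outerWeight u O c d l r b (b + 1)
      = if O b ≠ c ∧ O b ≠ d then u b else 1 := by
    rw [outerWeight, outerWeight, ← Finset.prod_mul_distrib]
    simp only [gap_add_one hn, hg]
    rw [Finset.prod_eq_single b]
    · have := gap_lt_or_gap_lt hlr (O b)
      split_ifs <;> first | (simp; done) | tauto
    · intro i _ hi
      simp [hi]
    · exact fun h => absurd (Finset.mem_univ _) h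
  have hE : edgeMat (columnWeight u O c) (columnWeight u O d) T p q b (b + 1)
      = rowMat (columnWeight u O c) (columnWeight u O d) T p q b := by
    rw [edgeMat, gap_add_one hn, colMat, colMat, Matrix.mul_one, show shift b 0 = b by
      ext; simp [shift, Nat.mod_eq_of_lt b.isLt]]
  have h1 : innerWeight (columnWeight u O c) (columnWeight u O d) T p q c r l b (b + 1) *
      innerWeight (columnWeight u O c) (columnWeight u O d) T p q c l r b (b + 1)
      = (columnWeight u O c b * columnWeight u O d b) • 1 := by
    rw [← det_rowMat (T := T) hpq b, ← hE]
    by_cases hl : l = c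
    · subst hl
      simp [innerWeight, hlr.symm, Matrix.adjugate_mul]
    by_cases hr : r = c
    · subst hr
      simp [innerWeight, hlr, Matrix.mul_adjugate]
    simp only [innerWeight, hl, hr, if_false]
    rcases cyc_or_cyc hl (Ne.symm hr) hlr with h | h
    · rw [if_neg h.rotate.rotate.asymm, if_pos h, Matrix.one_mul]
    · rw [if_pos h.rotate, if_neg h.asymm, Matrix.mul_one]
  rw [polyWeight, polyWeight, Matrix.smul_mul, Matrix.mul_smul, smul_smul, h0, h1, smul_smul]
  congr 1
  simp only [columnWeight]
  by_cases hc : O b = c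
  · simp [hc, hcd]
  by_cases hd : O b = d
  · simp [hd, hcd.symm]
  simp [hc, hd]

theorem prod_columnWeight (v : Fin n) : ∏ i, columnWeight u O v i = u (O.symm v) := by
  have : ∀ i, columnWeight u O v i = if i = O.symm v then u i else 1 := fun i => by
    rw [columnWeight]
    exact if_congr (Equiv.eq_symm_apply O).symm rfl rfl
  simp [this]

theorem outerWeight_vertical [NeZero n] (hn : 2 ≤ n) (v : Fin n) {b t : Fin n} (hbt : b ≠ t) :
    outerWeight u O c d v (v + 1) t b * outerWeight u O c d v (v + 1) b t
      = if v = c ∨ v = d then 1 else u (O.symm v) := by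
  have hg : ∀ i, gap v i < 1 ↔ i = v := fun i => by
    rw [Nat.lt_one_iff]
    exact ⟨fun h => (gap_inj (h.trans (gap_self v).symm)), fun h => h ▸ gap_self v⟩
  have : ∀ i, ((if gap t i < gap t b ∧ gap v (O i) < gap v (v + 1) ∧ O i ≠ c ∧ O i ≠ d then u i else 1) *
      if gap b i < gap b t ∧ gap v (O i) < gap v (v + 1) ∧ O i ≠ c ∧ O i ≠ d then u i else 1)
      = if v = c ∨ v = d then 1 else columnWeight u O v i := fun i => by
    have := gap_lt_or_gap_lt hbt i
    simp only [gap_add_one hn, hg, columnWeight]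
    by_cases h : O i = v
    · subst h
      split_ifs <;> first | (simp; done) | tauto
    · simp [h]
  rw [outerWeight, outerWeight, ← Finset.prod_mul_distrib]
  simp only [this]
  split_ifs
  · simp
  · exact prod_columnWeight v

theorem polyWeight_vertical_of_ne [NeZero n] (hn : 2 ≤ n) {v : Fin n} (hc : v ≠ c) (hd : v + 1 ≠ c)
    (hvd : v ≠ d) {b t : Fin n} (hbt : b ≠ t) :
    polyWeight u O T p q c d v (v + 1) t b * polyWeight u O T p q c d v (v + 1) b t
      = u (O.symm v) • 1 := by
  have h := ((not_cyc_iff_eq_add_one hn (b := v) (t := v + 1)).2 rfl).2 c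
  rw [polyWeight, polyWeight, Matrix.smul_mul, Matrix.mul_smul, smul_smul, outerWeight_vertical hn v hbt]
  simp [innerWeight, hc, hd, h, hvd]

theorem polyWeight_vertical_right [NeZero n] (hn : 2 ≤ n) {b t : Fin n} (hbt : b ≠ t) :
    polyWeight u O T p q c d c (c + 1) t b * polyWeight u O T p q c d c (c + 1) b t
      = colMat (columnWeight u O c) (columnWeight u O d) T p q b n := by
  rw [polyWeight, polyWeight, Matrix.smul_mul, Matrix.mul_smul, smul_smul, outerWeight_vertical hn c hbt]
  simp [innerWeight, edgeMat_mul_edgeMat hbt]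

theorem polyWeight_vertical_left [NeZero n] (hn : 2 ≤ n) (hd : d + 1 = c) (hcd : c ≠ d) {b t : Fin n}
    (hbt : b ≠ t) :
    polyWeight u O T p q c d d (d + 1) t b * polyWeight u O T p q c d d (d + 1) b t
      = (colMat (columnWeight u O c) (columnWeight u O d) T p q t n).adjugate := by
  rw [polyWeight, polyWeight, Matrix.smul_mul, Matrix.mul_smul, smul_smul, outerWeight_vertical hn d hbt]
  simp [innerWeight, hcd.symm, hd, ← Matrix.adjugate_mul_distrib, edgeMat_mul_edgeMat hbt.symm]

theorem gap_le_of_inArc {h x y i : Fin n} (hxy : gap h x < gap h y) (hi : InArc x y i) :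
    gap h x ≤ gap h i ∧ gap h i ≤ gap h y := by
  have := x.isLt
  have := y.isLt
  have := i.isLt
  have := h.isLt
  rw [gap_lt_iff] at hxy
  simp only [InArc, gap_eq] at *
  rcases hxy with hxy | hxy | hxy <;> split_ifs at * <;> omega

theorem not_gap_lt_of_inArc {h x y i : Fin n} (hi : InArc y x i) :
    ¬ (gap h x < gap h i ∧ gap h i < gap h y) := by
  have := x.isLt
  have := y.isLt
  have := i.isLt
  have := h.isLt
  simp only [InArc, gap_eq] at hi ⊢
  split_ifs at hi ⊢ <;> omega

/-- The trace of the transfer matrix once around the circle. A closed path stays in one of the two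
states, or it passes from `0` to `1` in row `p` and back in row `q`; in the last case it avoids all
weights, as the marks of both columns lie in the bigon on the other side. -/
theorem trace_colMat (hpq : p ≠ q) (hc : InArc p q (O.symm c)) (hd : InArc q p (O.symm d)) (h : Fin n) :
    (colMat (columnWeight u O c) (columnWeight u O d) T p q h n).trace
      = u (O.symm c) + u (O.symm d) + T ^ 2 := by
  have hg : ∀ i, gap h i < n := gap_lt h
  have hne : gap h p ≠ gap h q := fun e => hpq (gap_inj e)
  have e1 := (colMat_first_column (μ := columnWeight u O c) (ν := columnWeight u O d) (T := T)
    hpq h n le_rfl).1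
  have e2 := (colMat_first_column (μ := columnWeight u O d) (ν := columnWeight u O c) (T := T)
    hpq.symm h n le_rfl).1
  rw [(colMat_swap h n).1] at e2
  have hμ : ∀ i, O i = c → i = O.symm c := fun i => (Equiv.eq_symm_apply O).2
  have hν : ∀ i, O i = d → i = O.symm d := fun i => (Equiv.eq_symm_apply O).2
  have hout := fun x y i hxy => gap_le_of_inArc (h := h) (x := x) (y := y) (i := i) hxy
  simp only [hg, if_true, and_true] at e1 e2
  rw [Matrix.trace_fin_two, e1, e2, prod_columnWeight, prod_columnWeight]
  rcases Nat.lt_or_gt_of_ne hne with hlt | hlt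
  · rw [if_pos hlt, if_neg (by omega), Finset.prod_eq_one]
    · ring
    · intro i _
      have k1 := hout p q _ hlt hc
      have k2 := not_gap_lt_of_inArc (h := h) hd
      simp only [columnWeight]
      split_ifs with j1 j2 j3 j4
      · rw [hμ i j2] at j1; omega
      · rfl
      · rw [hν i j4] at j3; exact absurd j3 k2
      all_goals rfl
  · rw [if_pos hlt, if_neg (by omega), Finset.prod_eq_one]
    · ring
    · intro i _
      have k1 := hout q p _ hlt hd
      have k2 := not_gap_lt_of_inArc (h := h) hc
      simp only [columnWeight]
      split_ifs with j1 j2 j3 j4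
      · rw [hν i j2] at j1; omega
      · rfl
      · rw [hμ i j4] at j3; exact absurd j3 k2
      all_goals rfl

/-- The main identity: the contributions of the horizontal annuli cancel those of the vertical annuli,
up to the square of the variable which counts the corners on the distinguished circle. -/
theorem rectMatrix_polyWeight_sq [NeZero n] (hn : 2 ≤ n) {σ : RectSign n}
    (hσ : SignRel (Matrix (Fin 2) (Fin 2) P) σ) (hpq : p ≠ q) (hdc : d + 1 = c)
    (hc : InArc p q (O.symm c)) (hd : InArc q p (O.symm d)) :
    rectMatrix σ (polyWeight u O T p q c d) * rectMatrix σ (polyWeight u O T p q c d)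
      = -((T ^ 2) • (1 : Matrix (Fin 2) (Fin 2) P)) •
          (1 : Matrix (Gen n) (Gen n) (Matrix (Fin 2) (Fin 2) P)) := by
  have hcd : c ≠ d := by
    rintro rfl
    have := gap_add_one hn c
    rw [hdc, gap_self] at this
    omega
  ext z x : 1
  by_cases hzx : z = x
  · subst hzx
    rw [rectMatrix_mul_self_diagonal hn hσ]
    have hne : ∀ v : Fin n, v ≠ v + 1 := fun v => ((not_cyc_iff_eq_add_one hn).2 rfl).1
    have h1 : ∀ b, polyWeight u O T p q c d (z (b + 1)) (z b) b (b + 1) *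
        polyWeight u O T p q c d (z b) (z (b + 1)) b (b + 1) = u b • 1 := fun b =>
      polyWeight_horizontal hn hpq hcd (z.injective.ne (hne b)) b
    have hs : ∀ v, z.symm v ≠ z.symm (v + 1) := fun v => z.symm.injective.ne (hne v)
    have hvert : ∑ v, polyWeight u O T p q c d v (v + 1) (z.symm (v + 1)) (z.symm v) *
        polyWeight u O T p q c d v (v + 1) (z.symm v) (z.symm (v + 1)) =
        colMat (columnWeight u O c) (columnWeight u O d) T p q (z.symm c) n +
        ((colMat (columnWeight u O c) (columnWeight u O d) T p q (z.symm (d + 1)) n).adjugate +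
          ∑ v ∈ (Finset.univ.erase c).erase d, u (O.symm v) • 1) := by
      rw [← Finset.add_sum_erase _ _ (Finset.mem_univ c),
        ← Finset.add_sum_erase _ _ (Finset.mem_erase.2 ⟨hcd.symm, Finset.mem_univ d⟩),
        polyWeight_vertical_right hn (hs c), polyWeight_vertical_left hn hdc hcd (hs d)]
      refine congrArg _ (congrArg _ (Finset.sum_congr rfl fun v hv => ?_))
      exact polyWeight_vertical_of_ne hn (Finset.ne_of_mem_erase (Finset.mem_of_mem_erase hv))
        (fun h => Finset.ne_of_mem_erase hv (add_right_cancel (h.trans hdc.symm)))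
        (Finset.ne_of_mem_erase hv) (hs v)
    have hadj : ∀ M : Matrix (Fin 2) (Fin 2) P, M + M.adjugate = M.trace • 1 := by
      intro M
      rw [Matrix.adjugate_fin_two]
      ext i j
      fin_cases i <;> fin_cases j <;> simp [Matrix.trace_fin_two, add_comm]
    have ht := trace_colMat (u := u) (T := T) hpq hc hd (z.symm c)
    have hsum : ∑ i, u i = u (O.symm c) + (u (O.symm d) +
        ∑ v ∈ (Finset.univ.erase c).erase d, u (O.symm v)) := by
      rw [← Equiv.sum_comp O.symm u, ← Finset.add_sum_erase _ _ (Finset.mem_univ c),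
        ← Finset.add_sum_erase _ _ (Finset.mem_erase.2 ⟨hcd.symm, Finset.mem_univ d⟩)]
    rw [hvert, hdc, ← add_assoc, hadj, ht]
    simp only [h1]
    rw [← Finset.sum_smul, ← Finset.sum_smul, hsum, ← add_smul, ← sub_smul]
    rw [Matrix.smul_apply, Matrix.one_apply_eq, smul_eq_mul, mul_one, ← neg_smul]
    congr 1
    ring
  · rw [rectMatrix_mul_self_off_diagonal hσ (isTransferWeight_polyWeight u O T p q c d) hzx,
      Matrix.smul_apply, Matrix.one_apply_ne hzx, smul_zero]

end

end GridHomology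

namespace GridHomology

open Matrix

variable {n : ℕ} {P : Type} [CommRing P]

/-! ### Matrix entries: rectangles, pentagons and hexagons -/

theorem gap_sub_one [NeZero n] (hn : 2 ≤ n) {l c : Fin n} (h : l ≠ c) :
    gap l (c - 1) + 1 = gap l c := by
  have h1 := gap_add_one hn (c - 1)
  rw [sub_add_cancel] at h1
  have := l.isLt
  have := c.isLt
  have := (c - 1).isLt
  rw [ne_eq, Fin.ext_iff] at h
  rw [gap_eq] at *
  rw [gap_eq]
  split_ifs at * <;> omega

theorem sub_one_ne [NeZero n] (hn : 2 ≤ n) (c : Fin n) : c - 1 ≠ c := by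
  intro h
  have h1 := gap_add_one hn (c - 1)
  rw [sub_add_cancel, h, gap_self] at h1
  omega

namespace Rect

variable {r : Rect n} {c : Fin n}

theorem gap_pos (r : Rect n) : 0 < gap r.left r.right := GridHomology.gap_pos r.left_ne_right

theorem hasCol_of_left (h : r.left = c) : r.HasCol c := by
  rw [HasCol, h, gap_self, ← h]
  exact r.gap_pos

theorem not_hasCol_sub_one_of_left [NeZero n] (hn : 2 ≤ n) (h : r.left = c) : ¬ r.HasCol (c - 1) := by
  have h1 := gap_add_one hn (c - 1)
  rw [sub_add_cancel] at h1
  have h2 := gap_add_gap (sub_one_ne hn c).symm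
  have h3 := gap_lt c r.right
  rw [HasCol, h]
  omega

theorem not_hasCol_of_right (h : r.right = c) : ¬ r.HasCol c := by
  rw [HasCol, h]
  exact lt_irrefl _

theorem hasCol_sub_one_of_right [NeZero n] (hn : 2 ≤ n) (h : r.right = c) : r.HasCol (c - 1) := by
  have := gap_sub_one hn (h ▸ r.left_ne_right : r.left ≠ c)
  rw [HasCol, h]
  omega

theorem hasCol_iff_cyc (hl : r.left ≠ c) : r.HasCol c ↔ Cyc r.left c r.right :=
  ⟨fun h => ⟨GridHomology.gap_pos hl, h⟩, fun h => h.2⟩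

theorem hasCol_sub_one_iff_cyc [NeZero n] (hn : 2 ≤ n) (hl : r.left ≠ c) (hr : r.right ≠ c) :
    r.HasCol (c - 1) ↔ Cyc r.left c r.right := by
  have h1 := gap_sub_one hn hl
  have h2 : gap r.left r.right ≠ gap r.left c := fun h => hr (gap_inj h)
  rw [← hasCol_iff_cyc hl, HasCol, HasCol]
  omega

end Rect

theorem det_colMat {μ ν : Fin n → P} {T : P} {a b : Fin n} (hab : a ≠ b) (p : Fin n) (k : ℕ) (hk : k ≤ n) :
    (colMat μ ν T a b p k).det = ∏ i, if gap p i < k then μ i * ν i else 1 := by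
  induction k with
  | zero => simp [colMat]
  | succ k ih =>
    have hj : ∀ i, gap p i = k ↔ i = shift p k := fun i => gap_eq_iff p i (by omega)
    have hgj : gap p (shift p k) = k := gap_shift p (by omega)
    rw [colMat, Matrix.det_mul, det_rowMat hab, ih (by omega),
      prod_update (F' := fun i => if gap p i < k + 1 then μ i * ν i else 1) (shift p k)
        (F := fun i => if gap p i < k then μ i * ν i else 1)]
    · rw [hgj, if_pos (by omega)]
    · intro i hi
      have : gap p i ≠ k := fun h => hi ((hj i).1 h)
      split_ifs <;> first | rfl | omega
    · simp [hgj]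

open Classical in
theorem outerWeight_rect {u : Fin n → P} {O : Equiv.Perm (Fin n)} {c d : Fin n} (r : Rect n) :
    outerWeight u O c d r.left r.right r.bottom r.top
      = ∏ i, if r.HasRow i ∧ r.HasCol (O i) ∧ O i ≠ c ∧ O i ≠ d then u i else 1 :=
  Finset.prod_congr rfl fun _ _ => if_congr Iff.rfl rfl rfl

namespace Curve

variable [NeZero n] {G H : GridDiagram n} {c : Fin n}

theorem O_eq_iff (γ : Curve G H c) (i : Fin n) : (H.O i = c ↔ G.O i = c - 1) ∧ (H.O i = c - 1 ↔ G.O i = c) :=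
  ⟨swap_eq_right (γ.O_switch i), swap_eq_left (γ.O_switch i)⟩

theorem O_eq_of_ne (γ : Curve G H c) {i : Fin n} (h1 : G.O i ≠ c) (h2 : G.O i ≠ c - 1) : H.O i = G.O i := by
  rw [γ.O_switch, Equiv.swap_apply_of_ne_of_ne h2 h1]

theorem a_ne_b (γ : Curve G H c) : γ.a ≠ γ.b := by
  intro h
  have h1 := γ.right_bigon (G.O.symm c) (Or.inl (by simp))
  have h2 := γ.right_bigon (G.X.symm c) (Or.inr (by simp))
  rw [InArc, ← h, gap_self, Nat.le_zero] at h1 h2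
  have h3 := gap_inj (h1.trans h2.symm)
  exact G.O_ne_X (G.O.symm c) (by
    conv_rhs => rw [h3]
    simp)

open Classical in
/-- Passing from `β` to `γ`: the weight counts pentagons. -/
theorem polyWeight_one_zero (γ : Curve G H c) (hn : 2 ≤ n) (u : Fin n → P) (T : P) (r : Rect n) :
    polyWeight u G.O T γ.a γ.b c (c - 1) r.left r.right r.bottom r.top 1 0 =
      if γ.IsPentagon r then (if r.left = c then -T else T) *
        ∏ i, (if γ.PentHasO r i then u i else 1) else 0 := by
  have hne := (sub_one_ne hn c).symm
  have hcol := (colMat_first_column (μ := columnWeight u G.O c) (ν := columnWeight u G.O (c - 1))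
    (T := T) γ.a_ne_b r.bottom (gap r.bottom r.top) (gap_lt _ _).le).2
  rw [polyWeight, Matrix.smul_apply, smul_eq_mul, outerWeight_rect, innerWeight]
  by_cases hl : r.left = c
  · have hc := r.hasCol_of_left hl
    have hd := r.not_hasCol_sub_one_of_left hn hl
    rw [if_pos hl, edgeMat, hcol]
    by_cases ha : gap r.bottom γ.a < gap r.bottom r.top
    · rw [if_pos ha, if_pos ⟨Or.inl hl, ha⟩, if_pos hl, mul_left_comm, ← Finset.prod_mul_distrib]
      congr 1
      refine Finset.prod_congr rfl fun i _ => ?_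
      simp only [PentHasO, hl, if_true, Rect.HasRow, columnWeight]
      obtain ⟨h1, h2⟩ := γ.O_eq_iff i
      by_cases hO : G.O i = c
      · rw [h2.2 hO, hO]
        simp only [hc, hd, hne]
        grind
      by_cases hO' : G.O i = c - 1
      · rw [h1.2 hO', hO']
        simp only [hc, hd]
        grind
      · rw [γ.O_eq_of_ne hO hO']
        grind
    · rw [if_neg ha, if_neg fun h => ha h.2, mul_zero]
  by_cases hr : r.right = c
  · have hc := r.not_hasCol_of_right hr
    have hd := r.hasCol_sub_one_of_right hn hr
    rw [if_neg hl, if_pos hr, edgeMat, Matrix.adjugate_fin_two, Matrix.of_apply, Matrix.cons_val_one,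
      Matrix.cons_val_zero, Matrix.cons_val_zero, hcol]
    by_cases ha : gap r.bottom γ.a < gap r.bottom r.top
    · rw [if_pos ha, if_pos ⟨Or.inr hr, ha⟩, if_neg hl, neg_mul, neg_neg, mul_left_comm,
        ← Finset.prod_mul_distrib]
      congr 1
      refine Finset.prod_congr rfl fun i _ => ?_
      simp only [PentHasO, hl, if_false, Rect.HasRow, columnWeight]
      obtain ⟨h1, h2⟩ := γ.O_eq_iff i
      by_cases hO : G.O i = c
      · rw [h2.2 hO, hO]
        simp only [hc, hd, hne]
        grind
      by_cases hO' : G.O i = c - 1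
      · rw [h1.2 hO', hO']
        simp only [hc, hd]
        grind
      · rw [γ.O_eq_of_ne hO hO']
        grind
    · rw [if_neg ha, if_neg fun h => ha h.2, neg_zero, mul_zero]
  · rw [if_neg hl, if_neg hr, if_neg (show ¬ γ.IsPentagon r from fun h => h.1.elim hl hr)]
    split_ifs <;> simp

open Classical in
/-- From `β` to `β`: the weight counts rectangles and hexagons. -/
theorem polyWeight_zero_zero (γ : Curve G H c) (hn : 2 ≤ n) (u : Fin n → P) (T : P) (r : Rect n) :
    polyWeight u G.O T γ.a γ.b c (c - 1) r.left r.right r.bottom r.top 0 0 =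
      (∏ i, if r.HasCol (G.O i) ∧ r.HasRow i then u i else 1) +
      if γ.IsHexagon r then T ^ 2 * ∏ i, (if γ.HexHasO r i then u i else 1) else 0 := by
  have hne := (sub_one_ne hn c).symm
  rw [polyWeight, Matrix.smul_apply, smul_eq_mul, outerWeight_rect, innerWeight]
  by_cases hl : r.left = c
  · have hc := r.hasCol_of_left hl
    have hd := r.not_hasCol_sub_one_of_left hn hl
    have hcol := (colMat_first_column (μ := columnWeight u G.O c) (ν := columnWeight u G.O (c - 1))
      (T := T) γ.a_ne_b r.bottom (gap r.bottom r.top) (gap_lt _ _).le).1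
    rw [if_pos hl, edgeMat, hcol, mul_add]
    congr 1
    · rw [← Finset.prod_mul_distrib]
      refine Finset.prod_congr rfl fun i _ => ?_
      simp only [Rect.HasRow, columnWeight]
      by_cases hO : G.O i = c
      · rw [hO]
        simp only [hc]
        grind
      by_cases hO' : G.O i = c - 1
      · rw [hO']
        simp only [hd]
        grind
      · grind
    · simp only [IsHexagon, HexHasO, lowerCorner, upperCorner, hl, if_true, true_or, true_and, Rect.HasRow]
      by_cases hab : gap r.bottom γ.a < gap r.bottom γ.b ∧ gap r.bottom γ.b < gap r.bottom r.top
      · rw [if_pos hab, if_pos ⟨hab.2, hab.1⟩, mul_left_comm, ← Finset.prod_mul_distrib]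
        congr 1
        refine Finset.prod_congr rfl fun i _ => ?_
        simp only [columnWeight]
        obtain ⟨h1, h2⟩ := γ.O_eq_iff i
        by_cases hO : G.O i = c
        · rw [h2.2 hO, hO]
          simp only [hc, hd, hne]
          grind
        by_cases hO' : G.O i = c - 1
        · rw [h1.2 hO', hO']
          simp only [hc, hd]
          grind
        · rw [γ.O_eq_of_ne hO hO']
          grind
      · rw [if_neg hab, if_neg fun h => hab ⟨h.2, h.1⟩, mul_zero]
  by_cases hr : r.right = c
  · have hc := r.not_hasCol_of_right hr
    have hd := r.hasCol_sub_one_of_right hn hr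
    have hcol := (colMat_first_column (μ := columnWeight u G.O (c - 1)) (ν := columnWeight u G.O c)
      (T := T) γ.a_ne_b.symm r.bottom (gap r.bottom r.top) (gap_lt _ _).le).1
    rw [(colMat_swap _ _).1] at hcol
    rw [if_neg hl, if_pos hr, edgeMat, Matrix.adjugate_fin_two, Matrix.of_apply, Matrix.cons_val_zero,
      Matrix.cons_val_zero, hcol, mul_add]
    congr 1
    · rw [← Finset.prod_mul_distrib]
      refine Finset.prod_congr rfl fun i _ => ?_
      simp only [Rect.HasRow, columnWeight]
      by_cases hO : G.O i = c
      · rw [hO]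
        simp only [hc, hne]
        grind
      by_cases hO' : G.O i = c - 1
      · rw [hO']
        simp only [hd]
        grind
      · grind
    · simp only [IsHexagon, HexHasO, lowerCorner, upperCorner, hl, hr, if_false, or_true, true_and, Rect.HasRow]
      by_cases hab : gap r.bottom γ.b < gap r.bottom γ.a ∧ gap r.bottom γ.a < gap r.bottom r.top
      · rw [if_pos hab, if_pos ⟨hab.2, hab.1⟩, mul_left_comm, ← Finset.prod_mul_distrib]
        congr 1
        refine Finset.prod_congr rfl fun i _ => ?_
        simp only [columnWeight]
        obtain ⟨h1, h2⟩ := γ.O_eq_iff i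
        by_cases hO : G.O i = c
        · rw [h2.2 hO, hO]
          simp only [hc, hd, hne]
          grind
        by_cases hO' : G.O i = c - 1
        · rw [h1.2 hO', hO']
          simp only [hc, hd]
          grind
        · rw [γ.O_eq_of_ne hO hO']
          grind
      · rw [if_neg hab, if_neg fun h => hab ⟨h.2, h.1⟩, mul_zero]
  · have hc := r.hasCol_iff_cyc hl
    have hd := r.hasCol_sub_one_iff_cyc hn hl hr
    rw [if_neg hl, if_neg hr, if_neg (show ¬ γ.IsHexagon r from fun h => h.1.elim hl hr), add_zero]
    by_cases h : Cyc r.left c r.right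
    · rw [if_pos h, Matrix.smul_apply, Matrix.one_apply_eq, smul_eq_mul, mul_one, edgeMat,
        det_colMat γ.a_ne_b _ _ (gap_lt _ _).le, ← Finset.prod_mul_distrib]
      refine Finset.prod_congr rfl fun i _ => ?_
      simp only [Rect.HasRow, columnWeight]
      by_cases hO : G.O i = c
      · rw [hO]
        simp only [hc, h, hne]
        grind
      by_cases hO' : G.O i = c - 1
      · rw [hO']
        simp only [hd, h]
        grind
      · grind
    · rw [if_neg h, Matrix.one_apply_eq, mul_one]
      refine Finset.prod_congr rfl fun i _ => ?_
      simp only [Rect.HasRow]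
      by_cases hO : G.O i = c
      · rw [hO]
        simp [hc, h]
      by_cases hO' : G.O i = c - 1
      · rw [hO']
        simp [hd, h]
      · grind

/-- Exchanging the roles of `β` and `γ` exchanges the two states. -/
theorem polyWeight_symm (γ : Curve G H c) (u : Fin n → P) (T : P) (l r b t : Fin n) :
    polyWeight u H.O T γ.b γ.a c (c - 1) l r b t 0 0
        = polyWeight u G.O T γ.a γ.b c (c - 1) l r b t 1 1 ∧
      polyWeight u H.O T γ.b γ.a c (c - 1) l r b t 1 0
        = polyWeight u G.O T γ.a γ.b c (c - 1) l r b t 0 1 := by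
  have h1 : columnWeight u H.O c = columnWeight u G.O (c - 1) := by
    funext i
    exact if_congr (γ.O_eq_iff i).1 rfl rfl
  have h2 : columnWeight u H.O (c - 1) = columnWeight u G.O c := by
    funext i
    exact if_congr (γ.O_eq_iff i).2 rfl rfl
  have h3 : outerWeight u H.O c (c - 1) l r b t = outerWeight u G.O c (c - 1) l r b t := by
    refine Finset.prod_congr rfl fun i _ => ?_
    by_cases hO : G.O i ≠ c ∧ G.O i ≠ c - 1
    · rw [γ.O_eq_of_ne hO.1 hO.2]
    · rw [if_neg, if_neg]
      · tauto
      · rw [ne_eq, ne_eq, (γ.O_eq_iff i).1, (γ.O_eq_iff i).2]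
        tauto
  have h4 := colMat_swap (μ := columnWeight u G.O c) (ν := columnWeight u G.O (c - 1)) (T := T)
    (a := γ.a) (b := γ.b) b (gap b t)
  have h5 := colMat_swap (μ := columnWeight u G.O (c - 1)) (ν := columnWeight u G.O c) (T := T)
    (a := γ.b) (b := γ.a) b (gap b t)
  simp only [polyWeight, Matrix.smul_apply, h1, h2, h3, innerWeight, edgeMat]
  split_ifs
  · rw [h4.1, h4.2]
    exact ⟨rfl, rfl⟩
  · simp [Matrix.adjugate_fin_two, h4, h5]
  · simp [Matrix.det_fin_two, h4, h5, mul_comm]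
  · simp

end Curve

end GridHomology

namespace GridHomology

open Matrix

variable {n : ℕ} (k : Type) [CommRing k]

/-! ### The maps as matrices -/

/-- The matrix of the differential. -/
noncomputable def diffMatrix (σ : RectSign n) (G : GridDiagram n) :
    Matrix (Gen n) (Gen n) (MvPolynomial (Fin n) k) := fun y x =>
  ∑ r : EmptyRect x y, weight k (σ x y r) fun i => r.1.HasCol (G.O i) ∧ r.1.HasRow i

open Classical in
/-- The matrix of the map which counts pentagons. -/
noncomputable def Curve.pentMatrix [NeZero n] (σ : RectSign n) {G H : GridDiagram n} {c : Fin n}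
    (γ : Curve G H c) : Matrix (Gen n) (Gen n) (MvPolynomial (Fin n) k) := fun y x =>
  ∑ p : γ.EmptyPent x y,
    weight k (if p.1.1.left = c then -σ x y p.1 else σ x y p.1) (γ.PentHasO p.1.1)

/-- The matrix of the map which counts hexagons. -/
noncomputable def Curve.hexMatrix [NeZero n] (σ : RectSign n) {G H : GridDiagram n} {c : Fin n}
    (γ : Curve G H c) : Matrix (Gen n) (Gen n) (MvPolynomial (Fin n) k) := fun y x =>
  ∑ p : γ.EmptyHex x y, weight k (σ x y p.1) (γ.HexHasO p.1.1)

/-- The linear map with a given matrix. -/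
noncomputable def matrixMap (M : Matrix (Gen n) (Gen n) (MvPolynomial (Fin n) k)) :
    (Gen n →₀ MvPolynomial (Fin n) k) →ₗ[MvPolynomial (Fin n) k]
      (Gen n →₀ MvPolynomial (Fin n) k) :=
  Matrix.toLin Finsupp.basisSingleOne Finsupp.basisSingleOne M

variable {k}

theorem matrixMap_mul (M N : Matrix (Gen n) (Gen n) (MvPolynomial (Fin n) k)) :
    matrixMap k (M * N) = matrixMap k M ∘ₗ matrixMap k N :=
  Matrix.toLin_mul _ _ _ M N

theorem matrixMap_add (M N : Matrix (Gen n) (Gen n) (MvPolynomial (Fin n) k)) :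
    matrixMap k (M + N) = matrixMap k M + matrixMap k N :=
  map_add _ M N

theorem matrixMap_one : matrixMap k (1 : Matrix (Gen n) (Gen n) (MvPolynomial (Fin n) k)) = LinearMap.id :=
  Matrix.toLin_one _

theorem matrixMap_zero : matrixMap k (0 : Matrix (Gen n) (Gen n) (MvPolynomial (Fin n) k)) = 0 :=
  map_zero _

theorem linearCombination_eq_matrixMap {ι : Gen n → Gen n → Type} [∀ x y, Fintype (ι x y)]
    (f : ∀ x y, ι x y → MvPolynomial (Fin n) k) :
    Finsupp.linearCombination (MvPolynomial (Fin n) k)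
      (fun x : Gen n => ∑ y : Gen n, ∑ r : ι x y, Finsupp.single y (f x y r))
      = matrixMap k (fun y x => ∑ r : ι x y, f x y r) := by
  refine Finsupp.basisSingleOne.ext fun x => ?_
  refine Eq.trans ?_ (Matrix.toLin_self _ _ _ x).symm
  simp [Finsupp.single_finsetSum]

theorem differential_eq_matrixMap (σ : RectSign n) (G : GridDiagram n) :
    differential k σ G = matrixMap k (diffMatrix k σ G) :=
  linearCombination_eq_matrixMap (ι := fun x y => EmptyRect x y) _

open Classical in
theorem C_weight (ε : ℤˣ) (Q : Fin n → Prop) :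
    Polynomial.C (weight k ε Q) = ((ε : ℤ) : Polynomial (MvPolynomial (Fin n) k)) *
      ∏ i, if Q i then Polynomial.C (MvPolynomial.X i) else 1 := by
  rw [weight, map_mul, map_intCast, map_prod]
  congr 1
  refine Finset.prod_congr rfl fun i _ => ?_
  split_ifs <;> simp

theorem rectMatrix_apply_apply {P : Type} [CommRing P] (σ : RectSign n)
    (w : Fin n → Fin n → Fin n → Fin n → Matrix (Fin 2) (Fin 2) P) (y x : Gen n) (i j : Fin 2) :
    rectMatrix σ w y x i j = ∑ r : EmptyRect x y,
      ((σ x y r : ℤ) : P) * w r.1.left r.1.right r.1.bottom r.1.top i j := by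
  rw [rectMatrix, Matrix.sum_apply]
  refine Finset.sum_congr rfl fun r _ => ?_
  rw [← zsmul_eq_mul, Matrix.smul_apply, zsmul_eq_mul]

section

variable [NeZero n] {G H : GridDiagram n} {c : Fin n}

theorem Curve.pentMap_eq_matrixMap (σ : RectSign n) (γ : Curve G H c) :
    γ.pentMap k σ = matrixMap k (γ.pentMatrix k σ) :=
  linearCombination_eq_matrixMap (ι := fun x y => γ.EmptyPent x y) _

theorem Curve.hexMap_eq_matrixMap (σ : RectSign n) (γ : Curve G H c) :
    γ.hexMap k σ = matrixMap k (γ.hexMatrix k σ) :=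
  linearCombination_eq_matrixMap (ι := fun x y => γ.EmptyHex x y) _

open Classical in
theorem Curve.sum_emptyPent (γ : Curve G H c) {M : Type} [AddCommMonoid M] {x y : Gen n}
    (f : EmptyRect x y → M) :
    ∑ p : γ.EmptyPent x y, f p.1 = ∑ r : EmptyRect x y, if γ.IsPentagon r.1 then f r else 0 := by
  rw [← Finset.sum_filter]
  exact (Finset.sum_subtype (p := fun r : EmptyRect x y => γ.IsPentagon r.1) _ (by simp) f).symm

open Classical in
theorem Curve.sum_emptyHex (γ : Curve G H c) {M : Type} [AddCommMonoid M] {x y : Gen n}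
    (f : EmptyRect x y → M) :
    ∑ p : γ.EmptyHex x y, f p.1 = ∑ r : EmptyRect x y, if γ.IsHexagon r.1 then f r else 0 := by
  rw [← Finset.sum_filter]
  exact (Finset.sum_subtype (p := fun r : EmptyRect x y => γ.IsHexagon r.1) _ (by simp) f).symm

/-- The matrix which counts all polygons at once, with coefficients in the `2 × 2` matrices over
`k[U_1, …, U_n][T]`, where `T` counts the corners of a polygon at `a` and `b`. -/
noncomputable def Curve.totalMatrix (k : Type) [CommRing k] (σ : RectSign n) (γ : Curve G H c) :
    Matrix (Gen n) (Gen n) (Matrix (Fin 2) (Fin 2) (Polynomial (MvPolynomial (Fin n) k))) :=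
  rectMatrix σ (polyWeight (fun i => Polynomial.C (MvPolynomial.X i)) G.O Polynomial.X γ.a γ.b c (c - 1))

theorem Curve.totalMatrix_zero_zero (hn : 2 ≤ n) (σ : RectSign n) (γ : Curve G H c) (y x : Gen n) :
    γ.totalMatrix k σ y x 0 0 = Polynomial.C (diffMatrix k σ G y x)
      + Polynomial.X ^ 2 * Polynomial.C (γ.hexMatrix k σ y x) := by
  classical
  rw [totalMatrix, rectMatrix_apply_apply, diffMatrix, hexMatrix,
    γ.sum_emptyHex (fun r => weight k (σ x y r) (γ.HexHasO r.1)), map_sum, map_sum, Finset.mul_sum,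
    ← Finset.sum_add_distrib]
  refine Finset.sum_congr rfl fun r _ => ?_
  rw [γ.polyWeight_zero_zero hn, mul_add, C_weight]
  refine congrArg₂ _ (congrArg _ (Finset.prod_congr rfl fun i _ => ?_)) ?_
  · congr
  by_cases h : γ.IsHexagon r.1
  · rw [if_pos h, if_pos h, C_weight]
    ring
  · rw [if_neg h, if_neg h, map_zero, mul_zero, mul_zero]

theorem Curve.totalMatrix_one_zero (hn : 2 ≤ n) (σ : RectSign n) (γ : Curve G H c) (y x : Gen n) :
    γ.totalMatrix k σ y x 1 0 = Polynomial.X * Polynomial.C (γ.pentMatrix k σ y x) := by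
  classical
  rw [totalMatrix, rectMatrix_apply_apply, pentMatrix,
    γ.sum_emptyPent (fun r => weight k (if r.1.left = c then -σ x y r else σ x y r) (γ.PentHasO r.1)),
    map_sum, Finset.mul_sum]
  refine Finset.sum_congr rfl fun r _ => ?_
  rw [γ.polyWeight_one_zero hn]
  split_ifs
  · rw [C_weight, Units.val_neg, Int.cast_neg]
    ring
  · rw [C_weight]
    ring
  · simp

theorem Curve.totalMatrix_symm (σ : RectSign n) (γ : Curve G H c) (y x : Gen n) :
    γ.symm.totalMatrix k σ y x 0 0 = γ.totalMatrix k σ y x 1 1 ∧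
      γ.symm.totalMatrix k σ y x 1 0 = γ.totalMatrix k σ y x 0 1 := by
  simp only [totalMatrix, rectMatrix_apply_apply]
  exact ⟨Finset.sum_congr rfl fun r _ => congrArg _ (γ.polyWeight_symm _ _ _ _ _ _).1,
    Finset.sum_congr rfl fun r _ => congrArg _ (γ.polyWeight_symm _ _ _ _ _ _).2⟩

theorem GridDiagram.two_le (G : GridDiagram n) : 2 ≤ n := by
  by_contra h
  have h0 := NeZero.ne n
  obtain rfl : n = 1 := by omega
  exact G.O_ne_X 0 (Subsingleton.elim _ _)

/-- The coefficients of `1`, `T` and `T ^ 2` in the square of the total matrix. -/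
theorem Curve.matrix_relations (σ : RectSign n) (γ : Curve G H c)
    (hσ : SignRel (Matrix (Fin 2) (Fin 2) (Polynomial (MvPolynomial (Fin n) k))) σ) :
    diffMatrix k σ G * diffMatrix k σ G = 0 ∧
    diffMatrix k σ H * γ.pentMatrix k σ + γ.pentMatrix k σ * diffMatrix k σ G = 0 ∧
    1 + γ.symm.pentMatrix k σ * γ.pentMatrix k σ + diffMatrix k σ G * γ.hexMatrix k σ
      + γ.hexMatrix k σ * diffMatrix k σ G = 0 := by
  have hn := G.two_le
  have hsq := rectMatrix_polyWeight_sq (T := Polynomial.X)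
    (u := fun i => Polynomial.C (MvPolynomial.X i : MvPolynomial (Fin n) k)) hn hσ γ.a_ne_b
    (sub_add_cancel c 1)
    (γ.right_bigon (G.O.symm c) (Or.inl (G.O.apply_symm_apply c)))
    (γ.left_bigon (G.O.symm (c - 1)) (Or.inl (G.O.apply_symm_apply (c - 1))))
  change γ.totalMatrix k σ * γ.totalMatrix k σ = _ at hsq
  have e0 : ∀ z x, ∑ y, (γ.totalMatrix k σ z y 0 0 * γ.totalMatrix k σ y x 0 0
      + γ.totalMatrix k σ z y 0 1 * γ.totalMatrix k σ y x 1 0)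
      = -(Polynomial.X ^ 2 * Polynomial.C ((1 : Matrix (Gen n) (Gen n) (MvPolynomial (Fin n) k)) z x)) := by
    intro z x
    have := congrFun (congrFun (congrFun (congrFun hsq z) x) 0) 0
    rw [Matrix.mul_apply, Matrix.sum_apply] at this
    simp only [Matrix.mul_apply, Fin.sum_univ_two] at this
    rw [this, Matrix.smul_apply]
    by_cases h : z = x
    · subst h; simp
    · simp [Matrix.one_apply_ne h]
  have e1 : ∀ z x, ∑ y, (γ.totalMatrix k σ z y 1 0 * γ.totalMatrix k σ y x 0 0
      + γ.totalMatrix k σ z y 1 1 * γ.totalMatrix k σ y x 1 0) = 0 := by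
    intro z x
    have := congrFun (congrFun (congrFun (congrFun hsq z) x) 1) 0
    rw [Matrix.mul_apply, Matrix.sum_apply] at this
    simp only [Matrix.mul_apply, Fin.sum_univ_two] at this
    rw [this, Matrix.smul_apply]
    by_cases h : z = x
    · subst h; simp
    · simp [Matrix.one_apply_ne h]
  have s1 := fun y x => (γ.totalMatrix_symm (k := k) σ y x).1
  have s2 := fun y x => (γ.totalMatrix_symm (k := k) σ y x).2
  simp only [← s1, ← s2, γ.totalMatrix_zero_zero hn, γ.totalMatrix_one_zero hn,
    γ.symm.totalMatrix_zero_zero hn, γ.symm.totalMatrix_one_zero hn] at e0 e1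
  have f0 : ∀ z x, Polynomial.C ((diffMatrix k σ G * diffMatrix k σ G) z x) +
      Polynomial.C ((γ.symm.pentMatrix k σ * γ.pentMatrix k σ + diffMatrix k σ G * γ.hexMatrix k σ
        + γ.hexMatrix k σ * diffMatrix k σ G) z x) * Polynomial.X ^ 2 +
      Polynomial.C ((γ.hexMatrix k σ * γ.hexMatrix k σ) z x) * Polynomial.X ^ 4
      = -(Polynomial.C ((1 : Matrix (Gen n) (Gen n) (MvPolynomial (Fin n) k)) z x) * Polynomial.X ^ 2) := by
    intro z x
    rw [mul_comm, ← mul_comm (Polynomial.X ^ 2), ← e0]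
    simp only [Matrix.add_apply, Matrix.mul_apply, map_add, map_sum, map_mul, Finset.mul_sum,
      ← Finset.sum_add_distrib]
    rw [mul_comm, Finset.mul_sum, ← Finset.sum_add_distrib]
    refine Finset.sum_congr rfl fun y _ => ?_
    ring
  have f1 : ∀ z x, Polynomial.C ((diffMatrix k σ H * γ.pentMatrix k σ
        + γ.pentMatrix k σ * diffMatrix k σ G) z x) * Polynomial.X +
      Polynomial.C ((γ.pentMatrix k σ * γ.hexMatrix k σ + γ.symm.hexMatrix k σ * γ.pentMatrix k σ) z x)
        * Polynomial.X ^ 3 = 0 := by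
    intro z x
    rw [← e1 z x]
    simp only [Matrix.add_apply, Matrix.mul_apply, map_add, map_sum, map_mul, Finset.sum_mul,
      ← Finset.sum_add_distrib]
    refine Finset.sum_congr rfl fun y _ => ?_
    ring
  refine ⟨?_, ?_, ?_⟩
  · ext1 z x
    simpa [Polynomial.coeff_C_mul, Polynomial.coeff_X_pow] using congrArg (Polynomial.coeff · 0) (f0 z x)
  · ext1 z x
    have := congrArg (Polynomial.coeff · 1) (f1 z x)
    simp only [Polynomial.coeff_add, Polynomial.coeff_C_mul, Polynomial.coeff_X_one,
      Polynomial.coeff_X_pow, Polynomial.coeff_zero] at this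
    norm_num at this
    exact this
  · ext1 z x
    have := congrArg (Polynomial.coeff · 2) (f0 z x)
    simp only [Polynomial.coeff_add, Polynomial.coeff_neg, Polynomial.coeff_C_mul,
      Polynomial.coeff_X_pow, Polynomial.coeff_C] at this
    norm_num at this
    rw [add_assoc, add_assoc, ← add_assoc (γ.symm.pentMatrix k σ * γ.pentMatrix k σ)]
    rw [Matrix.add_apply, Matrix.add_apply, Matrix.add_apply, this]
    simp

end

end GridHomology

namespace GridHomology

variable {n : ℕ}

/-! ### The bilinear form `𝒥` -/

open Classical in
/-- The value of `𝒥` on two points. -/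
noncomputable def pointForm (p q : ℚ × ℚ) : ℚ :=
  ((if p.1 < q.1 ∧ p.2 < q.2 then 1 else 0) + (if q.1 < p.1 ∧ q.2 < p.2 then 1 else 0)) / 2

/-- `𝒥` as a bilinear map. -/
noncomputable def formJ : PointSum →ₗ[ℚ] PointSum →ₗ[ℚ] ℚ :=
  Finsupp.linearCombination ℚ fun p => Finsupp.linearCombination ℚ fun q => pointForm p q

theorem J_eq_formJ (A B : PointSum) : J A B = formJ A B := by
  simp only [J, formJ, Finsupp.linearCombination_apply, Finsupp.sum, LinearMap.sum_apply,
    LinearMap.smul_apply, smul_eq_mul, pointForm, mul_assoc, Finset.mul_sum]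

theorem formJ_single (p q : ℚ × ℚ) :
    formJ (Finsupp.single p 1) (Finsupp.single q 1) = pointForm p q := by
  simp [formJ]

theorem pointForm_comm (p q : ℚ × ℚ) : pointForm p q = pointForm q p := by
  simp only [pointForm, add_comm]

theorem formJ_comm (A B : PointSum) : formJ A B = formJ B A := by
  have : formJ = formJ.flip := by
    refine Finsupp.lhom_ext' fun p => LinearMap.ext_ring (Finsupp.lhom_ext' fun q => LinearMap.ext_ring ?_)
    change formJ (Finsupp.single p 1) (Finsupp.single q 1) = formJ (Finsupp.single q 1) (Finsupp.single p 1)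
    rw [formJ_single, formJ_single, pointForm_comm]
  exact congrFun (congrArg DFunLike.coe (congrFun (congrArg DFunLike.coe this) A)) B

/-- The indicator of `u ≤ v`. -/
def ind (u v : Fin n) : ℚ := if u ≤ v then 1 else 0

theorem ind_self (u : Fin n) : ind u u = 1 := if_pos le_rfl

theorem ind_of_ne {u v : Fin n} (h : u ≠ v) : ind v u = 1 - ind u v := by
  rcases lt_or_gt_of_ne h with h | h
  · rw [ind, ind, if_neg h.not_ge, if_pos h.le, sub_self]
  · rw [ind, ind, if_pos h.le, if_neg h.not_ge, sub_zero]

/-- An intersection point of circles. -/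
def gridPt (u h : Fin n) : ℚ × ℚ := ((u.val : ℚ), (h.val : ℚ))

/-- The centre of a square. -/
def centrePt (u i : Fin n) : ℚ × ℚ := ((u.val : ℚ) + 1 / 2, (i.val : ℚ) + 1 / 2)

theorem ite_and_eq_mul (Q Q' : Prop) [Decidable Q] [Decidable Q'] [Decidable (Q ∧ Q')] :
    (if Q ∧ Q' then (1 : ℚ) else 0) = (if Q then 1 else 0) * (if Q' then 1 else 0) := by
  split_ifs <;> first | (simp; done) | tauto

theorem lt_ind (u v : Fin n) : (if u < v then (1 : ℚ) else 0) = 1 - ind v u := by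
  rw [ind]
  split_ifs <;> first | (simp; done) | (exfalso; omega)

theorem cast_lt_centre (u v : Fin n) : ((u.val : ℚ) < (v.val : ℚ) + 1 / 2) ↔ u ≤ v := by
  rw [Fin.le_def]
  constructor
  · intro h
    by_contra h'
    have : (v.val : ℚ) + 1 ≤ u.val := by exact_mod_cast Nat.lt_of_not_le h'
    linarith
  · intro h
    have : (u.val : ℚ) ≤ v.val := by exact_mod_cast h
    linarith

theorem centre_lt_cast (u v : Fin n) : ((u.val : ℚ) + 1 / 2 < (v.val : ℚ)) ↔ u < v := by
  rw [Fin.lt_def]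
  constructor
  · intro h
    by_contra h'
    have : (v.val : ℚ) ≤ u.val := by exact_mod_cast Nat.le_of_not_lt h'
    linarith
  · intro h
    have : (u.val : ℚ) + 1 ≤ v.val := by exact_mod_cast h
    linarith

theorem pointForm_grid_grid (u h u' h' : Fin n) : pointForm (gridPt u h) (gridPt u' h') =
    ((1 - ind u' u) * (1 - ind h' h) + (1 - ind u u') * (1 - ind h h')) / 2 := by
  classical
  rw [pointForm]
  simp only [gridPt, Nat.cast_lt, Fin.val_fin_lt, ite_and_eq_mul, lt_ind]

theorem pointForm_centre_centre (u h u' h' : Fin n) : pointForm (centrePt u h) (centrePt u' h') =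
    ((1 - ind u' u) * (1 - ind h' h) + (1 - ind u u') * (1 - ind h h')) / 2 := by
  classical
  rw [pointForm]
  simp only [centrePt, add_lt_add_iff_right, Nat.cast_lt, Fin.val_fin_lt, ite_and_eq_mul, lt_ind]

theorem pointForm_grid_centre (u h u' i : Fin n) : pointForm (gridPt u h) (centrePt u' i) =
    (ind u u' * ind h i + (1 - ind u u') * (1 - ind h i)) / 2 := by
  classical
  rw [pointForm]
  simp only [gridPt, centrePt, cast_lt_centre, centre_lt_cast, ite_and_eq_mul, lt_ind]
  rfl

/-! ### Gradings of the end points of a rectangle -/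

/-- The difference of the points on the two generators connected by a rectangle. -/
noncomputable def corners (l r b t : Fin n) : PointSum :=
  Finsupp.single (gridPt l b) 1 + Finsupp.single (gridPt r t) 1
    - Finsupp.single (gridPt r b) 1 - Finsupp.single (gridPt l t) 1

theorem genSum_sub_genSum {x y : Gen n} {r : Rect n} (h : r.Connects x y) :
    genSum x - genSum y = corners r.left r.right r.bottom r.top := by
  rw [genSum, genSum, ← Finset.sum_sub_distrib,
    Finset.sum_eq_add r.bottom r.top r.bottom_ne_top]
  · rw [h.lower_left, h.upper_right, h.lower_right, h.upper_left, corners]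
    simp only [gridPt]
    abel
  · intro i _ hi
    rw [h.agree i hi.1 hi.2, sub_self]
  · exact fun h => absurd (Finset.mem_univ _) h
  · exact fun h => absurd (Finset.mem_univ _) h

theorem formJ_corners_grid (l r b t u h : Fin n) :
    formJ (corners l r b t) (Finsupp.single (gridPt u h) 1) =
      ((ind u r - ind u l) * (ind h t - ind h b) + (ind l u - ind r u) * (ind b h - ind t h)) / 2 := by
  simp only [corners, map_add, map_sub, LinearMap.add_apply, LinearMap.sub_apply, formJ_single,
    pointForm_grid_grid]
  ring

theorem formJ_corners_centre (l r b t u i : Fin n) :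
    formJ (corners l r b t) (Finsupp.single (centrePt u i) 1) =
      (ind l u - ind r u) * (ind b i - ind t i) := by
  simp only [corners, map_add, map_sub, LinearMap.add_apply, LinearMap.sub_apply, formJ_single,
    pointForm_grid_centre]
  ring

/-- The indicator of the half-open arc `[p, q)`. -/
def arcInd (p q i : Fin n) : ℚ := if gap p i < gap p q then 1 else 0

/-- The indicator of the half-open arc `(p, q]`. -/
def arcInd' (p q i : Fin n) : ℚ := if 0 < gap p i ∧ gap p i ≤ gap p q then 1 else 0

/-- Whether the arc from `p` to `q` passes through `0`. -/
def wrap (p q : Fin n) : ℚ := if q < p then 1 else 0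

theorem ind_sub_ind (p q i : Fin n) : ind p i - ind q i = arcInd p q i - wrap p q := by
  simp only [ind, arcInd, wrap, gap_lt_iff, Fin.le_def, Fin.lt_def]
  split_ifs <;> first | (norm_num; done) | omega

theorem gap_le_iff' (p q i : Fin n) : (0 < gap p i ∧ gap p i ≤ gap p q) ↔
    (p.val < i.val ∧ i.val ≤ q.val) ∨ (i.val ≤ q.val ∧ q.val < p.val) ∨
      (q.val < p.val ∧ p.val < i.val) := by
  have := p.isLt
  have := q.isLt
  have := i.isLt
  simp only [gap_eq]
  split_ifs <;> omega

theorem ind_sub_ind' (p q i : Fin n) : ind i q - ind i p = arcInd' p q i - wrap p q := by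
  simp only [ind, arcInd', wrap, gap_le_iff', Fin.le_def, Fin.lt_def]
  split_ifs <;> first | (norm_num; done) | omega

theorem sum_ind_left (p : Fin n) : ∑ i, ind p i = (n : ℚ) - p.val := by
  simp only [ind]
  rw [Finset.sum_ite, Finset.sum_const_zero, add_zero, Finset.sum_const, nsmul_eq_mul, mul_one,
    Finset.filter_le_eq_Ici, Fin.card_Ici, Nat.cast_sub p.isLt.le]

theorem sum_ind_right (p : Fin n) : ∑ i, ind i p = (p.val : ℚ) + 1 := by
  simp only [ind]
  rw [Finset.sum_ite, Finset.sum_const_zero, add_zero, Finset.sum_const, nsmul_eq_mul, mul_one,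
    Finset.filter_ge_eq_Iic, Fin.card_Iic, Nat.cast_succ]

theorem sum_arcInd (p q : Fin n) : ∑ i, arcInd p q i = (q.val : ℚ) - p.val + n * wrap p q := by
  have : ∀ i, arcInd p q i = ind p i - ind q i + wrap p q := fun i => by rw [ind_sub_ind]; ring
  simp only [this, Finset.sum_add_distrib, Finset.sum_sub_distrib, sum_ind_left, Finset.sum_const,
    Finset.card_univ, Fintype.card_fin, nsmul_eq_mul]
  ring

theorem sum_arcInd' (p q : Fin n) : ∑ i, arcInd' p q i = (q.val : ℚ) - p.val + n * wrap p q := by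
  have : ∀ i, arcInd' p q i = ind i q - ind i p + wrap p q := fun i => by rw [ind_sub_ind']; ring
  simp only [this, Finset.sum_add_distrib, Finset.sum_sub_distrib, sum_ind_right, Finset.sum_const,
    Finset.card_univ, Fintype.card_fin, nsmul_eq_mul]
  ring

/-- The correction term for rectangles which leave the fundamental domain. -/
def wrapTerm (l r b t : Fin n) : ℚ :=
  -(wrap l r * ((t.val : ℚ) - b.val + n * wrap b t)) - wrap b t * ((r.val : ℚ) - l.val + n * wrap l r)
    + n * wrap l r * wrap b t

theorem sum_arc_mul_arc (l r b t : Fin n) (x : Equiv.Perm (Fin n)) :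
    ∑ i, (ind l (x i) - ind r (x i)) * (ind b i - ind t i)
      = ∑ i, arcInd l r (x i) * arcInd b t i + wrapTerm l r b t := by
  have h1 := sum_arcInd b t
  have h2 := (Equiv.sum_comp x (arcInd l r)).trans (sum_arcInd l r)
  simp only [ind_sub_ind, sub_mul, mul_sub, Finset.sum_sub_distrib]
  rw [← Finset.sum_mul, ← Finset.mul_sum, h1, h2, Finset.sum_const, Finset.card_univ, Fintype.card_fin,
    wrapTerm, nsmul_eq_mul]
  ring

theorem sum_arc_mul_arc' (l r b t : Fin n) (x : Equiv.Perm (Fin n)) :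
    ∑ i, (ind (x i) r - ind (x i) l) * (ind i t - ind i b)
      = ∑ i, arcInd' l r (x i) * arcInd' b t i + wrapTerm l r b t := by
  have h1 := sum_arcInd' b t
  have h2 := (Equiv.sum_comp x (arcInd' l r)).trans (sum_arcInd' l r)
  simp only [ind_sub_ind', sub_mul, mul_sub, Finset.sum_sub_distrib]
  rw [← Finset.sum_mul, ← Finset.mul_sum, h1, h2, Finset.sum_const, Finset.card_univ, Fintype.card_fin,
    wrapTerm, nsmul_eq_mul]
  ring

theorem formJ_corners_genSum (l r b t : Fin n) (x : Gen n) :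
    formJ (corners l r b t) (genSum x) = (∑ i, arcInd' l r (x i) * arcInd' b t i
      + ∑ i, arcInd l r (x i) * arcInd b t i) / 2 + wrapTerm l r b t := by
  have h : ∀ i, formJ (corners l r b t) (Finsupp.single (((x i).val : ℚ), (i.val : ℚ)) 1)
      = _ := fun i => formJ_corners_grid l r b t (x i) i
  rw [genSum, map_sum]
  simp only [h]
  rw [← Finset.sum_div, Finset.sum_add_distrib, sum_arc_mul_arc, sum_arc_mul_arc']
  ring

theorem formJ_corners_markSum (l r b t : Fin n) (D : Equiv.Perm (Fin n)) (K : Finset (Fin n)) :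
    formJ (corners l r b t) (markSum D K) = ∑ i ∈ K, (ind l (D i) - ind r (D i)) * (ind b i - ind t i) := by
  have h : ∀ i, formJ (corners l r b t) (Finsupp.single (((D i).val : ℚ) + 1 / 2, (i.val : ℚ) + 1 / 2) 1)
      = _ := fun i => formJ_corners_centre l r b t (D i) i
  rw [markSum, map_sum]
  simp only [h]

theorem arcInd_corner_sums {x y : Gen n} (r : EmptyRect x y) :
    ∑ i, arcInd r.1.left r.1.right (x i) * arcInd r.1.bottom r.1.top i = 1 ∧
    ∑ i, arcInd' r.1.left r.1.right (x i) * arcInd' r.1.bottom r.1.top i = 1 ∧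
    ∑ i, arcInd r.1.left r.1.right (y i) * arcInd r.1.bottom r.1.top i = 0 ∧
    ∑ i, arcInd' r.1.left r.1.right (y i) * arcInd' r.1.bottom r.1.top i = 0 := by
  obtain ⟨⟨l, rr, b, t, hlr, hbt⟩, hc, he⟩ := r
  have h1 : x b = l := hc.lower_left
  have h2 : x t = rr := hc.upper_right
  have h3 : y b = rr := hc.lower_right
  have h4 : y t = l := hc.upper_left
  have h5 : ∀ h, h ≠ b → h ≠ t → y h = x h := hc.agree
  replace he : ∀ h, ¬ ((0 < gap l (x h) ∧ gap l (x h) < gap l rr) ∧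
    (0 < gap b h ∧ gap b h < gap b t)) := he
  dsimp only
  have p1 := gap_pos hlr
  have p2 := gap_pos hbt
  have pos : ∀ h, h ≠ b → h ≠ t → (gap l (x h) ≠ 0 ∧ gap l (x h) ≠ gap l rr) ∧
      gap b h ≠ 0 ∧ gap b h ≠ gap b t := by
    intro h hb ht
    refine ⟨⟨fun e => ?_, fun e => ?_⟩, fun e => ?_, fun e => ?_⟩
    · exact hb (x.injective ((gap_inj (e.trans (gap_self l).symm)).trans h1.symm))
    · exact ht (x.injective ((gap_inj e).trans h2.symm))
    · exact hb (gap_inj (e.trans (gap_self b).symm))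
    · exact ht (gap_inj e)
  have z1 : ∀ h, h ≠ b → h ≠ t → arcInd l rr (x h) * arcInd b t h = 0 := by
    intro h hb ht
    have := he h
    obtain ⟨⟨q1, q2⟩, q3, q4⟩ := pos h hb ht
    simp only [arcInd]
    split_ifs <;> first | (simp; done) | (exfalso; omega)
  have z2 : ∀ h, h ≠ b → h ≠ t → arcInd' l rr (x h) * arcInd' b t h = 0 := by
    intro h hb ht
    have := he h
    obtain ⟨⟨q1, q2⟩, q3, q4⟩ := pos h hb ht
    simp only [arcInd']
    split_ifs <;> first | (simp; done) | (exfalso; omega)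
  refine ⟨?_, ?_, ?_, ?_⟩
  all_goals
    rw [Finset.sum_eq_add b t hbt]
  all_goals first | exact fun h => absurd (Finset.mem_univ _) h | skip
  · simp [h1, h2, arcInd, gap_self, p1, p2]
  · exact fun h _ hh => z1 h hh.1 hh.2
  · simp [h1, h2, arcInd', gap_self, p1, p2]
  · exact fun h _ hh => z2 h hh.1 hh.2
  · simp [h3, h4, arcInd, gap_self]
  · exact fun h _ hh => by rw [h5 h hh.1 hh.2, z1 h hh.1 hh.2]
  · simp [h3, h4, arcInd', gap_self]
  · exact fun h _ hh => by rw [h5 h hh.1 hh.2, z2 h hh.1 hh.2]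

theorem maslov_emptyRect (G : GridDiagram n) {x y : Gen n} (r : EmptyRect x y) :
    maslov G y = maslov G x - 1
      + 2 * ∑ i, arcInd r.1.left r.1.right (G.O i) * arcInd r.1.bottom r.1.top i := by
  obtain ⟨h1, h2, h3, h4⟩ := arcInd_corner_sums r
  have hx : genSum x = genSum y + corners r.1.left r.1.right r.1.bottom r.1.top := by
    rw [← genSum_sub_genSum r.2.1]
    abel
  have e1 := formJ_corners_genSum r.1.left r.1.right r.1.bottom r.1.top x
  have e2 := formJ_corners_genSum r.1.left r.1.right r.1.bottom r.1.top y
  have e3 := formJ_corners_markSum r.1.left r.1.right r.1.bottom r.1.top G.O Finset.univ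
  rw [sum_arc_mul_arc] at e3
  rw [h1, h2] at e1
  rw [h3, h4] at e2
  rw [hx] at e1
  rw [maslov, maslov, J_eq_formJ, J_eq_formJ, hx]
  simp only [map_add, map_sub, LinearMap.add_apply, LinearMap.sub_apply] at e1 ⊢
  rw [formJ_comm (genSum y) (corners _ _ _ _), formJ_comm (markSum G.O _) (corners _ _ _ _), e2, e3]
  rw [e2] at e1
  linear_combination -e1

end GridHomology

namespace GridHomology

variable {n : ℕ}

/-! ### Alexander gradings of the end points of a rectangle -/

theorem GridDiagram.IsComponentNumbering.comp_follow {ℓ : ℕ} {G : GridDiagram n} {comp : Fin n → Fin ℓ}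
    (h : G.IsComponentNumbering comp) (i : Fin n) : comp (G.follow i) = comp i :=
  ((h.2 _ _).2 (Equiv.Perm.sameCycle_apply_right.2 (Equiv.Perm.SameCycle.refl _ _))).symm

theorem GridDiagram.IsComponentNumbering.sum_O_eq_sum_X {ℓ : ℕ} {G : GridDiagram n} {comp : Fin n → Fin ℓ}
    (h : G.IsComponentNumbering comp) (j : Fin ℓ) (f : Fin n → ℚ) :
    ∑ i ∈ Finset.univ.filter (fun i => comp i = j), f (G.O i)
      = ∑ i ∈ Finset.univ.filter (fun i => comp i = j), f (G.X i) := by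
  rw [Finset.sum_filter, Finset.sum_filter, ← Equiv.sum_comp G.follow]
  refine Finset.sum_congr rfl fun i _ => ?_
  rw [h.comp_follow i]
  simp [GridDiagram.follow]

theorem GridDiagram.IsComponentNumbering.comp_symm {ℓ : ℕ} {G : GridDiagram n} {comp : Fin n → Fin ℓ}
    (h : G.IsComponentNumbering comp) (v : Fin n) : comp (G.X.symm v) = comp (G.O.symm v) := by
  rw [← h.comp_follow (G.X.symm v)]
  simp [GridDiagram.follow]

theorem alexander_emptyRect {ℓ : ℕ} {G : GridDiagram n} {comp : Fin n → Fin ℓ}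
    (h : G.IsComponentNumbering comp) {x y : Gen n} (r : EmptyRect x y) (j : Fin ℓ) :
    alexander G comp y j = alexander G comp x j
      + ∑ i ∈ Finset.univ.filter (fun i => comp i = j),
          arcInd r.1.left r.1.right (G.O i) * arcInd r.1.bottom r.1.top i
      - ∑ i ∈ Finset.univ.filter (fun i => comp i = j),
          arcInd r.1.left r.1.right (G.X i) * arcInd r.1.bottom r.1.top i := by
  have hx : genSum x = genSum y + corners r.1.left r.1.right r.1.bottom r.1.top := by
    rw [← genSum_sub_genSum r.2.1]
    abel
  have key := h.sum_O_eq_sum_X j (arcInd r.1.left r.1.right)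
  rw [alexander, alexander, J_eq_formJ, J_eq_formJ, hx]
  simp only [map_add, map_sub, LinearMap.add_apply, LinearMap.sub_apply, formJ_corners_markSum,
    ind_sub_ind, sub_mul, mul_sub, Finset.sum_sub_distrib, ← Finset.sum_mul]
  rw [key]
  ring

/-! ### Gradings before and after the commutation -/

/-- The difference of the centres of the two squares in row `p` on both sides of the vertical
circle `c`. -/
noncomputable def slide [NeZero n] (c p : Fin n) : PointSum :=
  Finsupp.single (centrePt (c - 1) p) 1 - Finsupp.single (centrePt c p) 1

theorem gap_sub_one_self [NeZero n] (hn : 2 ≤ n) (c : Fin n) : gap (c - 1) c = 1 := by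
  simpa using gap_add_one hn (c - 1)

theorem ind_sub_ind_pred [NeZero n] (hn : 2 ≤ n) (c u : Fin n) :
    ind u c - ind u (c - 1) = (if u = c then 1 else 0) - wrap (c - 1) c := by
  rw [ind_sub_ind', arcInd', gap_sub_one_self hn]
  congr 2
  rw [eq_iff_iff]
  constructor
  · intro h
    exact gap_inj ((le_antisymm h.2 h.1).trans (gap_sub_one_self hn c).symm)
  · rintro rfl
    rw [gap_sub_one_self hn]
    exact ⟨Nat.one_pos, le_rfl⟩

theorem ind_pred_sub_ind [NeZero n] (hn : 2 ≤ n) (c u : Fin n) :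
    ind (c - 1) u - ind c u = (if u = c - 1 then 1 else 0) - wrap (c - 1) c := by
  rw [ind_sub_ind, arcInd, gap_sub_one_self hn]
  congr 2
  rw [eq_iff_iff]
  constructor
  · intro h
    exact gap_inj ((Nat.lt_one_iff.1 h).trans (gap_self (c - 1)).symm)
  · rintro rfl
    rw [gap_self]
    exact Nat.one_pos

theorem formJ_slide_grid [NeZero n] (hn : 2 ≤ n) (c p u h : Fin n) :
    formJ (slide c p) (Finsupp.single (gridPt u h) 1)
      = ((if u = c then 1 else 0) - wrap (c - 1) c) * (1 - 2 * ind h p) / 2 := by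
  rw [← ind_sub_ind_pred hn, formJ_comm]
  simp only [slide, map_sub, formJ_single, pointForm_grid_centre]
  ring

theorem formJ_slide_centre [NeZero n] (hn : 2 ≤ n) (c p u i : Fin n) :
    formJ (slide c p) (Finsupp.single (centrePt u i) 1)
      = (((if u = c then 1 else 0) - wrap (c - 1) c) * (1 - ind i p)
        - ((if u = c - 1 then 1 else 0) - wrap (c - 1) c) * (1 - ind p i)) / 2 := by
  rw [← ind_sub_ind_pred hn, ← ind_pred_sub_ind hn]
  simp only [slide, map_sub, LinearMap.sub_apply, formJ_single, pointForm_centre_centre]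
  ring

theorem formJ_slide_genSum [NeZero n] (hn : 2 ≤ n) (c p : Fin n) (x : Gen n) :
    formJ (slide c p) (genSum x)
      = (1 - 2 * ind (x.symm c) p) / 2 - wrap (c - 1) c * (n - 2 * (p.val + 1)) / 2 := by
  have h : ∀ i, formJ (slide c p) (Finsupp.single (((x i).val : ℚ), (i.val : ℚ)) 1)
      = _ := fun i => formJ_slide_grid hn c p (x i) i
  have e : ∀ i, x i = c ↔ i = x.symm c := fun i => (Equiv.eq_symm_apply x).symm
  rw [genSum, map_sum]
  simp only [h, e]
  rw [← Finset.sum_div]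
  simp only [sub_mul, Finset.sum_sub_distrib, ite_mul, one_mul, zero_mul, Finset.sum_ite_eq',
    Finset.mem_univ, if_true, mul_sub, mul_one, Finset.sum_const, Finset.card_univ, Fintype.card_fin,
    nsmul_eq_mul, mul_left_comm _ (2 : ℚ), ← Finset.mul_sum, sum_ind_right]
  ring

theorem formJ_slide_markSum [NeZero n] (hn : 2 ≤ n) (c p : Fin n) (D : Equiv.Perm (Fin n))
    (K : Finset (Fin n)) :
    formJ (slide c p) (markSum D K)
      = ((if D.symm c ∈ K then 1 else 0) * (1 - ind (D.symm c) p)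
        - (if D.symm (c - 1) ∈ K then 1 else 0) * (1 - ind p (D.symm (c - 1)))) / 2
        - wrap (c - 1) c * (∑ i ∈ K, (ind p i - ind i p)) / 2 := by
  have h : ∀ i, formJ (slide c p) (Finsupp.single (((D i).val : ℚ) + 1 / 2, (i.val : ℚ) + 1 / 2) 1)
      = _ := fun i => formJ_slide_centre hn c p (D i) i
  have e : ∀ i v, D i = v ↔ i = D.symm v := fun i v => (Equiv.eq_symm_apply D).symm
  rw [markSum, map_sum]
  simp only [h, e]
  rw [← Finset.sum_div]
  have : ∀ i, ((if i = D.symm c then (1 : ℚ) else 0) - wrap (c - 1) c) * (1 - ind i p)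
        - ((if i = D.symm (c - 1) then 1 else 0) - wrap (c - 1) c) * (1 - ind p i)
      = (if i = D.symm c then 1 - ind (D.symm c) p else 0)
        - (if i = D.symm (c - 1) then 1 - ind p (D.symm (c - 1)) else 0)
        - wrap (c - 1) c * (ind p i - ind i p) := by
    intro i
    split_ifs with h1 h2 h2
    · rw [← h1, ← h2]; ring
    · rw [← h1]; ring
    · rw [← h2]; ring
    · ring
  simp only [this, Finset.sum_sub_distrib, Finset.sum_ite_eq', ← Finset.mul_sum, ite_mul, one_mul,
    zero_mul]
  ring

theorem markSum_sub_markSum [NeZero n] (hn : 2 ≤ n) {c : Fin n} {D D' : Equiv.Perm (Fin n)}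
    (h : ∀ i, D' i = Equiv.swap (c - 1) c (D i)) (K : Finset (Fin n)) :
    markSum D K - markSum D' K = (if D.symm (c - 1) ∈ K then (1 : ℚ) else 0) • slide c (D.symm (c - 1))
      - (if D.symm c ∈ K then (1 : ℚ) else 0) • slide c (D.symm c) := by
  have hc := sub_one_ne hn c
  have : ∀ i, (Finsupp.single (((D i).val : ℚ) + 1 / 2, (i.val : ℚ) + 1 / 2) 1 : PointSum)
      - Finsupp.single (((D' i).val : ℚ) + 1 / 2, (i.val : ℚ) + 1 / 2) 1
      = (if i = D.symm (c - 1) then slide c (D.symm (c - 1)) else 0)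
        - (if i = D.symm c then slide c (D.symm c) else 0) := by
    intro i
    split_ifs with h1 h2 h2
    · exact absurd (D.symm.injective (h1.symm.trans h2)) hc
    · rw [h, ← h1, (Equiv.eq_symm_apply D).1 h1, Equiv.swap_apply_left, sub_zero]
      rfl
    · rw [h, ← h2, (Equiv.eq_symm_apply D).1 h2, Equiv.swap_apply_right, zero_sub, slide, neg_sub]
      rfl
    · rw [h, Equiv.swap_apply_of_ne_of_ne, sub_self, sub_zero]
      · exact fun e => h1 ((Equiv.eq_symm_apply D).2 e)
      · exact fun e => h2 ((Equiv.eq_symm_apply D).2 e)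
  rw [markSum, markSum, ← Finset.sum_sub_distrib]
  simp only [this, Finset.sum_sub_distrib, Finset.sum_ite_eq', ite_smul, one_smul, zero_smul]

theorem formJ_slide_sub [NeZero n] (hn : 2 ≤ n) (c p : Fin n) (x : Gen n) (D : Equiv.Perm (Fin n)) :
    formJ (slide c p) (genSum x - markSum D Finset.univ)
      = (1 - 2 * ind (x.symm c) p - ind p (D.symm (c - 1)) + ind (D.symm c) p + wrap (c - 1) c) / 2 := by
  rw [map_sub, formJ_slide_genSum hn, formJ_slide_markSum hn, Finset.sum_sub_distrib, sum_ind_left,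
    sum_ind_right]
  simp only [Finset.mem_univ, if_true]
  ring

theorem symm_apply_of_swap [NeZero n] {c : Fin n} {D D' : Equiv.Perm (Fin n)}
    (h : ∀ i, D' i = Equiv.swap (c - 1) c (D i)) :
    D'.symm c = D.symm (c - 1) ∧ D'.symm (c - 1) = D.symm c := by
  constructor
  · rw [Equiv.symm_apply_eq, h, Equiv.apply_symm_apply, Equiv.swap_apply_left]
  · rw [Equiv.symm_apply_eq, h, Equiv.apply_symm_apply, Equiv.swap_apply_right]

theorem maslov_sub_maslov [NeZero n] (hn : 2 ≤ n) {G H : GridDiagram n} {c : Fin n}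
    (h : ∀ i, H.O i = Equiv.swap (c - 1) c (G.O i)) (x : Gen n) :
    maslov H x - maslov G x = 1 + 2 * (ind (x.symm c) (G.O.symm c) - ind (x.symm c) (G.O.symm (c - 1))
      - ind (G.O.symm (c - 1)) (G.O.symm c)) := by
  have e := markSum_sub_markSum hn h Finset.univ
  obtain ⟨s1, s2⟩ := symm_apply_of_swap h
  have hne : G.O.symm (c - 1) ≠ G.O.symm c := G.O.symm.injective.ne (sub_one_ne hn c)
  simp only [Finset.mem_univ, if_true, one_smul] at e
  set E := slide c (G.O.symm (c - 1)) - slide c (G.O.symm c) with hE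
  have e1 : formJ E (genSum x - markSum G.O Finset.univ) = ind (x.symm c) (G.O.symm c)
      - ind (x.symm c) (G.O.symm (c - 1)) - ind (G.O.symm (c - 1)) (G.O.symm c) := by
    rw [hE, LinearMap.map_sub₂, formJ_slide_sub hn, formJ_slide_sub hn, ind_self, ind_self,
      ind_of_ne hne]
    ring
  have e2 : formJ E (genSum x - markSum H.O Finset.univ) = ind (x.symm c) (G.O.symm c)
      - ind (x.symm c) (G.O.symm (c - 1)) + 1 - ind (G.O.symm (c - 1)) (G.O.symm c) := by
    rw [hE, LinearMap.map_sub₂, formJ_slide_sub hn, formJ_slide_sub hn, s1, s2, ind_self,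
      ind_self]
    ring
  have hG : genSum x - markSum G.O Finset.univ = genSum x - markSum H.O Finset.univ - E := by
    rw [← e]; abel
  rw [maslov, maslov, J_eq_formJ, J_eq_formJ]
  rw [hG] at e1 ⊢
  generalize genSum x - markSum H.O Finset.univ = Z at *
  simp only [map_sub, LinearMap.sub_apply] at e1 ⊢
  rw [formJ_comm Z E]
  linear_combination e1 + e2

theorem alexander_sub_alexander [NeZero n] (hn : 2 ≤ n) {ℓ : ℕ} {G H : GridDiagram n} {c : Fin n}
    (hO : ∀ i, H.O i = Equiv.swap (c - 1) c (G.O i)) (hX : ∀ i, H.X i = Equiv.swap (c - 1) c (G.X i))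
    {comp : Fin n → Fin ℓ} (hcomp : G.IsComponentNumbering comp) (x : Gen n) (j : Fin ℓ)
    {pO qO pX qX t : Fin n} (hpO : G.O.symm (c - 1) = pO) (hqO : G.O.symm c = qO)
    (hpX : G.X.symm (c - 1) = pX) (hqX : G.X.symm c = qX) (ht : x.symm c = t) {κ κ' : ℚ}
    (hκ : κ = if comp pO = j then 1 else 0) (hκ' : κ' = if comp qO = j then 1 else 0) :
    alexander G comp x j - alexander H comp x j =
      κ * (ind t pO - ind t pX + (ind qO pX - ind pX qO + ind pO qO - ind qO pO
          + ind qX pX - ind pX qX + ind pO qX - ind qX pO) / 4)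
      + κ' * (ind t qX - ind t qO + (ind pO qO - ind qO pO + ind qX pO - ind pO qX
          + ind pX qO - ind qO pX + ind qX pX - ind pX qX) / 4) := by
  set K := Finset.univ.filter (fun i => comp i = j) with hK
  have mem : ∀ i, i ∈ K ↔ comp i = j := fun i => by simp [hK]
  have cp : comp pX = comp pO := by rw [← hpX, ← hpO, hcomp.comp_symm]
  have cq : comp qX = comp qO := by rw [← hqX, ← hqO, hcomp.comp_symm]
  have bO := markSum_sub_markSum hn hO K
  have bX := markSum_sub_markSum hn hX K
  have uO := markSum_sub_markSum hn hO Finset.univ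
  have uX := markSum_sub_markSum hn hX Finset.univ
  obtain ⟨s1, s2⟩ := symm_apply_of_swap hO
  obtain ⟨s3, s4⟩ := symm_apply_of_swap hX
  simp only [hpO, hqO, hpX, hqX, mem, cp, cq, ← hκ, ← hκ', Finset.mem_univ, if_true, one_smul] at bO bX uO uX
  simp only [hpO, hqO, hpX, hqX] at s1 s2 s3 s4
  have f1 : ∀ p, formJ (slide c p) (genSum x - markSum H.O Finset.univ) = _ :=
    fun p => formJ_slide_sub hn c p x H.O
  have f2 : ∀ p, formJ (slide c p) (genSum x - markSum H.X Finset.univ) = _ :=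
    fun p => formJ_slide_sub hn c p x H.X
  have f3 : ∀ p, formJ (slide c p) (markSum G.O K) = _ := fun p => formJ_slide_markSum hn c p G.O K
  have f4 : ∀ p, formJ (slide c p) (markSum G.X K) = _ := fun p => formJ_slide_markSum hn c p G.X K
  simp only [hpO, hqO, hpX, hqX, mem, cp, cq, ← hκ, ← hκ', s1, s2, s3, s4, ht] at f1 f2 f3 f4
  rw [alexander, alexander, J_eq_formJ, J_eq_formJ, ← hK]
  have g1 : markSum G.O Finset.univ = markSum H.O Finset.univ + (slide c pO - slide c qO) := by
    rw [← uO]; abel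
  have g2 : markSum G.X Finset.univ = markSum H.X Finset.univ + (slide c pX - slide c qX) := by
    rw [← uX]; abel
  have g3 : markSum H.O K = markSum G.O K - (κ • slide c pO - κ' • slide c qO) := by
    rw [← bO]; abel
  have g4 : markSum H.X K = markSum G.X K - (κ • slide c pX - κ' • slide c qX) := by
    rw [← bX]; abel
  rw [g1, g2, g3, g4]
  have f1' : ∀ p, formJ (genSum x) (slide c p) - formJ (markSum H.O Finset.univ) (slide c p) = _ :=
    fun p => by rw [← LinearMap.sub_apply, ← map_sub, formJ_comm, f1]
  have f2' : ∀ p, formJ (genSum x) (slide c p) - formJ (markSum H.X Finset.univ) (slide c p) = _ :=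
    fun p => by rw [← LinearMap.sub_apply, ← map_sub, formJ_comm, f2]
  simp only [map_sub, map_add, map_smul, LinearMap.sub_apply, LinearMap.add_apply, LinearMap.smul_apply,
    smul_eq_mul, f3, f4]
  linear_combination (κ * (f1' pX - f1' pO) - κ' * (f1' qX - f1' qO)
    + κ * (f2' pX - f2' pO) - κ' * (f2' qX - f2' qO)) / 2

end GridHomology

namespace GridHomology

variable {n : ℕ}

/-! ### Gradings of the end points of pentagons and hexagons -/

open Classical in
/-- The indicator of the open arc `(p, q)`. -/
noncomputable def openInd (p q i : Fin n) : ℚ := if Cyc p i q then 1 else 0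

theorem ind_eq_of_ne_left (p : Fin n) {a h : Fin n} (hh : h ≠ a) :
    ind h p = 2 - ind p a - openInd a h p - ind a h := by
  have hh' := Fin.val_ne_of_ne hh
  simp only [ind, openInd, cyc_iff, Fin.le_def]
  split_ifs <;> first | (norm_num; done) | omega

theorem ind_eq_of_ne_right (q : Fin n) {a h : Fin n} (hh : h ≠ a) :
    ind h q = 1 + ind a q - arcInd a h q - ind a h := by
  have hh' := Fin.val_ne_of_ne hh
  simp only [ind, arcInd, gap_lt_iff, Fin.le_def]
  split_ifs <;> first | (norm_num; done) | omega

/-- Away from `a`, a mark in the left bigon and a mark in the right bigon are separated by `a` or by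
the cut at `0`. -/
theorem ind_of_inArc {a b p q : Fin n} (hp : InArc b a p) (hq : InArc a b q) (hpq : p ≠ q) :
    ind p q = ind p a + ind a q - 1 := by
  have hpq' := Fin.val_ne_of_ne hpq
  have := p.isLt
  have := q.isLt
  have := a.isLt
  have := b.isLt
  simp only [InArc, gap_eq] at hp hq
  simp only [ind, Fin.le_def]
  split_ifs at hp hq ⊢ <;> first | (norm_num; done) | omega

theorem skew_of_inArc {a b p q : Fin n} (hp : InArc b a p) (hq : InArc a b q) (hpq : p ≠ q) :
    ind p q - ind q p = 2 * (ind p a + ind a q) - 3 := by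
  rw [ind_of_ne hpq, ind_of_inArc hp hq hpq]
  ring

theorem cyc_iff_of_gap_lt {b a t p : Fin n} (h : gap b a < gap b t) :
    Cyc a p t ↔ gap b p < gap b t ∧ gap b a < gap b p := by
  have := b.isLt
  have := a.isLt
  have := t.isLt
  have := p.isLt
  simp only [gap_eq] at h ⊢
  rw [cyc_iff]
  split_ifs at h ⊢ <;> omega

theorem gap_lt_iff_of_gap_lt {b a t p : Fin n} (h : gap b a < gap b t) :
    gap a p < gap a t ↔ gap b p < gap b t ∧ gap b a ≤ gap b p := by
  have := b.isLt
  have := a.isLt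
  have := t.isLt
  have := p.isLt
  simp only [gap_eq] at h ⊢
  rw [← gap_eq, ← gap_eq, gap_lt_iff]
  split_ifs at h ⊢ <;> omega

open Classical in
/-- The number of marks in a rectangle, in the rows of `K`. -/
noncomputable def Rect.count (r : Rect n) (D : Equiv.Perm (Fin n)) (K : Finset (Fin n)) : ℚ :=
  ∑ i ∈ K, if r.HasCol (D i) ∧ r.HasRow i then 1 else 0

theorem Rect.count_eq (r : Rect n) (D : Equiv.Perm (Fin n)) (K : Finset (Fin n)) :
    ∑ i ∈ K, arcInd r.left r.right (D i) * arcInd r.bottom r.top i = r.count D K := by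
  classical
  refine Finset.sum_congr rfl fun i _ => ?_
  rw [ite_and_eq_mul]
  simp only [arcInd, Rect.HasCol, Rect.HasRow]
  congr

namespace Curve

variable [NeZero n] {G H : GridDiagram n} {c : Fin n}

theorem maslov_sub_maslov (γ : Curve G H c) (x : Gen n) (ha : x.symm c ≠ γ.a) :
    maslov H x - maslov G x = 1 - 2 * (arcInd γ.a (x.symm c) (G.O.symm c)
      - openInd γ.a (x.symm c) (G.O.symm (c - 1))) := by
  have hp := γ.left_bigon (G.O.symm (c - 1)) (Or.inl (by simp))
  have hq := γ.right_bigon (G.O.symm c) (Or.inl (by simp))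
  have hpq : G.O.symm (c - 1) ≠ G.O.symm c := G.O.symm.injective.ne (sub_one_ne G.two_le c)
  rw [GridHomology.maslov_sub_maslov G.two_le γ.O_switch, ind_eq_of_ne_left (G.O.symm (c - 1)) ha,
    ind_eq_of_ne_right (G.O.symm c) ha, ind_of_inArc hp hq hpq]
  ring

theorem alexander_sub_alexander {ℓ : ℕ} {comp : Fin n → Fin ℓ} (γ : Curve G H c)
    (hcomp : G.IsComponentNumbering comp) (x : Gen n) (ha : x.symm c ≠ γ.a) (j : Fin ℓ) :
    alexander H comp x j - alexander G comp x j =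
      (if comp (G.O.symm (c - 1)) = j then 1 else 0) * (openInd γ.a (x.symm c) (G.O.symm (c - 1))
        - openInd γ.a (x.symm c) (G.X.symm (c - 1)))
      - (if comp (G.O.symm c) = j then 1 else 0) * (arcInd γ.a (x.symm c) (G.O.symm c)
        - arcInd γ.a (x.symm c) (G.X.symm c)) := by
  have hp := γ.left_bigon (G.O.symm (c - 1)) (Or.inl (by simp))
  have hq := γ.right_bigon (G.O.symm c) (Or.inl (by simp))
  have hp' := γ.left_bigon (G.X.symm (c - 1)) (Or.inr (by simp))
  have hq' := γ.right_bigon (G.X.symm c) (Or.inr (by simp))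
  have hc := sub_one_ne G.two_le c
  have cp := hcomp.comp_symm (c - 1)
  have cq := hcomp.comp_symm c
  have e := GridHomology.alexander_sub_alexander G.two_le γ.O_switch γ.X_switch hcomp x j rfl rfl rfl rfl rfl
    rfl rfl
  have s1 := skew_of_inArc hp hq (G.O.symm.injective.ne hc)
  have s2 := skew_of_inArc hp' hq' (G.X.symm.injective.ne hc)
  -- If two marks of the different columns lie in one row, then all four lie on one component.
  have s3 : ((if comp (G.O.symm (c - 1)) = j then (1 : ℚ) else 0) - if comp (G.O.symm c) = j then 1 else 0)
      * (ind (G.O.symm (c - 1)) (G.X.symm c) - ind (G.X.symm c) (G.O.symm (c - 1))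
        - (2 * (ind (G.O.symm (c - 1)) γ.a + ind γ.a (G.X.symm c)) - 3)) = 0 := by
    by_cases h : G.O.symm (c - 1) = G.X.symm c
    · rw [h, cq, sub_self, zero_mul]
    · rw [skew_of_inArc hp hq' h, sub_self, mul_zero]
  have s4 : ((if comp (G.O.symm (c - 1)) = j then (1 : ℚ) else 0) - if comp (G.O.symm c) = j then 1 else 0)
      * (ind (G.X.symm (c - 1)) (G.O.symm c) - ind (G.O.symm c) (G.X.symm (c - 1))
        - (2 * (ind (G.X.symm (c - 1)) γ.a + ind γ.a (G.O.symm c)) - 3)) = 0 := by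
    by_cases h : G.X.symm (c - 1) = G.O.symm c
    · rw [← cp, h, sub_self, zero_mul]
    · rw [skew_of_inArc hp' hq h, sub_self, mul_zero]
  rw [ind_eq_of_ne_left (G.O.symm (c - 1)) ha, ind_eq_of_ne_right (G.O.symm c) ha,
    ind_eq_of_ne_left (G.X.symm (c - 1)) ha, ind_eq_of_ne_right (G.X.symm c) ha] at e
  generalize (if comp (G.O.symm (c - 1)) = j then (1 : ℚ) else 0) = κ at *
  generalize (if comp (G.O.symm c) = j then (1 : ℚ) else 0) = κ' at *
  linear_combination -e - (κ + κ') / 4 * s1 + (κ + κ') / 4 * s2 - s3 / 4 + s4 / 4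

/-- A mark in row `i`, in the columns `D i` with respect to `β` and `D' i` with respect to `γ`,
lies in the pentagon with the straightening `r`. -/
def PentHasMark (γ : Curve G H c) (D D' : Equiv.Perm (Fin n)) (r : Rect n) (i : Fin n) : Prop :=
  r.HasRow i ∧
    (gap r.bottom i ≤ gap r.bottom γ.a → r.HasCol (if r.left = c then D i else D' i)) ∧
    (gap r.bottom γ.a ≤ gap r.bottom i → r.HasCol (if r.left = c then D' i else D i))

/-- A mark in row `i`, in the columns `D i` with respect to `β` and `D' i` with respect to `γ`,
lies in the hexagon with the straightening `r`. -/
def HexHasMark (γ : Curve G H c) (D D' : Equiv.Perm (Fin n)) (r : Rect n) (i : Fin n) : Prop :=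
  r.HasRow i ∧
    (gap r.bottom i ≤ gap r.bottom (γ.lowerCorner r) ∨
      gap r.bottom (γ.upperCorner r) ≤ gap r.bottom i → r.HasCol (D i)) ∧
    (gap r.bottom (γ.lowerCorner r) ≤ gap r.bottom i ∧
      gap r.bottom i ≤ gap r.bottom (γ.upperCorner r) → r.HasCol (D' i))

theorem pentHasO_iff (γ : Curve G H c) (r : Rect n) (i : Fin n) :
    γ.PentHasO r i ↔ γ.PentHasMark G.O H.O r i := by
  unfold PentHasO PentHasMark
  exact Iff.rfl

open Classical in
/-- A mark of the left column is counted by the pentagon but not by the rectangle if it lies above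
`a`, and the other way round for a mark of the right column. -/
theorem count_sub_pentagon (γ : Curve G H c) {D D' : Equiv.Perm (Fin n)}
    (hD : ∀ i, D' i = Equiv.swap (c - 1) c (D i)) {r : Rect n} (hr : γ.IsPentagon r) (K : Finset (Fin n)) :
    (r.count (if r.left = c then D else D') K : ℚ) - ∑ i ∈ K, (if γ.PentHasMark D D' r i then 1 else 0)
      = (if D.symm c ∈ K then 1 else 0) * arcInd γ.a r.top (D.symm c)
        - (if D.symm (c - 1) ∈ K then 1 else 0) * openInd γ.a r.top (D.symm (c - 1)) := by
  have hn := G.two_le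
  have hc := sub_one_ne hn c
  obtain ⟨hl, ha⟩ := hr
  have key : ∀ i, ((if r.HasCol ((if r.left = c then D else D') i) ∧ r.HasRow i then 1 else 0 : ℚ)
      - if γ.PentHasMark D D' r i then 1 else 0)
      = (if i = D.symm c then arcInd γ.a r.top (D.symm c) else 0)
        - (if i = D.symm (c - 1) then openInd γ.a r.top (D.symm (c - 1)) else 0) := by
    intro i
    have e1 : i = D.symm c ↔ D i = c := Equiv.eq_symm_apply D
    have e2 : i = D.symm (c - 1) ↔ D i = c - 1 := Equiv.eq_symm_apply D
    by_cases h1 : D i = c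
    · have h2 : D' i = c - 1 := by rw [hD, h1, Equiv.swap_apply_right]
      rw [if_pos (e1.2 h1), if_neg (fun h => hc ((e2.1 h).symm.trans h1)), sub_zero, ← e1.2 h1, arcInd]
      simp only [gap_lt_iff_of_gap_lt ha, PentHasMark, Rect.HasRow]
      rcases hl with hl | hl
      · simp only [if_pos hl, h1, h2, Rect.hasCol_of_left hl, Rect.not_hasCol_sub_one_of_left hn hl]
        split_ifs <;> first | (norm_num; done) | (exfalso; grind)
      · have hl' : ¬ r.left = c := fun h => r.left_ne_right (h.trans hl.symm)
        simp only [if_neg hl', h1, h2, Rect.not_hasCol_of_right hl, Rect.hasCol_sub_one_of_right hn hl]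
        split_ifs <;> first | (norm_num; done) | (exfalso; grind)
    · by_cases h2 : D i = c - 1
      · have h3 : D' i = c := by rw [hD, h2, Equiv.swap_apply_left]
        rw [if_pos (e2.2 h2), if_neg (fun h => h1 (e1.1 h)), zero_sub, ← e2.2 h2, openInd]
        simp only [cyc_iff_of_gap_lt ha, PentHasMark, Rect.HasRow]
        rcases hl with hl | hl
        · simp only [if_pos hl, h3, h2, Rect.hasCol_of_left hl, Rect.not_hasCol_sub_one_of_left hn hl]
          split_ifs <;> first | (norm_num; done) | (exfalso; grind)
        · have hl' : ¬ r.left = c := fun h => r.left_ne_right (h.trans hl.symm)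
          simp only [if_neg hl', h3, h2, Rect.not_hasCol_of_right hl, Rect.hasCol_sub_one_of_right hn hl]
          split_ifs <;> first | (norm_num; done) | (exfalso; grind)
      · have h3 : D' i = D i := by rw [hD, Equiv.swap_apply_of_ne_of_ne h2 h1]
        rw [if_neg (fun h => h1 (e1.1 h)), if_neg (fun h => h2 (e2.1 h)), sub_zero, sub_eq_zero]
        have h4 : (if r.left = c then D else D') i = D i := by split_ifs <;> simp [h3]
        rw [h4]
        simp only [PentHasMark, h3, ite_self]
        have : gap r.bottom i ≤ gap r.bottom γ.a ∨ gap r.bottom γ.a ≤ gap r.bottom i := le_total _ _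
        congr 1
        rw [eq_iff_iff]
        tauto
  rw [Rect.count, ← Finset.sum_sub_distrib]
  simp only [key, Finset.sum_sub_distrib, Finset.sum_ite_eq', ite_mul, one_mul, zero_mul]

open Classical in
/-- The rectangle contains one mark of the columns next to `β`, and the hexagon none. -/
theorem count_sub_hexagon (γ : Curve G H c) {D D' : Equiv.Perm (Fin n)}
    (hD : ∀ i, D' i = Equiv.swap (c - 1) c (D i)) (hp : InArc γ.b γ.a (D.symm (c - 1)))
    (hq : InArc γ.a γ.b (D.symm c)) {r : Rect n} (hr : γ.IsHexagon r) (K : Finset (Fin n)) :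
    (r.count D K : ℚ) - ∑ i ∈ K, (if γ.HexHasMark D D' r i then 1 else 0)
      = if (if r.left = c then D.symm c else D.symm (c - 1)) ∈ K then 1 else 0 := by
  have hn := G.two_le
  have hc := sub_one_ne hn c
  obtain ⟨hl, ha, hab⟩ := hr
  unfold Rect.HasRow at ha
  have key : ∀ i, ((if r.HasCol (D i) ∧ r.HasRow i then 1 else 0 : ℚ)
      - if γ.HexHasMark D D' r i then 1 else 0)
      = if i = (if r.left = c then D.symm c else D.symm (c - 1)) then 1 else 0 := by
    intro i
    have e1 : i = D.symm c ↔ D i = c := Equiv.eq_symm_apply D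
    have e2 : i = D.symm (c - 1) ↔ D i = c - 1 := Equiv.eq_symm_apply D
    by_cases h1 : D i = c
    · have h2 : D' i = c - 1 := by rw [hD, h1, Equiv.swap_apply_right]
      rw [← e1.2 h1] at hq ⊢
      rcases hl with hl | hl
      · simp only [upperCorner, lowerCorner, if_pos hl] at ha hab
        have := gap_le_of_inArc hab hq
        simp only [HexHasMark, Rect.HasRow, upperCorner, lowerCorner, if_pos hl, h1, h2, Rect.hasCol_of_left hl,
          Rect.not_hasCol_sub_one_of_left hn hl]
        have h5 : gap r.bottom i < gap r.bottom r.top := by omega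
        simp [h5, this]
      · have hl' : ¬ r.left = c := fun h => r.left_ne_right (h.trans hl.symm)
        simp only [upperCorner, lowerCorner, if_neg hl'] at ha hab
        have := not_gap_lt_of_inArc (h := r.bottom) hq
        have h6 : ¬ i = D.symm (c - 1) := fun h => hc ((e2.1 h).symm.trans h1)
        simp only [HexHasMark, Rect.HasRow, upperCorner, lowerCorner, if_neg hl', h1, h2,
          Rect.not_hasCol_of_right hl, Rect.hasCol_sub_one_of_right hn hl, if_neg h6]
        split_ifs <;> first | (norm_num; done) | (exfalso; grind)
    · by_cases h2 : D i = c - 1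
      · have h3 : D' i = c := by rw [hD, h2, Equiv.swap_apply_left]
        rw [← e2.2 h2] at hp ⊢
        rcases hl with hl | hl
        · simp only [upperCorner, lowerCorner, if_pos hl] at ha hab
          have := not_gap_lt_of_inArc (h := r.bottom) hp
          simp only [HexHasMark, Rect.HasRow, upperCorner, lowerCorner, if_pos hl, h3, h2,
            Rect.hasCol_of_left hl, Rect.not_hasCol_sub_one_of_left hn hl, e1, hc]
          split_ifs <;> first | (norm_num; done) | (exfalso; grind)
        · have hl' : ¬ r.left = c := fun h => r.left_ne_right (h.trans hl.symm)
          simp only [upperCorner, lowerCorner, if_neg hl'] at ha hab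
          have := gap_le_of_inArc hab hp
          simp only [HexHasMark, Rect.HasRow, upperCorner, lowerCorner, if_neg hl', h3, h2,
            Rect.not_hasCol_of_right hl, Rect.hasCol_sub_one_of_right hn hl]
          have h5 : gap r.bottom i < gap r.bottom r.top := by omega
          simp [h5, this]
      · have h3 : D' i = D i := by rw [hD, Equiv.swap_apply_of_ne_of_ne h2 h1]
        have h4 : ¬ i = (if r.left = c then D.symm c else D.symm (c - 1)) := by
          split_ifs
          · exact fun h => h1 (e1.1 h)
          · exact fun h => h2 (e2.1 h)
        rw [if_neg h4, sub_eq_zero]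
        simp only [HexHasMark, h3]
        have : gap r.bottom i ≤ gap r.bottom (γ.lowerCorner r) ∨
            gap r.bottom (γ.lowerCorner r) ≤ gap r.bottom i :=
          le_total _ _
        have : gap r.bottom i ≤ gap r.bottom (γ.upperCorner r) ∨
            gap r.bottom (γ.upperCorner r) ≤ gap r.bottom i :=
          le_total _ _
        congr 1
        rw [eq_iff_iff]
        tauto
  rw [Rect.count, ← Finset.sum_sub_distrib]
  simp only [key, Finset.sum_ite_eq']

end Curve

end GridHomology

namespace GridHomology

variable {n : ℕ} {ℓ : ℕ}

theorem EmptyRect.symm_apply_of_left {x y : Gen n} (r : EmptyRect x y) {c : Fin n} (h : r.1.left = c) :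
    y.symm c = r.1.top := by
  rw [Equiv.symm_apply_eq, r.2.1.upper_left, h]

theorem EmptyRect.symm_apply_of_right {x y : Gen n} (r : EmptyRect x y) {c : Fin n} (h : r.1.right = c) :
    x.symm c = r.1.top := by
  rw [Equiv.symm_apply_eq, r.2.1.upper_right, h]

theorem Rect.count_nonneg (r : Rect n) (D : Equiv.Perm (Fin n)) (K : Finset (Fin n)) : 0 ≤ r.count D K :=
  Finset.sum_nonneg fun i _ => by split_ifs <;> norm_num

theorem Rect.top_ne_of_hasRow (r : Rect n) {i : Fin n} (h : r.HasRow i) : r.top ≠ i := by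
  rintro rfl
  exact lt_irrefl _ h

namespace Curve

variable [NeZero n] {G H : GridDiagram n} {c : Fin n}

theorem follow_eq (γ : Curve G H c) : H.follow = G.follow := by
  ext1 i
  have : H.O = G.O.trans (Equiv.swap (c - 1) c) := Equiv.ext γ.O_switch
  simp [GridDiagram.follow, γ.X_switch, this]

theorem isComponentNumbering {comp : Fin n → Fin ℓ} (γ : Curve G H c) (h : G.IsComponentNumbering comp) :
    H.IsComponentNumbering comp := by
  refine ⟨h.1, fun i j => ?_⟩
  rw [γ.follow_eq]
  exact h.2 i j

open Classical in
theorem maslov_pentagon (γ : Curve G H c) {x y : Gen n} (p : γ.EmptyPent x y) :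
    maslov H y = maslov G x + 2 * ∑ i, if γ.PentHasMark G.O H.O p.1.1 i then 1 else 0 := by
  have e := γ.count_sub_pentagon γ.O_switch p.2 Finset.univ
  have ht := p.1.1.top_ne_of_hasRow p.2.2
  simp only [Finset.mem_univ, if_true, one_mul] at e
  by_cases hl : p.1.1.left = c
  · have h1 := maslov_emptyRect G p.1
    have h2 := γ.maslov_sub_maslov y (by rwa [p.1.symm_apply_of_left hl])
    rw [Rect.count_eq] at h1
    rw [p.1.symm_apply_of_left hl, ← e, if_pos hl] at h2
    linear_combination h1 + h2
  · have hr := p.2.1.resolve_left hl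
    have h1 := maslov_emptyRect H p.1
    have h2 := γ.maslov_sub_maslov x (by rwa [p.1.symm_apply_of_right hr])
    rw [Rect.count_eq] at h1
    rw [p.1.symm_apply_of_right hr, ← e, if_neg hl] at h2
    linear_combination h1 + h2

open Classical in
theorem alexander_pentagon {comp : Fin n → Fin ℓ} (γ : Curve G H c) (hcomp : G.IsComponentNumbering comp)
    {x y : Gen n} (p : γ.EmptyPent x y) (j : Fin ℓ) :
    alexander H comp y j = alexander G comp x j
      + (∑ i ∈ Finset.univ.filter (fun i => comp i = j), if γ.PentHasMark G.O H.O p.1.1 i then 1 else 0)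
      - ∑ i ∈ Finset.univ.filter (fun i => comp i = j), if γ.PentHasMark G.X H.X p.1.1 i then 1 else 0 := by
  have e := γ.count_sub_pentagon γ.O_switch p.2 (Finset.univ.filter (fun i => comp i = j))
  have e' := γ.count_sub_pentagon γ.X_switch p.2 (Finset.univ.filter (fun i => comp i = j))
  have ht := p.1.1.top_ne_of_hasRow p.2.2
  have cp := hcomp.comp_symm (c - 1)
  have cq := hcomp.comp_symm c
  simp only [Finset.mem_filter, Finset.mem_univ, true_and, cp, cq] at e e'
  by_cases hl : p.1.1.left = c
  · have h1 := alexander_emptyRect hcomp p.1 j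
    have h2 := γ.alexander_sub_alexander hcomp y (by rwa [p.1.symm_apply_of_left hl]) j
    rw [Rect.count_eq, Rect.count_eq] at h1
    rw [p.1.symm_apply_of_left hl] at h2
    rw [if_pos hl] at e e'
    linear_combination h1 + h2 + e - e'
  · have hr := p.2.1.resolve_left hl
    have h1 := alexander_emptyRect (γ.isComponentNumbering hcomp) p.1 j
    have h2 := γ.alexander_sub_alexander hcomp x (by rwa [p.1.symm_apply_of_right hr]) j
    rw [Rect.count_eq, Rect.count_eq] at h1
    rw [p.1.symm_apply_of_right hr] at h2
    rw [if_neg hl] at e e'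
    linear_combination h1 + h2 + e - e'

open Classical in
theorem maslov_hexagon (γ : Curve G H c) {x y : Gen n} (p : γ.EmptyHex x y) :
    maslov G y = maslov G x + 1 + 2 * ∑ i, if γ.HexHasMark G.O H.O p.1.1 i then 1 else 0 := by
  have e := γ.count_sub_hexagon γ.O_switch (γ.left_bigon _ (Or.inl (by simp)))
    (γ.right_bigon _ (Or.inl (by simp))) p.2 Finset.univ
  have h1 := maslov_emptyRect G p.1
  rw [Rect.count_eq] at h1
  rw [if_pos (Finset.mem_univ _)] at e
  linear_combination h1 + 2 * e

open Classical in
theorem alexander_hexagon {comp : Fin n → Fin ℓ} (γ : Curve G H c) (hcomp : G.IsComponentNumbering comp)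
    {x y : Gen n} (p : γ.EmptyHex x y) (j : Fin ℓ) :
    alexander G comp y j = alexander G comp x j
      + (∑ i ∈ Finset.univ.filter (fun i => comp i = j), if γ.HexHasMark G.O H.O p.1.1 i then 1 else 0)
      - ∑ i ∈ Finset.univ.filter (fun i => comp i = j), if γ.HexHasMark G.X H.X p.1.1 i then 1 else 0 := by
  have e := γ.count_sub_hexagon γ.O_switch (γ.left_bigon _ (Or.inl (by simp)))
    (γ.right_bigon _ (Or.inl (by simp))) p.2 (Finset.univ.filter (fun i => comp i = j))
  have e' := γ.count_sub_hexagon γ.X_switch (γ.left_bigon _ (Or.inr (by simp)))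
    (γ.right_bigon _ (Or.inr (by simp))) p.2 (Finset.univ.filter (fun i => comp i = j))
  have cp := hcomp.comp_symm (c - 1)
  have cq := hcomp.comp_symm c
  have h1 := alexander_emptyRect hcomp p.1 j
  rw [Rect.count_eq, Rect.count_eq] at h1
  simp only [Finset.mem_filter, Finset.mem_univ, true_and, apply_ite comp, cp, cq] at e e'
  linear_combination h1 + e - e'

end Curve

/-! ### Filtered maps -/

variable {k : Type} [CommRing k]

open Classical in
/-- The exponents of the monomial in `weight`. -/
noncomputable def weightExponent (Q : Fin n → Prop) : Fin n →₀ ℕ :=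
  Finsupp.equivFunOnFinite.symm fun i => if Q i then 1 else 0

theorem weight_eq (ε : ℤˣ) (Q : Fin n → Prop) :
    weight k ε Q = ((ε : ℤ) : k) • MvPolynomial.monomial (weightExponent Q) 1 := by
  classical
  rw [weight, MvPolynomial.monomial_eq, Finsupp.prod_fintype _ _ (fun _ => pow_zero _), map_one, one_mul,
    MvPolynomial.smul_eq_C_mul, map_intCast]
  rfl

open Classical in
/-- A map that is given by a weighted count is filtered of degree `e` if each contribution is. -/
theorem isFilteredOfDegree_linearCombination {comp : Fin n → Fin ℓ} {G H : GridDiagram n} {e : ℤ}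
    {ι : Gen n → Gen n → Type} [∀ x y, Fintype (ι x y)] (ε : ∀ x y, ι x y → ℤˣ)
    (Q : ∀ x y, ι x y → Fin n → Prop)
    (hM : ∀ x y (r : ι x y), maslov H y = maslov G x + e + 2 * ∑ i, if Q x y r i then 1 else 0)
    (hA : ∀ x y (r : ι x y) j, alexander H comp y j ≤ alexander G comp x j
      + ∑ i ∈ Finset.univ.filter (fun i => comp i = j), if Q x y r i then 1 else 0)
    {f : Cx k G →ₗ[MvPolynomial (Fin n) k] Cx k H}
    (hf : f = Finsupp.linearCombination (MvPolynomial (Fin n) k) fun x : Gen n =>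
      ∑ y : Gen n, ∑ r : ι x y, Finsupp.single y (weight k (ε x y r) (Q x y r))) :
    IsFilteredOfDegree comp e f := by
  have hv : ∀ x m, f (Finsupp.single x (MvPolynomial.monomial m 1)) = ∑ y : Gen n, ∑ r : ι x y,
      ((ε x y r : ℤ) : k) • Finsupp.single y (MvPolynomial.monomial (m + weightExponent (Q x y r)) 1) := by
    intro x m
    rw [hf, Finsupp.linearCombination_single]
    simp only [Finset.smul_sum, weight_eq, Finsupp.smul_single, smul_eq_mul, Algebra.mul_smul_comm,
      MvPolynomial.monomial_mul, mul_one]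
  constructor
  · intro d v hvd
    induction hvd using Submodule.span_induction with
    | mem v hv' =>
      obtain ⟨x, m, h, rfl⟩ := hv'
      rw [hv]
      refine Submodule.sum_mem _ fun y _ => Submodule.sum_mem _ fun r _ => Submodule.smul_mem _ _
        (Submodule.subset_span ⟨y, _, ?_, rfl⟩)
      simp only [weightExponent, Finsupp.add_apply, Finsupp.equivFunOnFinite_symm_apply_apply, Nat.cast_add,
        Nat.cast_ite, Nat.cast_one, Nat.cast_zero, Finset.sum_add_distrib]
      rw [hM x y r]
      push_cast
      linear_combination h
    | zero => rw [map_zero]; exact Submodule.zero_mem _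
    | add u v _ _ hu hv => rw [map_add]; exact Submodule.add_mem _ hu hv
    | smul a v _ hv =>
      rw [← algebraMap_smul (MvPolynomial (Fin n) k), map_smul, algebraMap_smul]
      exact Submodule.smul_mem _ _ hv
  · intro s v hvs
    induction hvs using Submodule.span_induction with
    | mem v hv' =>
      obtain ⟨x, m, h, rfl⟩ := hv'
      rw [hv]
      refine Submodule.sum_mem _ fun y _ => Submodule.sum_mem _ fun r _ => ?_
      rw [← algebraMap_smul (MvPolynomial (Fin n) k)]
      refine Submodule.smul_mem _ _ (Submodule.subset_span ⟨y, _, fun j => ?_, rfl⟩)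
      simp only [weightExponent, Finsupp.add_apply, Finsupp.equivFunOnFinite_symm_apply_apply, Nat.cast_add,
        Nat.cast_ite, Nat.cast_one, Nat.cast_zero, Finset.sum_add_distrib]
      linarith [hA x y r j, h j]
    | zero => rw [map_zero]; exact Submodule.zero_mem _
    | add u v _ _ hu hv => rw [map_add]; exact Submodule.add_mem _ hu hv
    | smul a v _ hv =>
      rw [map_smul]
      exact Submodule.smul_mem _ _ hv

theorem sum_indicator_nonneg (K : Finset (Fin n)) (Q : Fin n → Prop) [DecidablePred Q] :
    (0 : ℚ) ≤ ∑ i ∈ K, if Q i then 1 else 0 :=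
  Finset.sum_nonneg fun i _ => by split_ifs <;> norm_num

theorem isFilteredOfDegree_differential {comp : Fin n → Fin ℓ} {G : GridDiagram n}
    (h : G.IsComponentNumbering comp) (σ : RectSign n) :
    IsFilteredOfDegree comp (-1) (differential k σ G) := by
  classical
  refine isFilteredOfDegree_linearCombination (ι := EmptyRect) σ
    (fun _ _ r i => r.1.HasCol (G.O i) ∧ r.1.HasRow i) (fun x y r => ?_) (fun x y r j => ?_) rfl
  · have := maslov_emptyRect G r
    rw [Rect.count_eq, Rect.count] at this
    push_cast
    rw [← sub_eq_add_neg]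
    convert this
  · have := alexander_emptyRect h r j
    rw [Rect.count_eq, Rect.count_eq] at this
    have h2 := r.1.count_nonneg G.X (Finset.univ.filter (fun i => comp i = j))
    rw [Rect.count] at this
    convert this.trans_le (sub_le_self _ h2)

namespace Curve

variable [NeZero n] {G H : GridDiagram n} {c : Fin n}

theorem isFilteredOfDegree_pentMap {comp : Fin n → Fin ℓ} (γ : Curve G H c)
    (h : G.IsComponentNumbering comp) (σ : RectSign n) :
    IsFilteredOfDegree comp 0 (γ.pentMap k σ) := by
  classical
  refine isFilteredOfDegree_linearCombination (ι := γ.EmptyPent)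
    (fun x y p => if p.1.1.left = c then -σ x y p.1 else σ x y p.1)
    (fun _ _ p => γ.PentHasO p.1.1) (fun x y p => ?_) (fun x y p j => ?_) ?_
  · simp only [pentHasO_iff, Int.cast_zero, add_zero]
    convert γ.maslov_pentagon p
  · have := γ.alexander_pentagon h p j
    simp only [pentHasO_iff]
    have h2 := sum_indicator_nonneg (Finset.univ.filter (fun i => comp i = j)) (γ.PentHasMark G.X H.X p.1.1)
    convert (this.trans_le (sub_le_self _ h2))
  · unfold pentMap
    congr

theorem isFilteredOfDegree_hexMap {comp : Fin n → Fin ℓ} (γ : Curve G H c)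
    (h : G.IsComponentNumbering comp) (σ : RectSign n) :
    IsFilteredOfDegree comp 1 (γ.hexMap k σ) := by
  classical
  refine isFilteredOfDegree_linearCombination (ι := γ.EmptyHex)
    (fun x y p => σ x y p.1) (fun _ _ p => γ.HexHasMark G.O H.O p.1.1) (fun x y p => ?_) (fun x y p j => ?_) rfl
  · rw [Int.cast_one]
    convert γ.maslov_hexagon p
  · have := γ.alexander_hexagon h p j
    have h2 := sum_indicator_nonneg (Finset.univ.filter (fun i => comp i = j)) (γ.HexHasMark G.X H.X p.1.1)
    convert (this.trans_le (sub_le_self _ h2))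

end Curve

/-! ### Existence of the curve -/

theorem IsCommutation.nonempty_curve [NeZero n] {G H : GridDiagram n} {c : Fin n}
    (h : IsCommutation G H c) : Nonempty (Curve G H c) := by
  have self : ∀ p : Fin n, ∀ q, InArc p q p := fun p q => by rw [InArc, gap_self]; exact Nat.zero_le _
  have self' : ∀ p : Fin n, ∀ q, InArc p q q := fun p q => le_refl _
  have hcol : ∀ i, G.O i = c - 1 ∨ G.X i = c - 1 → i = G.O.symm (c - 1) ∨ i = G.X.symm (c - 1) :=
    fun i hi => hi.imp (Equiv.eq_symm_apply _).2 (Equiv.eq_symm_apply _).2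
  rcases h.arcs (G.O.symm (c - 1)) (G.X.symm (c - 1)) (by simp) (by simp) with h1 | h1
  · refine ⟨⟨G.O.symm (c - 1), G.X.symm (c - 1), h.O_switch, h.X_switch, fun i hi => ?_, h1⟩⟩
    rcases hcol i hi with rfl | rfl
    exacts [self' _ _, self _ _]
  · refine ⟨⟨G.X.symm (c - 1), G.O.symm (c - 1), h.O_switch, h.X_switch, fun i hi => ?_, h1⟩⟩
    rcases hcol i hi with rfl | rfl
    exacts [self _ _, self' _ _]

/-! ### Homology -/

/-- A map which anti-commutes with the differentials and has an inverse up to homotopy and sign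
induces an isomorphism on homology. -/
theorem inducesIsoOnHomology {R M N : Type} [CommRing R] [AddCommGroup M] [Module R M]
    [AddCommGroup N] [Module R N] {d : M →ₗ[R] M} {d' : N →ₗ[R] N} {f : M →ₗ[R] N} {g : N →ₗ[R] M}
    {h : M →ₗ[R] M} {h' : N →ₗ[R] N} (hf : d' ∘ₗ f + f ∘ₗ d = 0) (hg : d ∘ₗ g + g ∘ₗ d' = 0)
    (hgf : LinearMap.id + g ∘ₗ f + d ∘ₗ h + h ∘ₗ d = 0)
    (hfg : LinearMap.id + f ∘ₗ g + d' ∘ₗ h' + h' ∘ₗ d' = 0) : InducesIsoOnHomology d d' f := by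
  have hf' : ∀ z, d' (f z) = -f (d z) := fun z => eq_neg_of_add_eq_zero_left (LinearMap.congr_fun hf z)
  have hg' : ∀ z, d (g z) = -g (d' z) := fun z => eq_neg_of_add_eq_zero_left (LinearMap.congr_fun hg z)
  have hgf' : ∀ z, z + g (f z) + d (h z) + h (d z) = 0 := LinearMap.congr_fun hgf
  have hfg' : ∀ z, z + f (g z) + d' (h' z) + h' (d' z) = 0 := LinearMap.congr_fun hfg
  have kf : ∀ z ∈ LinearMap.ker d, f z ∈ LinearMap.ker d' := by
    intro z hz
    rw [LinearMap.mem_ker] at hz ⊢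
    rw [hf', hz, map_zero, neg_zero]
  have kg : ∀ z ∈ LinearMap.ker d', g z ∈ LinearMap.ker d := by
    intro z hz
    rw [LinearMap.mem_ker] at hz ⊢
    rw [hg', hz, map_zero, neg_zero]
  have hle : (LinearMap.range d).submoduleOf (LinearMap.ker d)
      ≤ ((LinearMap.range d').submoduleOf (LinearMap.ker d')).comap (f.restrict kf) := by
    rintro ⟨z, hz⟩ ⟨w, hw⟩
    exact ⟨-f w, by
      change d' (-f w) = f z
      rw [map_neg, hf', neg_neg]
      exact congrArg f hw⟩
  refine ⟨kf, LinearEquiv.ofBijective (Submodule.mapQ _ _ (f.restrict kf) hle) ⟨?_, ?_⟩, fun z => rfl⟩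
  · rw [← LinearMap.ker_eq_bot, LinearMap.ker_eq_bot']
    intro m hm
    obtain ⟨⟨z, hz⟩, rfl⟩ := Submodule.Quotient.mk_surjective _ m
    rw [Submodule.mapQ_apply, Submodule.Quotient.mk_eq_zero] at hm
    obtain ⟨w, hw⟩ := hm
    replace hw : d' w = f z := hw
    rw [Submodule.Quotient.mk_eq_zero]
    refine ⟨g w - h z, ?_⟩
    change d (g w - h z) = z
    have e := hgf' z
    rw [LinearMap.mem_ker.1 hz, map_zero, add_zero] at e
    rw [map_sub, hg', hw]
    exact (eq_of_sub_eq_zero (by rw [← e]; abel)).symm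
  · intro m
    obtain ⟨⟨z, hz⟩, rfl⟩ := Submodule.Quotient.mk_surjective _ m
    refine ⟨Submodule.Quotient.mk (-⟨g z, kg z hz⟩), ?_⟩
    rw [Submodule.mapQ_apply, Submodule.Quotient.eq]
    refine ⟨h' z, ?_⟩
    change d' (h' z) = f (-g z) - z
    have e := hfg' z
    rw [LinearMap.mem_ker.1 hz, map_zero, add_zero] at e
    rw [map_neg]
    exact eq_of_sub_eq_zero (by rw [← e]; abel)

end GridHomology

namespace GridHomology

/-! ### The identities between the maps -/

variable {n : ℕ} {k : Type} [CommRing k]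

theorem noSign_signRel_zmod (n : ℕ) :
    SignRel (Matrix (Fin 2) (Fin 2) (Polynomial (MvPolynomial (Fin n) (ZMod 2)))) (noSign n) :=
  noSign_signRel n (by
    have h : (1 : ZMod 2) = -1 := rfl
    have := congrArg
      (algebraMap (ZMod 2) (Matrix (Fin 2) (Fin 2) (Polynomial (MvPolynomial (Fin n) (ZMod 2))))) h
    rwa [map_neg, map_one] at this)

namespace Curve

variable [NeZero n] {G H : GridDiagram n} {c : Fin n}

/-- The identities between the maps: `∂² = 0`, the pentagon map anti-commutes with the
differentials, and the hexagon map is a homotopy. -/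
theorem map_relations (γ : Curve G H c) {σ : RectSign n}
    (hσ : SignRel (Matrix (Fin 2) (Fin 2) (Polynomial (MvPolynomial (Fin n) k))) σ) :
    differential k σ G ∘ₗ differential k σ G = 0 ∧
    differential k σ H ∘ₗ γ.pentMap k σ + γ.pentMap k σ ∘ₗ differential k σ G = 0 ∧
    LinearMap.id + γ.symm.pentMap k σ ∘ₗ γ.pentMap k σ
      + differential k σ G ∘ₗ γ.hexMap k σ + γ.hexMap k σ ∘ₗ differential k σ G = 0 := by
  obtain ⟨h1, h2, h3⟩ := γ.matrix_relations (k := k) σ hσ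
  have e1 := congrArg (matrixMap k) h1
  have e2 := congrArg (matrixMap k) h2
  have e3 := congrArg (matrixMap k) h3
  simp only [matrixMap_mul, matrixMap_add, matrixMap_one, matrixMap_zero] at e1 e2 e3
  rw [γ.pentMap_eq_matrixMap, γ.hexMap_eq_matrixMap, γ.symm.pentMap_eq_matrixMap,
    differential_eq_matrixMap, differential_eq_matrixMap]
  exact ⟨e1, e2, e3⟩

end Curve

theorem eq_of_add_eq_zero_of_charTwo {M N : Type} [AddCommGroup M] [AddCommGroup N]
    [Module (MvPolynomial (Fin n) (ZMod 2)) M] [Module (MvPolynomial (Fin n) (ZMod 2)) N]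
    {f g : M →ₗ[MvPolynomial (Fin n) (ZMod 2)] N} (h : f + g = 0) : f = g := by
  have h2 : (2 : MvPolynomial (Fin n) (ZMod 2)) = 0 := CharTwo.two_eq_zero
  have : g + g = 0 := by rw [← two_smul (MvPolynomial (Fin n) (ZMod 2)) g, h2, zero_smul]
  rw [eq_neg_of_add_eq_zero_left h, ← eq_neg_of_add_eq_zero_left this]

end GridHomology

theorem proposition3p2 (n : ℕ) [NeZero n] (ℓ : ℕ) (G H : GridDiagram n) (c : Fin n)
    (hGH : IsCommutation G H c)
    (comp : Fin n → Fin ℓ) (hcomp : G.IsComponentNumbering comp) :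
    -- A curve as needed exists, and the following holds for each one.
    Nonempty (Curve G H c) ∧
    ∀ γ : Curve G H c,
      -- Coefficients in `𝔽₂`.
      (IsFilteredComplex comp
          (differential (ZMod 2) (noSign n) G) ∧
        IsFilteredComplex comp
          (differential (ZMod 2) (noSign n) H) ∧
        IsFilteredOfDegree comp 0 (γ.pentMap (ZMod 2) (noSign n)) ∧
        IsFilteredOfDegree comp 0 (γ.symm.pentMap (ZMod 2) (noSign n)) ∧
        IsFilteredOfDegree comp 1 (γ.hexMap (ZMod 2) (noSign n)) ∧
        IsFilteredOfDegree comp 1 (γ.symm.hexMap (ZMod 2) (noSign n)) ∧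
        differential (ZMod 2) (noSign n) H
            ∘ₗ γ.pentMap (ZMod 2) (noSign n)
          = γ.pentMap (ZMod 2) (noSign n)
            ∘ₗ differential (ZMod 2) (noSign n) G ∧
        differential (ZMod 2) (noSign n) G
            ∘ₗ γ.symm.pentMap (ZMod 2) (noSign n)
          = γ.symm.pentMap (ZMod 2) (noSign n)
            ∘ₗ differential (ZMod 2) (noSign n) H ∧
        LinearMap.id
          + γ.symm.pentMap (ZMod 2) (noSign n)
            ∘ₗ γ.pentMap (ZMod 2) (noSign n)
          + differential (ZMod 2) (noSign n) G
            ∘ₗ γ.hexMap (ZMod 2) (noSign n)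
          + γ.hexMap (ZMod 2) (noSign n)
            ∘ₗ differential (ZMod 2) (noSign n) G = 0 ∧
        LinearMap.id
          + γ.pentMap (ZMod 2) (noSign n)
            ∘ₗ γ.symm.pentMap (ZMod 2) (noSign n)
          + differential (ZMod 2) (noSign n) H
            ∘ₗ γ.symm.hexMap (ZMod 2) (noSign n)
          + γ.symm.hexMap (ZMod 2) (noSign n)
            ∘ₗ differential (ZMod 2) (noSign n) H = 0) ∧
      -- Coefficients in `ℤ`, for each sign assignment.
      ∀ S : RectSign n, IsSignAssignment S →
        IsFilteredComplex comp (differential ℤ S G) ∧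
        IsFilteredComplex comp (differential ℤ S H) ∧
        IsFilteredOfDegree comp 0 (γ.pentMap ℤ S) ∧
        IsFilteredOfDegree comp 0 (γ.symm.pentMap ℤ S) ∧
        IsFilteredOfDegree comp 1 (γ.hexMap ℤ S) ∧
        IsFilteredOfDegree comp 1 (γ.symm.hexMap ℤ S) ∧
        differential ℤ S H ∘ₗ γ.pentMap ℤ S
          + γ.pentMap ℤ S ∘ₗ differential ℤ S G = 0 ∧
        differential ℤ S G ∘ₗ γ.symm.pentMap ℤ S
          + γ.symm.pentMap ℤ S ∘ₗ differential ℤ S H = 0 ∧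
        LinearMap.id + γ.symm.pentMap ℤ S ∘ₗ γ.pentMap ℤ S
          + differential ℤ S G ∘ₗ γ.hexMap ℤ S
          + γ.hexMap ℤ S ∘ₗ differential ℤ S G = 0 ∧
        LinearMap.id + γ.pentMap ℤ S ∘ₗ γ.symm.pentMap ℤ S
          + differential ℤ S H ∘ₗ γ.symm.hexMap ℤ S
          + γ.symm.hexMap ℤ S ∘ₗ differential ℤ S H = 0 ∧
        InducesIsoOnHomology (differential ℤ S G)
          (differential ℤ S H) (γ.pentMap ℤ S) := by
  refine ⟨hGH.nonempty_curve, fun γ => ⟨?_, fun S hS => ?_⟩⟩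
  · have hσ := noSign_signRel_zmod n
    obtain ⟨h1, h2, h3⟩ := γ.map_relations hσ
    obtain ⟨h4, h5, h6⟩ := γ.symm.map_relations hσ
    exact ⟨⟨h1, isFilteredOfDegree_differential hcomp _⟩,
      ⟨h4, isFilteredOfDegree_differential (γ.isComponentNumbering hcomp) _⟩,
      γ.isFilteredOfDegree_pentMap hcomp _,
      γ.symm.isFilteredOfDegree_pentMap (γ.isComponentNumbering hcomp) _,
      γ.isFilteredOfDegree_hexMap hcomp _,
      γ.symm.isFilteredOfDegree_hexMap (γ.isComponentNumbering hcomp) _,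
      eq_of_add_eq_zero_of_charTwo h2, eq_of_add_eq_zero_of_charTwo h5, h3, h6⟩
  · obtain ⟨h1, h2, h3⟩ := γ.map_relations (k := ℤ) (hS.signRel _)
    obtain ⟨h4, h5, h6⟩ := γ.symm.map_relations (k := ℤ) (hS.signRel _)
    exact ⟨⟨h1, isFilteredOfDegree_differential hcomp _⟩,
      ⟨h4, isFilteredOfDegree_differential (γ.isComponentNumbering hcomp) _⟩,
      γ.isFilteredOfDegree_pentMap hcomp _,
      γ.symm.isFilteredOfDegree_pentMap (γ.isComponentNumbering hcomp) _,
      γ.isFilteredOfDegree_hexMap hcomp _,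
      γ.symm.isFilteredOfDegree_hexMap (γ.isComponentNumbering hcomp) _,
      h2, h5, h3, h6, inducesIsoOnHomology h2 h5 h3 h6⟩
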